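/- **Setting.** A template is a finite relational structure $\mathbb B$ over a finite relational vocabulary $L$; an instance of $\mathrm{CSP}(\mathbb B)$ is a finite $L$-structure $\mathbb A$ (with domain $A$), satisfiable if there is a homomorphism $\mathbb A\to\mathbb B$. **Reductions.** Let $\mathbb B'$ (over $L'$) be obtained from $\mathbb B$ (over $L$) by a finite sequence of the constructions (a)–(c) below. Each construction, leading from $\mathbb C$ to $\mathbb C'$, comes with a transformation of instances of $\mathrm{CSP}(\mathbb C')$ into instances of $\mathrm{CSP}(\mathbb C)$; the composition of these transformations sends an $L'$-structure $\mathbb A$ to an $L$-structure $\mathbb A'$. (a) *pp-interpretation*: there are $n\ge 1$ and a surjective partial function $f\colon C^n\rightharpoonup C'$ such that the domain of $f$, the preimage of equality and the preimage of every relation $R(\mathbb C')$ are defined in $\mathbb C$ by pp-formulas (built from relation symbols and equality by conjunction and existential quantification); let $\varphi_R$ be the formula for $R$. An instance $\mathbb A$ is transformed as follows: take the set $A\times[n]$; for every tuple $(a_1,\dots,a_r)\in R(\mathbb A)$ add a fresh element for every quantified variable of $\varphi_R$, and add all relational atoms of $\varphi_R$, with its free variables interpreted as $(a_1,1),\dots,(a_1,n),\dots,(a_r,n)$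 and its quantified variables as the fresh elements; finally take the quotient by the equivalence relation generated by the equality atoms of the formulas $\varphi_R$ interpreted in the same way. (b) *homomorphic equivalence*: $\mathbb C'$ has the same vocabulary as $\mathbb C$, and there are homomorphisms $\mathbb C\to\mathbb C'$ and $\mathbb C'\to\mathbb C$. Instances are unchanged. (c) *constants*: $\mathbb C$ is a core (all its endomorphisms are surjective) and $\mathbb C'$ is its expansion by new unary relations $R_b=\{b\}$, $b\in C$. An instance $\mathbb A$ is transformed into the structure on the disjoint union $A\sqcup C$ in which each $R$ from the vocabulary of $\mathbb C$ is interpreted as $R(\mathbb A)\cup R(\mathbb C)\cup\bigcup\{R(\mathbb C)_{b:=a} : b\in C,\ a\in R_b(\mathbb A)\}$, where $R(\mathbb C)_{b:=a}$ is $R(\mathbb C)$ with every occurrence of $b$ replaced by $a$. **Encodings.** For an instance $\mathbb A$ of $\mathrm{CSP}(\mathbb B)$ there are variables $X(a,b)$ and twin variables $\bar X(a,b)$ for $a\in A$, $b\in B$. The axioms are $X^2-X=0$, $\bar X^2-\bar X=0$, $X+\bar X-1=0$ and $X\ge0$, $\bar X\ge0$, $1-X\ge0$, $1-\bar X\ge0$,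 $1\ge 0$; an equation $P=0$ stands for the two inequalities $P\ge0$, $-P\ge0$. A *semi-algebraic encoding scheme* $E$ for $\mathrm{CSP}(\mathbb B)$ assigns to every instance $\mathbb A$ a finite set $E(\mathbb A)$ of real polynomial inequalities in these variables, such that a $\{0,1\}$-evaluation satisfying the axioms satisfies $E(\mathbb A)$ if and only if $\{(a,b): X(a,b)=1\}$ is the graph of a homomorphism $\mathbb A\to\mathbb B$. It is *local* if it is invariant under isomorphisms of instances and each $E(\mathbb A)$ is the union of the encodings of the one-element structures on $\{a\}$ with empty relations, $a\in A$, and of the structures on $\{a_1,\dots,a_r\}$ whose only tuple is $(a_1,\dots,a_r)$ in $R$, for all $R$ and $(a_1,\dots,a_r)\in R(\mathbb A)$. **Proof systems.** A refutation of a set $H$ of inequalities is a sequence of inequalities $P\ge 0$ ending with $-1\ge0$, each of which is in $H$, is an axiom, or follows from earlier ones by an allowed rule. In LS the rules are addition and multiplication by a positive scalar or by a variable (or twin variable); in $\mathrm{LS}^+$ one may also write down $P^2\ge0$ for any $P$. SA and $\mathrm{SA}^+$ are LS and $\mathrm{LS}^+$ with all multiplications preceding all additions. In SOS, one may write down $P^2\ge0$,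 inequalities may be multiplied by squares and equations (from $H$ or the axioms) by arbitrary polynomials, and all multiplications precede all additions. The degree is the maximal total degree of a polynomial in the sequence; the size is the number of symbols when the polynomials are written as explicit sums of monomials (every real coefficient counted as one symbol). **Theorem.** Let $\mathbb B'$ be obtained from $\mathbb B$ as above, and let $E$ and $E'$ be local semi-algebraic encoding schemes for $\mathrm{CSP}(\mathbb B)$ and $\mathrm{CSP}(\mathbb B')$, respectively. There are a constant $c$ and a polynomial $p$ such that for each of the systems SA, $\mathrm{SA}^+$, SOS, LS, $\mathrm{LS}^+$, for all positive integers $k$ and $s$, and for every finite $L'$-structure $\mathbb A$: if $E(\mathbb A')$ has a refutation of degree at most $k$ and size at most $s$ in the system, then $E'(\mathbb A)$ has a refutation of degree at most $c\,k$ and size at most $p(2^k,s,|A|)$ in the same system. -/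

import Mathlib

open scoped FirstOrder

namespace CSPClosure

open FirstOrder.Language.Structure (RelMap)

/-! ### Finite relational structures and constraint languages

A relational vocabulary is a `FirstOrder.Language` without function symbols; homomorphisms and
isomorphisms of structures are Mathlib's `→[L]` and `≃[L]`. -/

/-- A finite structure over the vocabulary `L`. -/
structure FinStr (L : FirstOrder.Language.{0, 0}) where
  dom : Type
  [str : L.Structure dom]
  [fin : Finite dom]

attribute [instance] FinStr.str FinStr.fin

/-- The finite structure over a relational vocabulary with given domain and relations. -/
def FinStr.ofRel (L : FirstOrder.Language.{0, 0}) [L.IsRelational] (D : Type) [Finite D]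
    (r : ∀ n, L.Relations n → (Fin n → D) → Prop) : FinStr L where
  dom := D
  str := { funMap := fun {_} f => isEmptyElim f, RelMap := fun {n} R x => r n R x }

/-- A constraint language (template): a finite relational vocabulary `L` and a finite
`L`-structure `B`. -/
structure Template where
  L : FirstOrder.Language.{0, 0}
  [relational : L.IsRelational]
  [finiteSymbols : Finite (Σ n, L.Relations n)]
  B : FinStr L

attribute [instance] Template.relational Template.finiteSymbols

/-! ### Primitive positive formulas and pp-interpretations -/

/-- Primitive positive formulas over `L` whose free variables are indexed by `α`.  In `ex φ` the
quantified variable is `none`, the other variables of `φ` are `some i`. -/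
inductive PPFormula (L : FirstOrder.Language.{0, 0}) : Type → Type 1
  | eq {α : Type} (i j : α) : PPFormula L α
  | rel {α : Type} {n : ℕ} (R : L.Relations n) (t : Fin n → α) : PPFormula L α
  | and {α : Type} (φ ψ : PPFormula L α) : PPFormula L α
  | ex {α : Type} (φ : PPFormula L (Option α)) : PPFormula L α

namespace PPFormula

variable {L : FirstOrder.Language.{0, 0}}

/-- Truth of a pp-formula in a structure under the assignment `e` of its free variables. -/
def Realize {D : Type} [L.Structure D] : ∀ {α : Type}, PPFormula L α → (α → D) → Prop
  | _, eq i j, e => e i = e j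
  | _, rel R t, e => RelMap R (fun k => e (t k))
  | _, and φ ψ, e => φ.Realize e ∧ ψ.Realize e
  | _, ex φ, e => ∃ d : D, φ.Realize (fun o => o.elim d e)

/-- The occurrences of existential quantifiers in a pp-formula. -/
def Wit : ∀ {α : Type}, PPFormula L α → Type
  | _, eq _ _ => Empty
  | _, rel _ _ => Empty
  | _, and φ ψ => φ.Wit ⊕ ψ.Wit
  | _, ex φ => Option φ.Wit

instance finite_wit : ∀ {α : Type} (φ : PPFormula L α), Finite φ.Wit
  | _, eq _ _ => inferInstanceAs (Finite Empty)
  | _, rel _ _ => inferInstanceAs (Finite Empty)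
  | _, and φ ψ =>
    have := finite_wit φ
    have := finite_wit ψ
    inferInstanceAs (Finite (φ.Wit ⊕ ψ.Wit))
  | _, ex φ =>
    have := finite_wit φ
    inferInstanceAs (Finite (Option φ.Wit))

/-- `φ.RelAtom e w S x`: when the free variables of `φ` are replaced according to `e` and its
quantified variables according to `w`, one of the relational atoms of `φ` becomes `S(x)`. -/
def RelAtom {D : Type} : ∀ {α : Type} (φ : PPFormula L α), (α → D) → (φ.Wit → D) →
    ∀ n : ℕ, L.Relations n → (Fin n → D) → Prop
  | _, eq _ _, _, _, _, _, _ => False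
  | _, @rel _ _ m R t, e, _, n, S, x =>
      (⟨n, S, x⟩ : Σ n, L.Relations n × (Fin n → D)) = ⟨m, R, fun k => e (t k)⟩
  | _, and φ ψ, e, w, n, S, x =>
      φ.RelAtom e (fun v => w (Sum.inl v)) n S x ∨ ψ.RelAtom e (fun v => w (Sum.inr v)) n S x
  | _, ex φ, e, w, n, S, x =>
      φ.RelAtom (fun o => o.elim (w none) e) (fun v => w (some v)) n S x

/-- `φ.EqAtom e w x y`: after the same replacement one of the equality atoms of `φ` becomes
`x = y`. -/
def EqAtom {D : Type} : ∀ {α : Type} (φ : PPFormula L α), (α → D) → (φ.Wit → D) → D → D → Prop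
  | _, eq i j, e, _, x, y => x = e i ∧ y = e j
  | _, rel _ _, _, _, _, _ => False
  | _, and φ ψ, e, w, x, y =>
      φ.EqAtom e (fun v => w (Sum.inl v)) x y ∨ ψ.EqAtom e (fun v => w (Sum.inr v)) x y
  | _, ex φ, e, w, x, y =>
      φ.EqAtom (fun o => o.elim (w none) e) (fun v => w (some v)) x y

end PPFormula

/-- A pp-interpretation of `V` in `U`: a surjective partial function `f` from `U.B ^ n` to `V.B`,
`n ≥ 1`, with pp-formulas over the vocabulary of `U` that define the domain of `f`, the preimage of
the equality relation and the preimages of all relations of `V`. -/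
structure PPInterpretation (U V : Template) where
  n : ℕ
  n_pos : 0 < n
  f : (Fin n → U.B.dom) →. V.B.dom
  surj : ∀ b : V.B.dom, ∃ x, b ∈ f x
  domF : PPFormula U.L (Fin n)
  domF_iff : ∀ x : Fin n → U.B.dom, domF.Realize x ↔ ∃ b, b ∈ f x
  eqF : PPFormula U.L (Fin 2 × Fin n)
  eqF_iff : ∀ x : Fin 2 → Fin n → U.B.dom,
    eqF.Realize (fun q => x q.1 q.2) ↔ ∃ b, b ∈ f (x 0) ∧ b ∈ f (x 1)
  relF : ∀ {r : ℕ}, V.L.Relations r → PPFormula U.L (Fin r × Fin n)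
  relF_iff : ∀ {r : ℕ} (R : V.L.Relations r) (x : Fin r → Fin n → U.B.dom),
    (relF R).Realize (fun q => x q.1 q.2) ↔
      ∃ b : Fin r → V.B.dom, (∀ i, b i ∈ f (x i)) ∧ RelMap R b

/-- The tuples in the relations of a structure. -/
def FinStr.Tuple {L : FirstOrder.Language.{0, 0}} (A : FinStr L) : Type :=
  {q : Σ r, L.Relations r × (Fin r → A.dom) // RelMap q.2.1 q.2.2}

instance {L : FirstOrder.Language.{0, 0}} [Finite (Σ n, L.Relations n)] (A : FinStr L) :
    Finite A.Tuple := by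
  have : Finite (Σ r, L.Relations r × (Fin r → A.dom)) :=
    Finite.of_injective
      (β := Σ q : (Σ n, L.Relations n), (Fin q.1 → A.dom))
      (fun q => ⟨⟨q.1, q.2.1⟩, q.2.2⟩) (by
        rintro ⟨r, R, t⟩ ⟨r', R', t'⟩ h
        simp only [Sigma.mk.injEq] at h
        obtain ⟨⟨h1, h2⟩, h3⟩ := h
        subst h1
        obtain rfl := eq_of_heq h2
        obtain rfl := eq_of_heq h3
        rfl)
  exact inferInstanceAs (Finite {q : Σ r, L.Relations r × (Fin r → A.dom) //
    RelMap q.2.1 q.2.2})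

namespace PPInterpretation

variable {U V : Template} (I : PPInterpretation U V)

/-- The domain of the instance of `U` before identification of elements: `n` copies of every
element of `A` and, for every tuple in a relation `R` of `A`, fresh witnesses for the quantified
variables of the formula that defines `R`. -/
abbrev PreDom (A : FinStr V.L) : Type :=
  (A.dom × Fin I.n) ⊕ (Σ q : A.Tuple, (I.relF q.1.2.1).Wit)

/-- The values of the free variables of the formula that belongs to the tuple `q`. -/
def freeVal (A : FinStr V.L) (q : A.Tuple) : Fin q.1.1 × Fin I.n → I.PreDom A :=
  fun p => Sum.inl (q.1.2.2 p.1, p.2)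

/-- The values of the quantified variables of the formula that belongs to the tuple `q`. -/
def witVal (A : FinStr V.L) (q : A.Tuple) : (I.relF q.1.2.1).Wit → I.PreDom A :=
  fun w => Sum.inr ⟨q, w⟩

/-- The instance of `U` that corresponds to the instance `A` of `V`: every tuple of a relation of
`A` is replaced by the atoms of its defining formula, and then the structure is quotiented by the
equivalence relation generated by the equality atoms. -/
def inst (A : FinStr V.L) : FinStr U.L :=
  FinStr.ofRel U.L
    (Quot fun x y : I.PreDom A =>
      ∃ q : A.Tuple, (I.relF q.1.2.1).EqAtom (I.freeVal A q) (I.witVal A q) x y)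
    (fun m S z => ∃ (q : A.Tuple) (x : Fin m → I.PreDom A),
      (I.relF q.1.2.1).RelAtom (I.freeVal A q) (I.witVal A q) m S x ∧ z = fun i => Quot.mk _ (x i))

end PPInterpretation

/-! ### Adding constants to a core -/

/-- A structure is a core if all its endomorphisms are surjective. -/
def FinStr.IsCore {L : FirstOrder.Language.{0, 0}} (B : FinStr L) : Prop :=
  ∀ h : B.dom →[L] B.dom, Function.Surjective h

/-- One unary relation symbol for every `b : B`. -/
inductive ConstSymbol (B : Type) : ℕ → Type
  | R (b : B) : ConstSymbol B 1

/-- The vocabulary of the unary relation symbols `R b`, `b : B`. -/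
def constLang (B : Type) : FirstOrder.Language.{0, 0} := ⟨fun _ => Empty, ConstSymbol B⟩

instance (B : Type) : (constLang B).IsRelational := fun _ => inferInstanceAs (IsEmpty Empty)

instance (L : FirstOrder.Language.{0, 0}) [Finite (Σ n, L.Relations n)] (B : Type) [Finite B] :
    Finite (Σ n, (L.sum (constLang B)).Relations n) := by
  refine Finite.of_surjective
    (fun x : (Σ n, L.Relations n) ⊕ B => match x with
      | Sum.inl q => (⟨q.1, Sum.inl q.2⟩ : Σ n, (L.sum (constLang B)).Relations n)
      | Sum.inr b => ⟨1, Sum.inr (ConstSymbol.R b)⟩) ?_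
  rintro ⟨n, R | R⟩
  · exact ⟨Sum.inl ⟨n, R⟩, rfl⟩
  · cases R with
    | R b => exact ⟨Sum.inr b, rfl⟩

/-- The expansion of a template by the unary relations `{b}`, `b ∈ B`. -/
def Template.withConstants (U : Template) : Template where
  L := U.L.sum (constLang U.B.dom)
  B := FinStr.ofRel _ U.B.dom fun n R => match n, R with
    | _, Sum.inl R => fun x => RelMap R x
    | _, Sum.inr (ConstSymbol.R b) => fun x => x 0 = b

open Classical in
/-- The instance of `U` that corresponds to an instance `A` of the expansion of `U` by constants:
the disjoint union of `A` and `U.B`, with, for every `a ∈ R_b(A)`, additional copies of all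
tuples of `U.B` with all occurrences of `b` replaced by `a`. -/
def constInst (U : Template) (A : FinStr U.withConstants.L) : FinStr U.L :=
  FinStr.ofRel U.L (A.dom ⊕ U.B.dom) fun m S z =>
    (∃ x : Fin m → A.dom,
      RelMap (L := U.withConstants.L) (Sum.inl S) x ∧
        z = fun i => Sum.inl (x i)) ∨
    (∃ y : Fin m → U.B.dom, RelMap S y ∧ z = fun i => Sum.inr (y i)) ∨
    (∃ (b : U.B.dom) (a : A.dom) (y : Fin m → U.B.dom),
      RelMap (L := U.withConstants.L) (Sum.inr (ConstSymbol.R b)) ![a] ∧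
        RelMap S y ∧
        z = fun i => if y i = b then Sum.inl a else Sum.inr (y i))

/-! ### Finite sequences of constructions -/

/-- `Reduction T T'`: a way to obtain the template `T'` from `T` by a finite sequence of
pp-interpretations, homomorphic equivalences and additions of constants to a core. -/
inductive Reduction (T : Template) : Template → Type 1
  | refl : Reduction T T
  | interp {U V : Template} (ρ : Reduction T U) (I : PPInterpretation U V) : Reduction T V
  | homEquiv {U : Template} (ρ : Reduction T U) (C : FinStr U.L)
      (h : Nonempty (U.B.dom →[U.L] C.dom)) (h' : Nonempty (C.dom →[U.L] U.B.dom)) :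
      Reduction T { L := U.L, B := C }
  | constants {U : Template} (ρ : Reduction T U) (h : U.B.IsCore) : Reduction T U.withConstants

/-- The transformation of instances of `CSP(T')` into instances of `CSP(T)`. -/
def Reduction.inst {T : Template} : ∀ {T' : Template}, Reduction T T' → FinStr T'.L → FinStr T.L
  | _, refl, A => A
  | _, interp ρ I, A => ρ.inst (I.inst A)
  | _, homEquiv ρ _ _ _, A => ρ.inst A
  | _, constants (U := U) ρ _, A => ρ.inst (constInst U A)

/-! ### Polynomials with twin variables -/

/-- Real polynomials in the variables `X v` and their twins, for `v : σ`. -/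
abbrev Poly (σ : Type) : Type := MvPolynomial (σ ⊕ σ) ℝ

/-- The variable `X v`. -/
noncomputable def var {σ : Type} (v : σ) : Poly σ := MvPolynomial.X (Sum.inl v)

/-- The twin variable of `X v`, which stands for `1 - X v`. -/
noncomputable def twin {σ : Type} (v : σ) : Poly σ := MvPolynomial.X (Sum.inr v)

/-- Renaming of variables, and of their twins accordingly. -/
noncomputable def renameVars {σ τ : Type} (g : σ → τ) (P : Poly σ) : Poly τ :=
  MvPolynomial.rename (Sum.map g g) P

/-- The number of symbols of the inequality `P ≥ 0` with `P` written as an explicit sum of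
monomials: one for every coefficient, one for every occurrence of a variable in a monomial, and one
for the sign `≥ 0`. -/
noncomputable def polySize {σ : Type} (P : Poly σ) : ℕ := 1 + ∑ m ∈ P.support, (1 + m.degree)

/-- The inequalities `P ≥ 0` imposed on the variables in all proof systems (`P` is listed); an
equation `P = 0` is the pair `P ≥ 0`, `-P ≥ 0`. -/
inductive Basic {σ : Type} : Poly σ → Prop
  | sq (v : σ) : Basic (var v ^ 2 - var v)
  | sq_neg (v : σ) : Basic (-(var v ^ 2 - var v))
  | twin_sq (v : σ) : Basic (twin v ^ 2 - twin v)
  | twin_sq_neg (v : σ) : Basic (-(twin v ^ 2 - twin v))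
  | sum (v : σ) : Basic (var v + twin v - 1)
  | sum_neg (v : σ) : Basic (-(var v + twin v - 1))
  | nonneg (v : σ) : Basic (var v)
  | twin_nonneg (v : σ) : Basic (twin v)
  | le_one (v : σ) : Basic (1 - var v)
  | twin_le_one (v : σ) : Basic (1 - twin v)
  | one : Basic 1

/-! ### Semi-algebraic proof systems -/

/-- Sherali-Adams, Positive Semidefinite Sherali-Adams, Sums-of-Squares, Lovász-Schrijver and
Positive Semidefinite Lovász-Schrijver. -/
inductive ProofSystem
  | SA
  | SAplus
  | SOS
  | LS
  | LSplus

namespace ProofSystem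

/-- The systems with the rule that derives `P ^ 2 ≥ 0`. -/
def HasSquares : ProofSystem → Prop
  | SA => False
  | SAplus => True
  | SOS => True
  | LS => False
  | LSplus => True

/-- The systems in which all multiplications precede all additions. -/
def IsStatic : ProofSystem → Prop
  | SA => True
  | SAplus => True
  | SOS => True
  | LS => False
  | LSplus => False

/-- `P ≥ 0` is a hypothesis from `H`, one of the basic inequalities, or, in the systems that allow
it, an instance of positivity of squares. -/
def Initial {σ : Type} (S : ProofSystem) (H : Set (Poly σ)) (P : Poly σ) : Prop :=
  P ∈ H ∨ Basic P ∨ (S.HasSquares ∧ ∃ Q, P = Q ^ 2)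

/-- `P ≥ 0` follows by the multiplication rule from the previous lines `prev`.  In SOS,
inequalities are multiplied by squares and equations by arbitrary polynomials; in the other systems
inequalities are multiplied by positive scalars and by variables. -/
def Mult {σ : Type} (S : ProofSystem) (H : Set (Poly σ)) (prev : List (Poly σ)) (P : Poly σ) :
    Prop :=
  match S with
  | SOS =>
    (∃ Q ∈ prev, ∃ R, P = Q * R ^ 2) ∨
    (∃ Q R, (Q ∈ H ∨ Basic Q) ∧ (-Q ∈ H ∨ Basic (-Q)) ∧ P = Q * R)
  | _ =>
    (∃ Q ∈ prev, ∃ c : ℝ, 0 < c ∧ P = MvPolynomial.C c * Q) ∨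
    (∃ Q ∈ prev, ∃ v : σ, P = Q * var v ∨ P = Q * twin v)

/-- `P ≥ 0` follows by the addition rule from the previous lines `prev`. -/
def Add {σ : Type} (prev : List (Poly σ)) (P : Poly σ) : Prop :=
  ∃ Q ∈ prev, ∃ R ∈ prev, P = Q + R

/-- `π` is a refutation of the system of inequalities `P ≥ 0`, `P ∈ H`: a sequence of inequalities
that follow from the previous ones by the rules of the system, and that ends with `-1 ≥ 0`. In the
static systems no multiplication occurs after an addition (`m` separates the two phases). -/
def IsRefutation {σ : Type} (S : ProofSystem) (H : Set (Poly σ)) (π : List (Poly σ)) : Prop :=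
  (∃ m : ℕ, ∀ (i : ℕ) (hi : i < π.length),
    S.Initial H π[i] ∨
    ((S.IsStatic → i < m) ∧ S.Mult H (π.take i) π[i]) ∨
    ((S.IsStatic → m ≤ i) ∧ Add (π.take i) π[i])) ∧
  π.getLast? = some (-1)

/-- There is a refutation of degree (at most) `k` and size (at most) `s`: all polynomials have total
degree at most `k`, and their sizes add up to at most `s`. -/
def Refutes {σ : Type} (S : ProofSystem) (H : Set (Poly σ)) (k s : ℕ) : Prop :=
  ∃ π : List (Poly σ), S.IsRefutation H π ∧ (∀ P ∈ π, P.totalDegree ≤ k) ∧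
    (π.map polySize).sum ≤ s

end ProofSystem

/-! ### Local semi-algebraic encoding schemes -/

/-- A semi-algebraic encoding scheme for `CSP(T)`: it assigns to every instance `A` a finite system
of inequalities `P ≥ 0` in the variables `X(a, b)` and their twins, such that the evaluations in
`{0, 1}` that satisfy it and the basic inequalities correspond exactly to the homomorphisms. -/
structure EncodingScheme (T : Template) where
  sys : (A : FinStr T.L) → Set (Poly (A.dom × T.B.dom))
  finite_sys : ∀ A, (sys A).Finite
  correct : ∀ (A : FinStr T.L) (v : (A.dom × T.B.dom) ⊕ (A.dom × T.B.dom) → ℝ),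
    (∀ x, v x = 0 ∨ v x = 1) → (∀ P, Basic P → 0 ≤ MvPolynomial.eval v P) →
      ((∀ P ∈ sys A, 0 ≤ MvPolynomial.eval v P) ↔
        ∃ h : A.dom →[T.L] T.B.dom, ∀ a b, v (Sum.inl (a, b)) = 1 ↔ h a = b)

/-- The structure with the single element `a` and with all relations empty. -/
def pointStr {L : FirstOrder.Language.{0, 0}} [L.IsRelational] (A : FinStr L) (a : A.dom) :
    FinStr L :=
  FinStr.ofRel L ({a} : Set A.dom) fun _ _ _ => False

/-- The structure whose elements are those of the tuple `t` and whose only non-empty relation is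
`R`, with the single tuple `t` in it. -/
def tupleStr {L : FirstOrder.Language.{0, 0}} [L.IsRelational] (A : FinStr L) {r : ℕ}
    (R : L.Relations r) (t : Fin r → A.dom) : FinStr L :=
  FinStr.ofRel L (Set.range t) fun m S x =>
    (⟨m, S, fun i => (x i : A.dom)⟩ : Σ m, L.Relations m × (Fin m → A.dom)) = ⟨r, R, t⟩

/-- An encoding scheme is local if it is invariant under isomorphisms and the encoding of every
instance is the union of the encodings of its elements and of the tuples in its relations. -/
structure EncodingScheme.IsLocal {T : Template} (E : EncodingScheme T) : Prop where
  invariant : ∀ (A A' : FinStr T.L) (g : A.dom ≃[T.L] A'.dom),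
    E.sys A' = renameVars (fun x : A.dom × T.B.dom => (g x.1, x.2)) '' E.sys A
  union : ∀ A : FinStr T.L, E.sys A =
    (⋃ a : A.dom,
      renameVars (fun x : ({a} : Set A.dom) × T.B.dom => ((x.1 : A.dom), x.2)) ''
        E.sys (pointStr A a)) ∪
    (⋃ (r : ℕ) (R : T.L.Relations r) (t : Fin r → A.dom) (_ : RelMap R t),
      renameVars (fun x : Set.range t × T.B.dom => ((x.1 : A.dom), x.2)) ''
        E.sys (tupleStr A R t))

end CSPClosure

/-! A refutation of `E(A')` is carried to `E'(A)` by a substitution of polynomials. Each element `x`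
of `A'` gets a value that depends on the values of boundedly many elements of `A` (a `Gadget`). The
variable `X(x, b)` is replaced by the sum of the products of variables of `A` over those assignments
that give `x` the value `b`, and its twin by the complementary sum. A substitution is linear, so it
preserves additions. It turns multiplication by a variable into multiplication by monomials with
coefficient `1`, so it also respects nonnegativity. Degrees grow by a constant factor. A monomial of
degree at most `k` becomes at most `M ^ k` monomials, and this is the source of `2 ^ k` in the size
bound.

It remains to derive the images of the hypotheses and axioms. By locality each of them concerns
boundedly many variables, and `exists_cone_bounds` makes such derivations a semantic matter: an
inequality that holds at all 0-1 points satisfying some derivable inequalities in the same variables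
has a static derivation with uniform bounds. The proof multiplies by the indicator monomials `cube
α`, whose sum is `1` modulo the basic equations. Hence it suffices that the gadget values form a
homomorphism wherever the local constraints of `A` hold (`exists_translates_bounds`).

For homomorphic equivalence the gadget applies a homomorphism. For constants it fixes every element
of the template. For a pp-interpretation it chooses a preimage tuple for each value and witnesses
for the quantified variables. Identified elements may be linked only by a long chain of equality
atoms, and then their equality is not a local consequence. The equalities along a simple path are
therefore added up (`Cone.of_eqvGen`), at a cost polynomial in the size of `A`.

The systems are treated by `transfer_SA`, `transfer_LS` and `transfer_SOS`. SOS needs two more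
facts: a monomial equals its square modulo the basic equations, and a cofactor cannot have many more
terms than the product (`terms_cofactor_le`). Constructions are composed through the direct encoding
of the intermediate templates. -/

namespace CSPClosure

open MvPolynomial

/-! ### Sequences of derivation steps -/

section Built

variable {α : Type*}

/-- The list `L`, read from its end to its beginning, is a derivation: every element follows by
`step` from those behind it. -/
def Built (step : List α → α → Prop) : List α → Prop
  | [] => True
  | p :: L => step L p ∧ Built step L

/-- A step remains possible when there are more previous lines. -/
def Monotonic (step : List α → α → Prop) : Prop :=
  ∀ ⦃L L' : List α⦄ ⦃p : α⦄, L ⊆ L' → step L p → step L' p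

theorem Monotonic.over {step : List α → α → Prop} (hm : Monotonic step) (L : List α) :
    Monotonic fun K => step (K ++ L) := fun _ _ _ h =>
  hm (List.append_subset.2 ⟨fun _ hx => List.mem_append_left _ (h hx),
    fun _ hx => List.mem_append_right _ hx⟩)

theorem Built.imp {step step' : List α → α → Prop} (h : ∀ L p, step L p → step' L p) :
    ∀ {L : List α}, Built step L → Built step' L
  | [], _ => trivial
  | _ :: _, hL => ⟨h _ _ hL.1, hL.2.imp h⟩

theorem Built.append {step : List α → α → Prop} (hm : Monotonic step) {L : List α}
    (h : Built step L) : ∀ {K : List α}, Built step K → Built step (K ++ L)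
  | [], _ => h
  | _ :: _, hK => ⟨hm (List.subset_append_left _ _) hK.1, h.append hm hK.2⟩

theorem Built.over {step : List α → α → Prop} {L : List α} (h : Built step L) :
    ∀ {K : List α}, Built (fun K => step (K ++ L)) K → Built step (K ++ L)
  | [], _ => h
  | _ :: _, hK => ⟨hK.1, h.over hK.2⟩

theorem Built.of_append {step : List α → α → Prop} {L : List α} :
    ∀ {K : List α}, Built step (K ++ L) → Built step L
  | [], h => h
  | _ :: _, h => Built.of_append h.2

/-- Derivations are stored with the newest line first, which suits induction. Reversal gives the
indexed form that `IsRefutation` requires. -/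
theorem Built.reverse_step {step : List α → α → Prop} (hm : Monotonic step) :
    ∀ {L : List α}, Built step L → ∀ (i : ℕ) (hi : i < L.reverse.length),
      step (L.reverse.take i) L.reverse[i]
  | [], _, i, hi => by simp at hi
  | p :: L, h, i, hi => by
    simp only [List.reverse_cons]
    rcases Nat.lt_or_ge i L.reverse.length with h1 | h1
    · rw [List.getElem_append_left h1, List.take_append_of_le_length h1.le]
      exact h.2.reverse_step hm i h1
    · have h2 : i = L.reverse.length := by
        simp only [List.length_reverse, List.length_cons] at hi h1 ⊢
        omega
      subst h2
      rw [List.getElem_append_right le_rfl, List.take_append_of_le_length le_rfl, List.take_length]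
      simp only [Nat.sub_self, List.getElem_cons_zero]
      exact hm (fun x hx => List.mem_reverse.2 hx) h.1

/-- `p` has a derivation of at most `n` lines, all of which satisfy `good`. -/
def Derivable (step : List α → α → Prop) (good : α → Prop) (n : ℕ) (p : α) : Prop :=
  ∃ K : List α, Built step K ∧ K.length ≤ n ∧ (∀ q ∈ K, good q) ∧ p ∈ K

theorem Derivable.single {step : List α → α → Prop} {good : α → Prop} {p : α} (h : step [] p)
    (hp : good p) : Derivable step good 1 p :=
  ⟨[p], ⟨h, trivial⟩, le_rfl, by simpa using hp, by simp⟩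

theorem Derivable.mono {step : List α → α → Prop} {good : α → Prop} {p : α} {n n' : ℕ}
    (h : Derivable step good n p) (hn : n ≤ n') : Derivable step good n' p := by
  obtain ⟨K, h1, h2, h3⟩ := h
  exact ⟨K, h1, h2.trans hn, h3⟩

theorem Derivable.good_mono {step : List α → α → Prop} {good good' : α → Prop} {p : α} {n : ℕ}
    (h : Derivable step good n p) (hg : ∀ q, good q → good' q) : Derivable step good' n p := by
  obtain ⟨K, h1, h2, h3, h4⟩ := h
  exact ⟨K, h1, h2, fun q hq => hg q (h3 q hq), h4⟩

theorem Derivable.next {step : List α → α → Prop} {good : α → Prop} {p q : α} {n : ℕ}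
    (h : Derivable step good n p) (hs : ∀ L, p ∈ L → step L q) (hq : good q) :
    Derivable step good (n + 1) q := by
  obtain ⟨K, h1, h2, h3, h4⟩ := h
  refine ⟨q :: K, ⟨hs _ h4, h1⟩, by simpa using h2, ?_, by simp⟩
  simpa [hq] using h3

theorem Derivable.list {step : List α → α → Prop} (hm : Monotonic step) {good : α → Prop} {n : ℕ} :
    ∀ {T : List α}, (∀ q ∈ T, Derivable step good n q) →
      ∃ K : List α, Built step K ∧ K.length ≤ T.length * n ∧ (∀ q ∈ K, good q) ∧ T ⊆ K
  | [], _ => ⟨[], trivial, by simp, by simp, by simp⟩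
  | p :: T, h => by
    obtain ⟨K, h1, h2, h3, h4⟩ := h p (by simp)
    obtain ⟨K', h1', h2', h3', h4'⟩ :=
      Derivable.list hm (T := T) fun q hq => h q (List.mem_cons_of_mem _ hq)
    refine ⟨K ++ K', h1'.append hm h1, ?_, ?_, ?_⟩
    · simp only [List.length_append, List.length_cons]
      linarith
    · intro q hq
      rcases List.mem_append.1 hq with hq | hq
      exacts [h3 q hq, h3' q hq]
    · intro q hq
      rcases List.mem_cons.1 hq with rfl | hq
      exacts [List.mem_append_left _ h4, List.mem_append_right _ (h4' hq)]

end Built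

/-! ### Degrees and numbers of terms -/

section Terms

variable {σ τ : Type}

/-- The number of monomials of a polynomial. -/
noncomputable def terms (P : Poly σ) : ℕ := P.support.card

/-- A bound on the degree and on the number of monomials. -/
def Bounded (D t : ℕ) (P : Poly σ) : Prop := P.totalDegree ≤ D ∧ terms P ≤ t

theorem terms_add_le (P Q : Poly σ) : terms (P + Q) ≤ terms P + terms Q := by
  classical
  exact (Finset.card_le_card MvPolynomial.support_add).trans (Finset.card_union_le _ _)

theorem terms_neg (P : Poly σ) : terms (-P) = terms P := by
  unfold terms
  rw [MvPolynomial.support_neg]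

theorem terms_sub_le (P Q : Poly σ) : terms (P - Q) ≤ terms P + terms Q := by
  rw [sub_eq_add_neg, ← terms_neg Q]
  exact terms_add_le _ _

theorem terms_zero : terms (0 : Poly σ) = 0 := by simp [terms]

theorem terms_mul_le (P Q : Poly σ) : terms (P * Q) ≤ terms P * terms Q := by
  classical
  exact (Finset.card_le_card (MvPolynomial.support_mul P Q)).trans Finset.card_add_le

theorem terms_monomial_le (e : (σ ⊕ σ) →₀ ℕ) (c : ℝ) : terms (monomial e c) ≤ 1 := by
  classical
  unfold terms
  refine (Finset.card_le_card MvPolynomial.support_monomial_subset).trans ?_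
  simp

theorem terms_C_le (c : ℝ) : terms (C c : Poly σ) ≤ 1 := terms_monomial_le 0 c

theorem terms_one_le : terms (1 : Poly σ) ≤ 1 := terms_C_le 1

theorem terms_X_le (u : σ ⊕ σ) : terms (X u : Poly σ) ≤ 1 := terms_monomial_le _ 1

theorem terms_mul_monomial_le (P : Poly σ) (e : (σ ⊕ σ) →₀ ℕ) (c : ℝ) :
    terms (P * monomial e c) ≤ terms P := by
  simpa using (terms_mul_le P (monomial e c)).trans (Nat.mul_le_mul_left _ (terms_monomial_le e c))

theorem terms_mul_C_le (P : Poly σ) (c : ℝ) : terms (P * C c) ≤ terms P :=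
  terms_mul_monomial_le P 0 c

theorem terms_C_mul_le (P : Poly σ) (c : ℝ) : terms (C c * P) ≤ terms P := by
  rw [mul_comm]
  exact terms_mul_C_le P c

theorem terms_mul_X_le (P : Poly σ) (u : σ ⊕ σ) : terms (P * X u) ≤ terms P :=
  terms_mul_monomial_le P _ 1

/-- Multiplication by a monomial shifts exponents injectively, so no terms cancel. In `transfer_SA`
this bounds the terms of an initial polynomial by those of the line in which it is a factor. -/
theorem terms_mul_monomial (P : Poly σ) (e : (σ ⊕ σ) →₀ ℕ) {c : ℝ} (hc : c ≠ 0) :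
    terms P ≤ terms (P * monomial e c) := by
  classical
  unfold terms
  rw [← Finset.card_map (addRightEmbedding e)]
  refine Finset.card_le_card fun x hx => ?_
  obtain ⟨y, hy, rfl⟩ := Finset.mem_map.1 hx
  rw [mem_support_iff] at hy ⊢
  simp only [addRightEmbedding_apply, coeff_mul_monomial]
  exact mul_ne_zero hy hc

theorem terms_C_mul (P : Poly σ) {c : ℝ} (hc : c ≠ 0) : terms P ≤ terms (C c * P) := by
  rw [mul_comm]
  exact terms_mul_monomial P 0 hc

theorem terms_list_sum_le {t : ℕ} : ∀ {L : List (Poly σ)}, (∀ P ∈ L, terms P ≤ t) →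
    terms L.sum ≤ L.length * t
  | [], _ => by simp [terms_zero]
  | P :: L, h => by
    have h1 := terms_list_sum_le (L := L) fun Q hQ => h Q (List.mem_cons_of_mem _ hQ)
    have h2 := h P (by simp)
    have h3 := terms_add_le P L.sum
    simp only [List.sum_cons, List.length_cons]
    linarith

theorem terms_finset_sum_le {ι : Type*} (s : Finset ι) (f : ι → Poly σ) :
    terms (∑ i ∈ s, f i) ≤ ∑ i ∈ s, terms (f i) := by
  classical
  induction s using Finset.induction_on with
  | empty => simp [terms_zero]
  | insert a s ha ih =>
    rw [Finset.sum_insert ha, Finset.sum_insert ha]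
    exact (terms_add_le _ _).trans (Nat.add_le_add_left ih _)

theorem totalDegree_list_sum_le {D : ℕ} : ∀ {L : List (Poly σ)}, (∀ P ∈ L, P.totalDegree ≤ D) →
    L.sum.totalDegree ≤ D
  | [], _ => by simp
  | P :: L, h => by
    have h1 := totalDegree_list_sum_le (L := L) fun Q hQ => h Q (List.mem_cons_of_mem _ hQ)
    rw [List.sum_cons]
    exact (totalDegree_add _ _).trans (max_le (h P (by simp)) h1)

theorem totalDegree_monomial_le' (e : (σ ⊕ σ) →₀ ℕ) (c : ℝ) :
    (monomial e c : Poly σ).totalDegree ≤ e.degree := by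
  rcases eq_or_ne c 0 with rfl | hc
  · simp
  · rw [totalDegree_monomial e hc]
    exact le_of_eq rfl

theorem totalDegree_mul_monomial_le (P : Poly σ) (e : (σ ⊕ σ) →₀ ℕ) (c : ℝ) :
    (P * monomial e c).totalDegree ≤ P.totalDegree + e.degree :=
  (totalDegree_mul _ _).trans (Nat.add_le_add_left (totalDegree_monomial_le' e c) _)

theorem totalDegree_C_mul_le (P : Poly σ) (c : ℝ) : (C c * P).totalDegree ≤ P.totalDegree := by
  simpa using totalDegree_mul (C c) P

theorem degree_le_totalDegree' {P : Poly σ} {e : (σ ⊕ σ) →₀ ℕ} (h : e ∈ P.support) :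
    e.degree ≤ P.totalDegree := le_totalDegree h

theorem Bounded.mono {D t D' t' : ℕ} {P : Poly σ} (h : Bounded D t P) (hD : D ≤ D')
    (ht : t ≤ t') : Bounded D' t' P := ⟨h.1.trans hD, h.2.trans ht⟩

theorem Bounded.list_sum {D t : ℕ} {L : List (Poly σ)} (h : ∀ P ∈ L, Bounded D t P) :
    Bounded D (L.length * t) L.sum :=
  ⟨totalDegree_list_sum_le fun P hP => (h P hP).1, terms_list_sum_le fun P hP => (h P hP).2⟩

/-- Degree and number of terms are easier to follow through substitutions than the size. This bound
and `terms_lt_polySize` translate between the two measures. -/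
theorem polySize_le {D t : ℕ} {P : Poly σ} (h : Bounded D t P) :
    polySize P ≤ 1 + t * (1 + D) := by
  unfold polySize
  have h1 : ∑ m ∈ P.support, (1 + m.degree) ≤ P.support.card • (1 + D) :=
    Finset.sum_le_card_nsmul _ _ _ fun m hm =>
      Nat.add_le_add_left ((degree_le_totalDegree' hm).trans h.1) 1
  have h2 : P.support.card ≤ t := h.2
  rw [smul_eq_mul] at h1
  have := Nat.mul_le_mul_right (1 + D) h2
  omega

theorem terms_lt_polySize (P : Poly σ) : terms P < polySize P := by
  unfold polySize terms
  rw [Finset.sum_add_distrib]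
  simp only [Finset.sum_const, smul_eq_mul, mul_one]
  omega

end Terms

/-! ### Assembling refutations -/

namespace ProofSystem

variable {σ : Type} (S : ProofSystem) (H : Set (Poly σ))

/-- The steps of the first phase of a refutation in a static system. -/
def StepM (L : List (Poly σ)) (P : Poly σ) : Prop := S.Initial H P ∨ S.Mult H L P

/-- The steps of the second phase of a refutation in a static system. -/
def StepA (L : List (Poly σ)) (P : Poly σ) : Prop := S.Initial H P ∨ Add L P

/-- The steps of a refutation in a dynamic system. -/
def Step (L : List (Poly σ)) (P : Poly σ) : Prop := S.Initial H P ∨ S.Mult H L P ∨ Add L P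

variable {S H}

theorem Mult.mono {L L' : List (Poly σ)} {P : Poly σ} (h : L ⊆ L') (hP : S.Mult H L P) :
    S.Mult H L' P := by
  cases S
  case SOS =>
    rcases hP with ⟨Q, hQ, R⟩ | R
    exacts [Or.inl ⟨Q, h hQ, R⟩, Or.inr R]
  all_goals
    rcases hP with ⟨Q, hQ, R⟩ | ⟨Q, hQ, R⟩
    exacts [Or.inl ⟨Q, h hQ, R⟩, Or.inr ⟨Q, h hQ, R⟩]

theorem Add.mono {L L' : List (Poly σ)} {P : Poly σ} (h : L ⊆ L') (hP : Add L P) : Add L' P := by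
  obtain ⟨Q, hQ, R, hR, e⟩ := hP
  exact ⟨Q, h hQ, R, h hR, e⟩

theorem monotonic_stepM : Monotonic (S.StepM H) := fun _ _ _ h hP =>
  hP.imp_right (Mult.mono h)

theorem monotonic_stepA : Monotonic (S.StepA H) := fun _ _ _ h hP =>
  hP.imp_right (Add.mono h)

theorem monotonic_step : Monotonic (S.Step H) := fun _ _ _ h hP =>
  hP.imp_right (Or.imp (Mult.mono h) (Add.mono h))

theorem sum_polySize_le {D t n : ℕ} {L : List (Poly σ)} (hL : ∀ P ∈ L, Bounded D t P)
    (hn : L.length ≤ n) : (L.map polySize).sum ≤ n * (1 + t * (1 + D)) := by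
  have h := List.sum_le_card_nsmul (L.map polySize) (1 + t * (1 + D)) (by
    intro x hx
    obtain ⟨P, hP, rfl⟩ := List.mem_map.1 hx
    exact polySize_le (hL P hP))
  rw [List.length_map, smul_eq_mul] at h
  exact h.trans (Nat.mul_le_mul_right _ hn)

theorem refutes_of_dynamic {D t n : ℕ} (hS : ¬ S.IsStatic) {L : List (Poly σ)}
    (hL : Built (S.Step H) L) (hb : ∀ P ∈ L, Bounded D t P) (hn : L.length ≤ n)
    (h1 : -1 ∈ L) : S.Refutes H D (n * (1 + t * (1 + D))) := by
  -- The newest lines come first, so `K` consists of the lines after `-1` and can be dropped.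
  obtain ⟨K, L, rfl⟩ := List.append_of_mem h1
  refine ⟨((-1) :: L).reverse, ⟨⟨0, fun i hi => ?_⟩, by simp⟩, ?_, ?_⟩
  · rcases (hL.of_append (K := K)).reverse_step monotonic_step i hi with h | h | h
    exacts [Or.inl h, Or.inr (Or.inl ⟨fun h => absurd h hS, h⟩),
      Or.inr (Or.inr ⟨fun h => absurd h hS, h⟩)]
  · intro P hP
    exact (hb P (List.mem_append_right _ (List.mem_reverse.1 hP))).1
  · refine sum_polySize_le (t := t) (fun P hP => hb P ?_) (le_trans ?_ hn)
    · exact List.mem_append_right _ (List.mem_reverse.1 hP)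
    · simp

/-- `L₁` is the multiplication phase and `L₂` the addition phase, so the separator of the two phases
is `L₁.length`. -/
theorem refutes_of_built_pair {D t n : ℕ} {L₁ L₂ : List (Poly σ)} (h₁ : Built (S.StepM H) L₁)
    (h₂ : Built (fun L => S.StepA H (L ++ L₁)) L₂) (hb : ∀ P ∈ L₂ ++ L₁, Bounded D t P)
    (hn : (L₂ ++ L₁).length ≤ n) (h : (L₂ ++ L₁).head? = some (-1)) :
    S.Refutes H D (n * (1 + t * (1 + D))) := by
  refine ⟨(L₂ ++ L₁).reverse, ⟨⟨L₁.length, fun i hi => ?_⟩, by simpa using h⟩, ?_, ?_⟩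
  · simp only [List.reverse_append]
    rcases Nat.lt_or_ge i L₁.reverse.length with hi' | hi'
    · rw [List.getElem_append_left hi', List.take_append_of_le_length hi'.le]
      rcases h₁.reverse_step monotonic_stepM i hi' with h | h
      · exact Or.inl h
      · exact Or.inr (Or.inl ⟨fun _ => by simpa using hi', h⟩)
    · rw [List.getElem_append_right hi', List.take_append]
      have := h₂.reverse_step (monotonic_stepA.over L₁) (i - L₁.reverse.length) (by
        simp only [List.length_reverse, List.length_append] at hi hi' ⊢
        omega)
      rcases this with h | h
      · exact Or.inl h
      · refine Or.inr (Or.inr ⟨fun _ => by simpa using hi', h.mono ?_⟩)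
        intro x hx
        rw [List.take_of_length_le hi']
        rcases List.mem_append.1 hx with hx | hx
        · exact List.mem_append_right _ hx
        · exact List.mem_append_left _ (List.mem_reverse.2 hx)
  · intro P hP
    exact (hb P (List.mem_reverse.1 hP)).1
  · exact sum_polySize_le (t := t) (fun P hP => hb P (List.mem_reverse.1 hP))
      (by simpa [add_comm] using hn)

theorem refutes_of_static {D t n : ℕ} {L₁ L₂ : List (Poly σ)} (h₁ : Built (S.StepM H) L₁)
    (h₂ : Built (fun L => S.StepA H (L ++ L₁)) L₂) (hb : ∀ P ∈ L₂ ++ L₁, Bounded D t P)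
    (hn : (L₂ ++ L₁).length ≤ n) (h : -1 ∈ L₂ ++ L₁) :
    S.Refutes H D (n * (1 + t * (1 + D))) := by
  rcases List.mem_append.1 h with h | h
  · obtain ⟨K, L, rfl⟩ := List.append_of_mem h
    refine refutes_of_built_pair h₁ (h₂.of_append (K := K)) (fun P hP => hb P ?_)
      (le_trans ?_ hn) (by simp)
    · rw [List.append_assoc]
      exact List.mem_append_right _ hP
    · simp only [List.length_append]
      omega
  -- Here `-1` occurs already in the multiplication phase, and no addition is needed.
  · obtain ⟨K, L, rfl⟩ := List.append_of_mem h
    refine refutes_of_built_pair (L₂ := []) (h₁.of_append (K := K)) trivial (fun P hP => hb P ?_)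
      (le_trans ?_ hn) (by simp)
    · exact List.mem_append_right _ (List.mem_append_right _ hP)
    · simp only [List.length_append, List.nil_append]
      omega

theorem Refutes.mono {k s k' s' : ℕ} (h : S.Refutes H k s) (hk : k ≤ k') (hs : s ≤ s') :
    S.Refutes H k' s' := by
  obtain ⟨π, h1, h2, h3⟩ := h
  exact ⟨π, h1, fun P hP => (h2 P hP).trans hk, h3.trans hs⟩

/-- Sums of previous lines can be derived. -/
theorem built_sum {step : List (Poly σ) → Poly σ → Prop} {B : List (Poly σ)}
    (hA : ∀ L P, Add (L ++ B) P → step L P) {L : List (Poly σ)} {D t : ℕ} (hL : Built step L) :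
    ∀ {T : List (Poly σ)}, T ≠ [] → (∀ P ∈ T, Bounded D t P) → T ⊆ L ++ B →
      ∃ K : List (Poly σ), Built step (K ++ L) ∧ K.length ≤ T.length ∧
        (∀ P ∈ K, Bounded D (T.length * t) P) ∧ T.sum ∈ K ++ L ++ B
  -- The empty sum is `0`, which need not be an available line. The simulations treat vanishing
  -- images separately for this reason.
  | [], h, _, _ => absurd rfl h
  | [P], _, _, hT => ⟨[], hL, by simp, by simp, by simpa using hT⟩
  | P :: Q :: T, _, hb, hT => by
    obtain ⟨K, h1, h2, h3, h4⟩ := built_sum hA (L := L) (D := D) (t := t) hL (T := Q :: T) (by simp)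
      (fun R hR => hb R (List.mem_cons_of_mem _ hR)) fun x hx => hT (List.mem_cons_of_mem _ hx)
    refine ⟨(P :: Q :: T).sum :: K, ⟨hA _ _ ⟨P, ?_, _, h4, by simp⟩, h1⟩, ?_, ?_, ?_⟩
    · rcases List.mem_append.1 (hT (List.mem_cons_self (a := P))) with h | h
      · exact List.mem_append_left _ (List.mem_append_right _ h)
      · exact List.mem_append_right _ h
    · simpa using h2
    · intro R hR
      rcases List.mem_cons.1 hR with rfl | hR
      · exact Bounded.list_sum hb
      · exact (h3 R hR).mono le_rfl (Nat.mul_le_mul_right _ (by simp))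
    · simp

end ProofSystem

/-! ### Static derivations with bounded parameters -/

section Cone

variable {σ τ : Type}

/-- A positive multiple of the product of a hypothesis or basic inequality with a monomial of
degree at most `D`. -/
def IsProd (H : Set (Poly σ)) (D : ℕ) (p : Poly σ) : Prop :=
  ∃ c : ℝ, 0 < c ∧ ∃ Q, (Q ∈ H ∨ Basic Q) ∧ ∃ e : (σ ⊕ σ) →₀ ℕ, e.degree ≤ D ∧
    p = C c * (Q * monomial e 1)

/-- The sums of at most `N` products of hypotheses or basic inequalities with monomials of degree
at most `D`. -/
def Cone (H : Set (Poly σ)) (D N : ℕ) (P : Poly σ) : Prop :=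
  ∃ L : List (Poly σ), P = L.sum ∧ L.length ≤ N ∧ ∀ p ∈ L, IsProd H D p

variable {H : Set (Poly σ)} {D D' N N' : ℕ} {P Q : Poly σ}

theorem IsProd.mono (h : IsProd H D P) (hD : D ≤ D') : IsProd H D' P := by
  obtain ⟨c, hc, Q, hQ, e, he, rfl⟩ := h
  exact ⟨c, hc, Q, hQ, e, he.trans hD, rfl⟩

theorem Cone.mono (h : Cone H D N P) (hD : D ≤ D') (hN : N ≤ N') : Cone H D' N' P := by
  obtain ⟨L, h1, h2, h3⟩ := h
  exact ⟨L, h1, h2.trans hN, fun p hp => (h3 p hp).mono hD⟩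

theorem Cone.zero : Cone H D N 0 := ⟨[], by simp, by simp, by simp⟩

theorem Cone.of_mem (h : P ∈ H ∨ Basic P) : Cone H D 1 P :=
  ⟨[P], by simp, by simp, by
    simp only [List.mem_singleton, forall_eq]
    exact ⟨1, one_pos, P, h, 0, by simp, by simp⟩⟩

theorem Cone.add (hP : Cone H D N P) (hQ : Cone H D N' Q) : Cone H D (N + N') (P + Q) := by
  obtain ⟨L, rfl, h2, h3⟩ := hP
  obtain ⟨L', rfl, h2', h3'⟩ := hQ
  refine ⟨L ++ L', by simp, by simpa using Nat.add_le_add h2 h2', fun p hp => ?_⟩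
  rcases List.mem_append.1 hp with hp | hp
  exacts [h3 p hp, h3' p hp]

theorem Cone.smul (hP : Cone H D N P) {c : ℝ} (hc : 0 ≤ c) : Cone H D N (C c * P) := by
  rcases hc.eq_or_lt with rfl | hc
  · simpa using Cone.zero
  obtain ⟨L, rfl, h2, h3⟩ := hP
  refine ⟨L.map (C c * ·), by simpa using (List.sum_map_mul_left L id (C c)).symm,
    by simpa using h2, ?_⟩
  intro p hp
  obtain ⟨q, hq, rfl⟩ := List.mem_map.1 hp
  obtain ⟨a, ha, Q, hQ, e, he, rfl⟩ := h3 q hq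
  exact ⟨c * a, mul_pos hc ha, Q, hQ, e, he, by rw [C_mul, mul_assoc]⟩

theorem Cone.mul_monomial (hP : Cone H D N P) (e : (σ ⊕ σ) →₀ ℕ) :
    Cone H (D + e.degree) N (P * monomial e 1) := by
  obtain ⟨L, rfl, h2, h3⟩ := hP
  refine ⟨L.map (· * monomial e 1), by simp [List.sum_map_mul_right], by simpa using h2, ?_⟩
  intro p hp
  obtain ⟨q, hq, rfl⟩ := List.mem_map.1 hp
  obtain ⟨a, ha, Q, hQ, e', he, rfl⟩ := h3 q hq
  refine ⟨a, ha, Q, hQ, e' + e, by rw [map_add]; omega, ?_⟩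
  rw [mul_assoc, mul_assoc, monomial_mul, one_mul]

theorem Cone.sum {ι : Type*} (s : Finset ι) (f : ι → Poly σ) (h : ∀ i ∈ s, Cone H D N (f i)) :
    Cone H D (s.card * N) (∑ i ∈ s, f i) := by
  classical
  induction s using Finset.induction_on with
  | empty => simpa using Cone.zero
  | insert a s ha ih =>
    rw [Finset.sum_insert ha, Finset.card_insert_of_notMem ha, Nat.succ_mul, Nat.add_comm]
    exact (h a (by simp)).add (ih fun i hi => h i (by simp [hi]))

theorem basic_renameVars (w : σ → τ) (h : Basic P) : Basic (renameVars w P) := by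
  have hv : ∀ v : σ, renameVars w (var v) = var (w v) := fun v => by
    simp [renameVars, var]
  have ht : ∀ v : σ, renameVars w (twin v) = twin (w v) := fun v => by
    simp [renameVars, twin]
  have h1 : renameVars w 1 = 1 := map_one (rename _)
  have hn : ∀ P, renameVars w (-P) = -renameVars w P := fun P => map_neg (rename _) P
  have hs : ∀ P Q, renameVars w (P - Q) = renameVars w P - renameVars w Q :=
    fun P Q => map_sub (rename _) P Q
  have ha : ∀ P Q, renameVars w (P + Q) = renameVars w P + renameVars w Q :=
    fun P Q => map_add (rename _) P Q
  have hp : ∀ P, renameVars w (P ^ 2) = renameVars w P ^ 2 := fun P => map_pow (rename _) P 2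
  cases h with
  | sq v => rw [hs, hp, hv]; exact Basic.sq _
  | sq_neg v => rw [hn, hs, hp, hv]; exact Basic.sq_neg _
  | twin_sq v => rw [hs, hp, ht]; exact Basic.twin_sq _
  | twin_sq_neg v => rw [hn, hs, hp, ht]; exact Basic.twin_sq_neg _
  | sum v => rw [hs, ha, hv, ht, h1]; exact Basic.sum _
  | sum_neg v => rw [hn, hs, ha, hv, ht, h1]; exact Basic.sum_neg _
  | nonneg v => rw [hv]; exact Basic.nonneg _
  | twin_nonneg v => rw [ht]; exact Basic.twin_nonneg _
  | le_one v => rw [hs, hv, h1]; exact Basic.le_one _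
  | twin_le_one v => rw [hs, ht, h1]; exact Basic.twin_le_one _
  | one => rw [h1]; exact Basic.one

/-- Without hypotheses only basic inequalities occur, and these are stable under any renaming,
injective or not. -/
theorem Cone.rename (w : σ → τ) {H' : Set (Poly τ)} (hP : Cone ∅ D N P) :
    Cone H' D N (renameVars w P) := by
  obtain ⟨L, rfl, h2, h3⟩ := hP
  refine ⟨L.map (renameVars w), ?_, by simpa using h2, ?_⟩
  · exact map_list_sum (MvPolynomial.rename (Sum.map w w)) L
  · intro p hp
    obtain ⟨q, hq, rfl⟩ := List.mem_map.1 hp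
    obtain ⟨a, ha, Q, hQ, e, he, rfl⟩ := h3 q hq
    refine ⟨a, ha, renameVars w Q, Or.inr (basic_renameVars w (by simpa using hQ)),
      e.mapDomain (Sum.map w w), ?_, ?_⟩
    · rw [Finsupp.degree_mapDomain]
      exact he
    · simp [renameVars, rename_monomial]

/-- Both `P` and `-P` have static derivations from the basic inequalities. -/
def ZeroCone (D N : ℕ) (P : Poly σ) : Prop := Cone ∅ D N P ∧ Cone ∅ D N (-P)

theorem ZeroCone.mono (h : ZeroCone D N P) (hD : D ≤ D') (hN : N ≤ N') : ZeroCone D' N' P :=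
  ⟨h.1.mono hD hN, h.2.mono hD hN⟩

/-- A negative scalar exchanges the derivations of `P` and `-P`. Hence scalars of either sign cost
nothing. -/
theorem ZeroCone.smul (hP : ZeroCone D N P) (c : ℝ) : ZeroCone D N (C c * P) := by
  rcases le_total 0 c with hc | hc
  · exact ⟨hP.1.smul hc, by rw [← mul_neg]; exact hP.2.smul hc⟩
  · have h : 0 ≤ -c := by linarith
    refine ⟨?_, ?_⟩
    · have := hP.2.smul h
      rwa [C_neg, neg_mul_neg] at this
    · have := hP.1.smul h
      rwa [C_neg, neg_mul] at this

theorem ZeroCone.add (hP : ZeroCone D N P) (hQ : ZeroCone D N' Q) :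
    ZeroCone D (N + N') (P + Q) :=
  ⟨hP.1.add hQ.1, by rw [neg_add]; exact hP.2.add hQ.2⟩

theorem ZeroCone.mul_monomial (hP : ZeroCone D N P) (e : (σ ⊕ σ) →₀ ℕ) (c : ℝ) :
    ZeroCone (D + e.degree) N (P * monomial e c) := by
  have : P * monomial e c = C c * (P * monomial e 1) := by
    rw [mul_left_comm, C_mul_monomial, mul_one]
  rw [this]
  exact ZeroCone.smul ⟨hP.1.mul_monomial e, by rw [← neg_mul]; exact hP.2.mul_monomial e⟩ c

theorem ZeroCone.sum {ι : Type*} (s : Finset ι) (f : ι → Poly σ)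
    (h : ∀ i ∈ s, ZeroCone D N (f i)) : ZeroCone D (s.card * N) (∑ i ∈ s, f i) :=
  ⟨Cone.sum s f fun i hi => (h i hi).1, by
    rw [← Finset.sum_neg_distrib]
    exact Cone.sum s _ fun i hi => (h i hi).2⟩

/-- The ideal generated by the basic equations. -/
noncomputable def basicIdeal (σ : Type) : Ideal (Poly σ) :=
  Ideal.span {P | Basic P ∧ Basic (-P)}

/-- The bounds depend on `P` here. Uniformity is obtained afterwards from linearity and finiteness.
-/
theorem exists_zeroCone_of_mem (h : P ∈ basicIdeal σ) : ∃ D N, ZeroCone D N P := by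
  induction h using Submodule.span_induction with
  | mem x hx => exact ⟨0, 1, Cone.of_mem (Or.inr hx.1), Cone.of_mem (Or.inr hx.2)⟩
  | zero => exact ⟨0, 0, Cone.zero, by simpa using Cone.zero⟩
  | add x y _ _ hx hy =>
    obtain ⟨D, N, h⟩ := hx
    obtain ⟨D', N', h'⟩ := hy
    exact ⟨D + D', N + N', (h.mono (by omega) le_rfl).add (h'.mono (by omega) le_rfl)⟩
  | smul a x _ hx =>
    obtain ⟨D, N, h⟩ := hx
    rw [smul_eq_mul, mul_comm]
    induction a using MvPolynomial.induction_on' with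
    | monomial e c => exact ⟨_, _, h.mul_monomial e c⟩
    | add p q hp hq =>
      obtain ⟨D, N, h⟩ := hp
      obtain ⟨D', N', h'⟩ := hq
      rw [mul_add]
      exact ⟨D + D', N + N', (h.mono (by omega) le_rfl).add (h'.mono (by omega) le_rfl)⟩

/-- A linear map with values in the ideal of the basic equations has static derivations of uniformly
bounded size on the polynomials of bounded degree. -/
theorem exists_zeroCone_bounds [Finite σ] (f : Poly σ →ₗ[ℝ] Poly σ)
    (hf : ∀ P, f P ∈ basicIdeal σ) (d : ℕ) :
    ∃ D N, ∀ P : Poly σ, P.totalDegree ≤ d → ZeroCone D N (f P) := by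
  classical
  -- Bounds are chosen monomial by monomial. Only finitely many monomials have degree at most `d`,
  -- and the coefficients of `P` enter merely as scalars.
  choose D N h using fun e : (σ ⊕ σ) →₀ ℕ => exists_zeroCone_of_mem (hf (monomial e 1))
  have hfin := Finsupp.finite_of_degree_le (σ := σ ⊕ σ) d
  set s := hfin.toFinset with hs
  refine ⟨s.sup D, s.card * s.sup N, fun P hP => ?_⟩
  have hPs : P = ∑ e ∈ s, coeff e P • monomial e (1 : ℝ) := by
    conv_lhs => rw [P.as_sum]
    refine (Finset.sum_subset (fun e he => ?_) fun e _ he => ?_).trans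
      (Finset.sum_congr rfl fun e _ => ?_)
    · rw [hs, Set.Finite.mem_toFinset]
      exact (degree_le_totalDegree' he).trans hP
    · rw [notMem_support_iff.1 he, monomial_zero]
    · rw [smul_monomial, smul_eq_mul, mul_one]
  rw [hPs, map_sum]
  refine ZeroCone.sum s _ fun e he => ?_
  rw [map_smul, smul_eq_C_mul]
  exact ((h e).smul _).mono (Finset.le_sup he) (Finset.le_sup he)

end Cone

/-! ### Local reasoning -/

section Local

variable {σ τ : Type}

/-- Evaluations in `{0, 1}` that respect twins. -/
def IsBool (v : σ ⊕ σ → ℝ) : Prop :=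
  (∀ u, v (Sum.inl u) = 0 ∨ v (Sum.inl u) = 1) ∧ ∀ u, v (Sum.inr u) = 1 - v (Sum.inl u)

theorem IsBool.zero_or_one {v : σ ⊕ σ → ℝ} (h : IsBool v) (x : σ ⊕ σ) : v x = 0 ∨ v x = 1 := by
  rcases x with u | u
  · exact h.1 u
  · rw [h.2 u]
    rcases h.1 u with h | h <;> simp [h]

theorem IsBool.basic {v : σ ⊕ σ → ℝ} (h : IsBool v) {P : Poly σ} (hP : Basic P) :
    0 ≤ eval v P := by
  cases hP with
  | sum u => simp [var, twin, h.2 u]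
  | sum_neg u => simp [var, twin, h.2 u]
  | one => simp
  | sq u | sq_neg u | nonneg u | le_one u => rcases h.1 u with h | h <;> simp [var, h]
  | twin_sq u | twin_sq_neg u | twin_nonneg u | twin_le_one u =>
    rcases h.zero_or_one (Sum.inr u) with h | h <;> simp [twin, h]

theorem isBool_of_basic {v : σ ⊕ σ → ℝ} (h : ∀ x, v x = 0 ∨ v x = 1)
    (hv : ∀ P, Basic P → 0 ≤ eval v P) : IsBool v := by
  refine ⟨fun u => h _, fun u => ?_⟩
  have h1 := hv _ (Basic.sum u)
  have h2 := hv _ (Basic.sum_neg u)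
  simp only [var, twin, map_neg, map_sub, map_add, eval_X, map_one] at h1 h2
  linarith

/-- The evaluation given by a set of true variables. -/
noncomputable def boolVal (α : σ → Bool) : σ ⊕ σ → ℝ :=
  Sum.elim (fun u => if α u then 1 else 0) (fun u => 1 - if α u then 1 else 0)

theorem isBool_boolVal (α : σ → Bool) : IsBool (boolVal α) :=
  ⟨fun u => by cases h : α u <;> simp [boolVal, h], fun _ => rfl⟩

theorem sq_sub_mem (x : σ ⊕ σ) : (X x ^ 2 - X x : Poly σ) ∈ basicIdeal σ := by
  rcases x with u | u
  · exact Ideal.subset_span ⟨Basic.sq u, Basic.sq_neg u⟩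
  · exact Ideal.subset_span ⟨Basic.twin_sq u, Basic.twin_sq_neg u⟩

theorem sum_sub_one_mem (u : σ) :
    (X (Sum.inl u) + X (Sum.inr u) - 1 : Poly σ) ∈ basicIdeal σ :=
  Ideal.subset_span ⟨Basic.sum u, Basic.sum_neg u⟩

theorem totalDegree_renameVars {w : σ → τ} (hw : Function.Injective w) (P : Poly σ) :
    (renameVars w P).totalDegree = P.totalDegree := by
  refine (totalDegree_rename_le _ P).antisymm (Finset.sup_le fun e he => ?_)
  have hw' : Function.Injective (Sum.map w w) := Sum.map_injective.2 ⟨hw, hw⟩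
  have h : e.mapDomain (Sum.map w w) ∈ (renameVars w P).support := by
    rw [mem_support_iff, renameVars, coeff_rename_mapDomain _ hw']
    exact mem_support_iff.1 he
  have h' := degree_le_totalDegree' h
  rw [Finsupp.degree_mapDomain] at h'
  exact h'

variable [Fintype σ]

/-- The exponent of the product of the literals that hold under `α`. -/
noncomputable def cubeExp (α : σ → Bool) : (σ ⊕ σ) →₀ ℕ :=
  ∑ i, Finsupp.single (if α i then Sum.inl i else Sum.inr i) 1

/-- The indicator polynomial of `α`. -/
noncomputable def cube (α : σ → Bool) : Poly σ := monomial (cubeExp α) 1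

theorem cube_eq_prod (α : σ → Bool) :
    cube α = ∏ i, (X (if α i then Sum.inl i else Sum.inr i) : Poly σ) := by
  unfold cube cubeExp
  rw [monomial_sum_one]
  rfl

theorem cubeExp_degree (α : σ → Bool) : (cubeExp α).degree = Fintype.card σ := by
  simp [cubeExp, map_sum]

/-- The sum of all indicators is the expansion of the product of the sums `X i + X̄ i`, and each
factor is `1` modulo the ideal. -/
theorem sum_cube_sub_one_mem [DecidableEq σ] :
    ∑ α : σ → Bool, cube α - 1 ∈ basicIdeal σ := by
  have h : ∑ α : σ → Bool, cube α = ∏ i : σ, (X (Sum.inl i) + X (Sum.inr i) : Poly σ) := by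
    have := (Finset.prod_univ_sum (fun _ : σ => (Finset.univ : Finset Bool))
      fun i b => (X (if b then Sum.inl i else Sum.inr i) : Poly σ)).symm
    rw [Fintype.piFinset_univ] at this
    simp only [Fintype.sum_bool, if_true, Bool.false_eq_true, if_false] at this
    rw [← this]
    exact Finset.sum_congr rfl fun α _ => cube_eq_prod α
  rw [h, ← Ideal.Quotient.eq, map_prod, map_one]
  refine Finset.prod_eq_one fun i _ => ?_
  rw [← map_one (Ideal.Quotient.mk (basicIdeal σ)), Ideal.Quotient.eq]
  exact sum_sub_one_mem i

/-- A literal that is true under `α` divides the indicator and is idempotent. For a false literal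
the indicator contains its twin, and the product of a variable with its twin lies in the ideal. -/
theorem X_mul_cube_mem (α : σ → Bool) (x : σ ⊕ σ) :
    X x * cube α - C (boolVal α x) * cube α ∈ basicIdeal σ := by
  classical
  -- `Sum.elim id id x` is the variable underlying the literal `x`. The literal of that variable
  -- which holds under `α` is split off the indicator.
  obtain ⟨R, hR⟩ : ∃ R : Poly σ, cube α = X (if α (Sum.elim id id x) then
      Sum.inl (Sum.elim id id x) else Sum.inr (Sum.elim id id x)) * R := by
    rw [cube_eq_prod]
    exact Finset.dvd_prod_of_mem _ (Finset.mem_univ _)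
  rw [hR]
  have key : ∀ y : σ ⊕ σ, X y * (X y * R) - C 1 * (X y * R) ∈ basicIdeal σ := fun y => by
    rw [show X y * (X y * R) - C 1 * (X y * R) = R * (X y ^ 2 - X y) by rw [C_1]; ring]
    exact Ideal.mul_mem_left _ _ (sq_sub_mem y)
  have key' : ∀ u : σ, X (Sum.inl u) * X (Sum.inr u) ∈ basicIdeal σ := fun u => by
    rw [show (X (Sum.inl u) * X (Sum.inr u) : Poly σ) =
      X (Sum.inl u) * (X (Sum.inl u) + X (Sum.inr u) - 1) -
        (X (Sum.inl u) ^ 2 - X (Sum.inl u)) by ring]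
    exact Ideal.sub_mem _ (Ideal.mul_mem_left _ _ (sum_sub_one_mem u)) (sq_sub_mem _)
  rcases x with u | u <;> cases hα : α u
  · simp only [Sum.elim_inl, id, hα, boolVal, Bool.false_eq_true, if_false, C_0, zero_mul, sub_zero]
    rw [← mul_assoc]
    exact Ideal.mul_mem_right _ _ (key' u)
  · simpa [hα, boolVal] using key (Sum.inl u)
  · simpa [hα, boolVal] using key (Sum.inr u)
  · simp only [Sum.elim_inr, id, hα, boolVal, if_true, sub_self, C_0, zero_mul, sub_zero]
    rw [← mul_assoc, mul_comm (X (Sum.inr u))]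
    exact Ideal.mul_mem_right _ _ (key' u)

theorem mul_cube_mem (α : σ → Bool) (P : Poly σ) :
    P * cube α - C (eval (boolVal α) P) * cube α ∈ basicIdeal σ := by
  induction P using MvPolynomial.induction_on with
  | C a => simp
  | add p q hp hq =>
    rw [map_add, C_add, add_mul, add_mul, add_sub_add_comm]
    exact Ideal.add_mem _ hp hq
  | mul_X p x hp =>
    rw [map_mul, eval_X, C_mul]
    have := Ideal.add_mem _ (Ideal.mul_mem_left _ (X x) hp)
      (Ideal.mul_mem_left _ (C (eval (boolVal α) p)) (X_mul_cube_mem α x))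
    convert this using 1
    ring

/-- The defect of a polynomial times an indicator. -/
noncomputable def cubeDefect (α : σ → Bool) : Poly σ →ₗ[ℝ] Poly σ :=
  LinearMap.mulRight ℝ (cube α) -
    (LinearMap.mulRight ℝ (cube α)).comp ((Algebra.linearMap ℝ (Poly σ)).comp
      (aeval (R := ℝ) (boolVal α)).toLinearMap)

theorem cubeDefect_apply (α : σ → Bool) (P : Poly σ) :
    cubeDefect α P = P * cube α - C (eval (boolVal α) P) * cube α := by
  simp [cubeDefect, algebraMap_eq, aeval_eq_eval]

/-- Modulo the ideal, `P` is the sum of the polynomials `P * cube α`, and each of these is `P(α) *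
cube α`. If `P(α) ≥ 0`, this is a multiple of the axiom `1` times a monomial. Otherwise some `g ∈ G`
is negative at `α`, and `(P(α) / g(α)) * g * cube α` serves instead. The errors are linear in `P`
and in `g`, so the bounds depend only on `σ` and `d`. -/
theorem exists_cone_bounds_fintype (d : ℕ) :
    ∃ D₁ N₁ : ℕ, ∀ {τ : Type} (H : Set (Poly τ)) (w : σ → τ) (P : Poly σ) (G : Set (Poly σ))
      (D₂ N₂ : ℕ), P.totalDegree ≤ d → (∀ g ∈ G, g.totalDegree ≤ d) →
      (∀ g ∈ G, Cone H D₂ N₂ (renameVars w g)) →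
      (∀ α : σ → Bool, (∀ g ∈ G, 0 ≤ eval (boolVal α) g) → 0 ≤ eval (boolVal α) P) →
      Cone H (D₂ + D₁) (N₁ * (N₂ + 1)) (renameVars w P) := by
  classical
  choose D N h using fun α : σ → Bool =>
    exists_zeroCone_bounds (cubeDefect α) (fun P => by
      rw [cubeDefect_apply]; exact mul_cube_mem α P) d
  obtain ⟨D', N', h'⟩ := exists_zeroCone_bounds
    (LinearMap.mulRight ℝ (1 - ∑ α : σ → Bool, cube α)) (fun P => by
      rw [LinearMap.mulRight_apply]
      refine Ideal.mul_mem_left _ _ ?_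
      rw [← neg_sub]
      exact neg_mem sum_cube_sub_one_mem) d
  set Ds := Finset.univ.sup D
  set Ns := Finset.univ.sup N
  have hDs : ∀ α, D α ≤ Ds := fun α => Finset.le_sup (Finset.mem_univ α)
  have hNs : ∀ α, N α ≤ Ns := fun α => Finset.le_sup (Finset.mem_univ α)
  refine ⟨D' + Ds + Fintype.card σ,
    N' + (Finset.univ : Finset (σ → Bool)).card * (1 + 2 * Ns), ?_⟩
  intro τ H w P G D₂ N₂ hP hG hH hsem
  have hr : ∀ P Q : Poly σ, renameVars w (P + Q) = renameVars w P + renameVars w Q :=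
    fun P Q => map_add (rename _) P Q
  have hrm : ∀ P Q : Poly σ, renameVars w (P * Q) = renameVars w P * renameVars w Q :=
    fun P Q => map_mul (rename _) P Q
  have hrC : ∀ c : ℝ, renameVars w (C c) = C c := fun c => rename_C _ c
  have hcube : ∀ (α : σ → Bool) (Q : Poly τ) (D N : ℕ), Cone H D N Q →
      Cone H (D + Fintype.card σ) N (Q * renameVars w (cube α)) := fun α Q D N hQ => by
    have h1 := hQ.mul_monomial ((cubeExp α).mapDomain (Sum.map w w))
    rw [Finsupp.degree_mapDomain, cubeExp_degree] at h1
    simpa [renameVars, cube, rename_monomial] using h1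
  have hcubeP : ∀ α : σ → Bool,
      Cone H (D₂ + (D' + Ds + Fintype.card σ)) ((1 + 2 * Ns) * (N₂ + 1))
        (renameVars w (P * cube α)) := by
    intro α
    have hdef : P * cube α = C (eval (boolVal α) P) * cube α + cubeDefect α P := by
      rw [cubeDefect_apply]; ring
    have hd : Cone H (D₂ + (D' + Ds + Fintype.card σ)) Ns (renameVars w (cubeDefect α P)) :=
      (h α P hP).1.rename w |>.mono (by have := hDs α; omega) (hNs α)
    rw [hdef, hr, hrm, hrC]
    rcases le_or_gt 0 (eval (boolVal α) P) with h0 | h0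
    · have h1 := (hcube α 1 0 1 (Cone.of_mem (Or.inr Basic.one))).smul h0
      rw [one_mul] at h1
      refine ((h1.mono (by omega) le_rfl).add hd).mono le_rfl ?_
      nlinarith
    · have : ∃ g ∈ G, eval (boolVal α) g < 0 := by
        by_contra hcon
        push Not at hcon
        exact absurd (hsem α hcon) (not_le.2 h0)
      obtain ⟨g, hg, hg0⟩ := this
      -- A quotient of two negative numbers is a legitimate positive multiplier for the inequality
      -- `g ≥ 0`.
      have hl : 0 ≤ eval (boolVal α) P / eval (boolVal α) g := (div_pos_of_neg_of_neg h0 hg0).le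
      have h1 := (hcube α _ _ _ (hH g hg)).smul hl
      have h2 : Cone H (D₂ + (D' + Ds + Fintype.card σ)) Ns (renameVars w (-cubeDefect α g)) :=
        (h α g (hG g hg)).2.rename w |>.mono (by have := hDs α; omega) (hNs α)
      have h3 := h2.smul hl
      have h4 := (((h1.mono (by omega) le_rfl).add h3).add hd).mono le_rfl
        (show N₂ + Ns + Ns ≤ (1 + 2 * Ns) * (N₂ + 1) by nlinarith)
      convert h4 using 2
      rw [← hrm, ← mul_add, ← hr, ← hrC, ← hrm, ← hrC, ← hrm]
      congr 1
      rw [cubeDefect_apply, neg_sub, add_sub_cancel, ← mul_assoc, ← C_mul,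
        div_mul_cancel₀ _ hg0.ne]
  have hsum : P = P * (1 - ∑ α : σ → Bool, cube α) + ∑ α : σ → Bool, P * cube α := by
    rw [← Finset.mul_sum]; ring
  rw [hsum, hr]
  have e1 : renameVars w (∑ α : σ → Bool, P * cube α) =
      ∑ α : σ → Bool, renameVars w (P * cube α) := map_sum (rename _) _ _
  rw [e1]
  have h5 := Cone.sum Finset.univ _ fun α _ => hcubeP α
  have h6 : Cone H (D₂ + (D' + Ds + Fintype.card σ)) N'
      (renameVars w (P * (1 - ∑ α : σ → Bool, cube α))) :=
    (h' P hP).1.rename w |>.mono (by omega) le_rfl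
  refine (h6.add h5).mono le_rfl ?_
  nlinarith [Nat.zero_le (N' * N₂)]

/-- The literals of the variables in `W`. -/
def literals (W : Set τ) : Set (τ ⊕ τ) := {x | Sum.elim id id x ∈ W}

/-- Inequalities in a bounded number of variables that hold for all evaluations in `{0, 1}` that
satisfy some derivable inequalities in the same variables are derivable. -/
theorem exists_cone_bounds (n d : ℕ) :
    ∃ D₁ N₁ : ℕ, ∀ {τ : Type} (H : Set (Poly τ)) (W : Finset τ) (P : Poly τ) (G : Set (Poly τ))
      (D₂ N₂ : ℕ), W.card ≤ n → P.totalDegree ≤ d → P ∈ supported ℝ (literals (W : Set τ)) →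
      (∀ g ∈ G, g.totalDegree ≤ d ∧ g ∈ supported ℝ (literals (W : Set τ)) ∧ Cone H D₂ N₂ g) →
      (∀ v : τ ⊕ τ → ℝ, IsBool v → (∀ g ∈ G, 0 ≤ eval v g) → 0 ≤ eval v P) →
      Cone H (D₂ + D₁) (N₁ * (N₂ + 1)) P := by
  classical
  -- Every `W` is renamed to `Fin W.card`, so the maximum of the bounds over all cardinalities up to
  -- `n` is uniform.
  choose D N h using fun m : ℕ => exists_cone_bounds_fintype (σ := Fin m) d
  refine ⟨(Finset.range (n + 1)).sup D, (Finset.range (n + 1)).sup N, ?_⟩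
  intro τ H W P G D₂ N₂ hW hPd hPW hG hsem
  have hm : W.card ∈ Finset.range (n + 1) := Finset.mem_range.2 (by omega)
  set w : Fin W.card → τ := fun i => (W.equivFin.symm i : τ) with hw
  have hwi : Function.Injective w :=
    Subtype.val_injective.comp W.equivFin.symm.injective
  have hwi' : Function.Injective (Sum.map w w) := Sum.map_injective.2 ⟨hwi, hwi⟩
  have hex : ∀ Q : Poly τ, Q ∈ supported ℝ (literals (W : Set τ)) →
      ∃ Q₀ : Poly (Fin W.card), renameVars w Q₀ = Q := fun Q hQ => by
    refine exists_rename_eq_of_vars_subset_range Q (Sum.map w w) hwi' ?_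
    refine (mem_supported.1 hQ).trans ?_
    rintro (x | x) hx
    · exact ⟨Sum.inl (W.equivFin ⟨x, hx⟩), by simp [hw]⟩
    · exact ⟨Sum.inr (W.equivFin ⟨x, hx⟩), by simp [hw]⟩
  have hdeg : ∀ Q : Poly (Fin W.card), Q.totalDegree = (renameVars w Q).totalDegree := fun Q =>
    (totalDegree_renameVars hwi Q).symm
  obtain ⟨P₀, rfl⟩ := hex P hPW
  refine (h W.card H w P₀ {g | renameVars w g ∈ G} D₂ N₂ (by rwa [hdeg])
    (fun g hg => by rw [hdeg]; exact (hG _ hg).1) (fun g hg => (hG _ hg).2.2) ?_).mono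
    (Nat.add_le_add_left (Finset.le_sup hm) _) (Nat.mul_le_mul_right _ (Finset.le_sup hm))
  intro α hα
  -- All polynomials concerned involve only `W`, so any extension of `α` would do.
  set v : τ ⊕ τ → ℝ := boolVal (Function.extend w α fun _ => false) with hv
  have hvw : v ∘ Sum.map w w = boolVal α := by
    funext x
    rcases x with i | i <;> simp [hv, boolVal, hwi.extend_apply]
  have := hsem v (isBool_boolVal _) (fun g hg => by
    obtain ⟨g₀, rfl⟩ := hex g (hG g hg).2.1
    have := hα g₀ hg
    rwa [renameVars, eval_rename, hvw])
  rwa [renameVars, eval_rename, hvw] at this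

end Local

/-! ### Simulation of refutations along linear maps -/

namespace ProofSystem

variable {σ τ : Type} {S : ProofSystem} {H : Set (Poly σ)} {H' : Set (Poly τ)}

theorem IsRefutation.length_le {π : List (Poly σ)} {s : ℕ} (h : (π.map polySize).sum ≤ s) :
    π.length ≤ s := by
  have h1 := List.card_nsmul_le_sum (π.map polySize) 1 (by
    intro x hx
    obtain ⟨P, _, rfl⟩ := List.mem_map.1 hx
    exact Nat.le_add_right _ _)
  simp only [List.length_map, smul_eq_mul, mul_one] at h1
  exact h1.trans h

theorem terms_le_of_mem {π : List (Poly σ)} {s : ℕ} (h : (π.map polySize).sum ≤ s) {P : Poly σ}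
    (hP : P ∈ π) : terms P ≤ s :=
  (terms_lt_polySize P).le.trans ((List.single_le_sum (fun _ _ => Nat.zero_le _) _
    (List.mem_map_of_mem hP)).trans h)

/-- The bound on the size of a simulating refutation. -/
def simSize (s N ℓ t D : ℕ) : ℕ := s * (N * ℓ + N + 1) * (1 + t * (1 + D))

/-- `F` describes the lines of the multiplication phase in closed form. The image of such a line is
a sum of polynomials derived in the new multiplication phase `L₁`, and the summation itself goes
into the addition phase `L₂`. By linearity of `Φ`, an addition is simulated by one addition. The
factor `N + 1` in the number of terms accounts for the partial sums. -/
theorem static_simulation (hS : S.IsStatic) (Φ : Poly σ →ₗ[ℝ] Poly τ) (hΦ : Φ (-1) = -1)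
    {F : Poly σ → Prop} (hF₀ : ∀ P, S.Initial H P → F P)
    (hF₁ : ∀ prev P, (∀ Q ∈ prev, F Q) → S.Mult H prev P → F P) {k s D t N ℓ : ℕ}
    (hT : ∀ P, F P → P.totalDegree ≤ k → terms P ≤ s → Φ P = 0 ∨
      ∃ T : List (Poly τ), Φ P = T.sum ∧ T.length ≤ N ∧
        ∀ q ∈ T, Derivable (S.StepM H') (Bounded D t) ℓ q)
    (hb : ∀ P : Poly σ, P.totalDegree ≤ k → terms P ≤ s → Bounded D t (Φ P))
    (h : S.Refutes H k s) : S.Refutes H' D (simSize s N ℓ ((N + 1) * t) D) := by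
  obtain ⟨π, ⟨⟨m, hm⟩, hlast⟩, hk, hs⟩ := h
  have hbt : ∀ {P : Poly τ}, Bounded D t P → Bounded D ((N + 1) * t) P := fun hP =>
    hP.mono le_rfl (Nat.le_mul_of_pos_left _ (by omega))
  have hFm : ∀ i (hi : i < π.length), i < m → F π[i] := by
    intro i
    induction i using Nat.strong_induction_on with
    | _ i ih =>
      intro hi him
      rcases hm i hi with h | ⟨_, h⟩ | ⟨h, _⟩
      · exact hF₀ _ h
      · refine hF₁ _ _ (fun Q hQ => ?_) h
        obtain ⟨j, hj, rfl⟩ := List.mem_take_iff_getElem.1 hQ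
        have hj' : j < i := by omega
        exact ih j hj' (by omega) (by omega)
      · exact absurd (h hS) (by omega)
  have key : ∀ j ≤ π.length, ∃ L₁ L₂ : List (Poly τ), Built (S.StepM H') L₁ ∧
      Built (fun L => S.StepA H' (L ++ L₁)) L₂ ∧ (L₂ ++ L₁).length ≤ j * (N * ℓ + N + 1) ∧
      (∀ P ∈ L₂ ++ L₁, Bounded D ((N + 1) * t) P) ∧
      ∀ i (hi : i < π.length), i < j → Φ π[i] = 0 ∨ Φ π[i] ∈ L₂ ++ L₁ := by
    intro j
    induction j with
    | zero => exact fun _ => ⟨[], [], trivial, trivial, by simp, by simp, by simp⟩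
    | succ j ih =>
      intro hj
      obtain ⟨L₁, L₂, h1, h2, h3, h4, h5⟩ := ih (by omega)
      have hkj := hk _ (List.getElem_mem (show j < π.length by omega))
      have hsj := terms_le_of_mem hs (List.getElem_mem (show j < π.length by omega))
      have hle : j * (N * ℓ + N + 1) ≤ (j + 1) * (N * ℓ + N + 1) :=
        Nat.mul_le_mul_right _ (by omega)
      have hzero : Φ π[j] = 0 ∨ Φ π[j] ∈ L₂ ++ L₁ → ∃ L₁ L₂ : List (Poly τ),
          Built (S.StepM H') L₁ ∧
          Built (fun L => S.StepA H' (L ++ L₁)) L₂ ∧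
          (L₂ ++ L₁).length ≤ (j + 1) * (N * ℓ + N + 1) ∧
          (∀ P ∈ L₂ ++ L₁, Bounded D ((N + 1) * t) P) ∧
          ∀ i (hi : i < π.length), i < j + 1 → Φ π[i] = 0 ∨ Φ π[i] ∈ L₂ ++ L₁ := fun h0 => by
        refine ⟨L₁, L₂, h1, h2, h3.trans hle, h4, fun i hi hij => ?_⟩
        rcases Nat.lt_succ_iff_lt_or_eq.1 hij with hij | rfl
        exacts [h5 i hi hij, h0]
      have hstatic : F π[j] → ∃ L₁ L₂ : List (Poly τ),
          Built (S.StepM H') L₁ ∧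
          Built (fun L => S.StepA H' (L ++ L₁)) L₂ ∧
          (L₂ ++ L₁).length ≤ (j + 1) * (N * ℓ + N + 1) ∧
          (∀ P ∈ L₂ ++ L₁, Bounded D ((N + 1) * t) P) ∧
          ∀ i (hi : i < π.length), i < j + 1 → Φ π[i] = 0 ∨ Φ π[i] ∈ L₂ ++ L₁ := fun hF => by
        rcases hT _ hF hkj hsj with h0 | ⟨T, hTs, hTN, hTd⟩
        · exact hzero (Or.inl h0)
        rcases eq_or_ne T [] with rfl | hTn
        · exact hzero (Or.inl (by simpa using hTs))
        obtain ⟨K, hK1, hK2, hK3, hK4⟩ := Derivable.list monotonic_stepM hTd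
        have h2' : Built (fun L => S.StepA H' (L ++ (K ++ L₁))) L₂ :=
          h2.imp fun L p hp => monotonic_stepA (by
            intro x hx
            rcases List.mem_append.1 hx with hx | hx <;> simp [hx]) hp
        obtain ⟨K', hK1', hK2', hK3', hK4'⟩ := built_sum (B := K ++ L₁) (D := D) (t := t)
          (fun L P hP => Or.inr hP) h2' hTn (fun P hP => hK3 P (hK4 hP))
          (fun P hP => List.mem_append_right _ (List.mem_append_left _ (hK4 hP)))
        refine ⟨K ++ L₁, K' ++ L₂, h1.append monotonic_stepM hK1, hK1', ?_, ?_, ?_⟩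
        · have e1 : K.length ≤ N * ℓ := hK2.trans (Nat.mul_le_mul_right _ hTN)
          have e2 := hK2'.trans hTN
          simp only [List.length_append] at h3 ⊢
          linarith
        · intro P hP
          simp only [List.mem_append] at hP
          rcases hP with (hP | hP) | hP | hP
          · exact (hK3' P hP).mono le_rfl (Nat.mul_le_mul_right _ (by omega))
          · exact h4 P (by simp [hP])
          · exact hbt (hK3 P hP)
          · exact h4 P (by simp [hP])
        · intro i hi hij
          rcases Nat.lt_succ_iff_lt_or_eq.1 hij with hij | rfl
          · refine (h5 i hi hij).imp_right fun hmem => ?_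
            rcases List.mem_append.1 hmem with hmem | hmem <;> simp [hmem]
          · rw [hTs]
            exact Or.inr hK4'
      rcases hm j (by omega) with h | ⟨h, h'⟩ | ⟨_, Q, hQ, R, hR, hQR⟩
      · exact hstatic (hF₀ _ h)
      · exact hstatic (hFm _ _ (h hS))
      · obtain ⟨a, ha, rfl⟩ := List.mem_take_iff_getElem.1 hQ
        obtain ⟨b, hb', rfl⟩ := List.mem_take_iff_getElem.1 hR
        have ha' := h5 a (by omega) (by omega)
        have hb'' := h5 b (by omega) (by omega)
        -- If the image of one summand vanishes, the image of the sum is that of the other summand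
        -- and no line is added.
        rcases ha' with ha' | ha'
        · refine hzero ?_
          rw [hQR, map_add, ha', zero_add]
          exact hb''
        rcases hb'' with hb'' | hb''
        · refine hzero (Or.inr ?_)
          rwa [hQR, map_add, hb'', add_zero]
        refine ⟨L₁, Φ π[j] :: L₂, h1, ⟨Or.inr ⟨_, ha', _, hb'', ?_⟩, h2⟩, ?_, ?_, ?_⟩
        · rw [hQR, map_add]
        · simp only [List.length_append, List.length_cons] at h3 ⊢
          linarith [Nat.zero_le (N * ℓ + N)]
        · intro P hP
          rcases List.mem_cons.1 hP with rfl | hP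
          · exact hbt (hb _ hkj hsj)
          · exact h4 P hP
        · intro i hi hij
          rcases Nat.lt_succ_iff_lt_or_eq.1 hij with hij | rfl
          · exact (h5 i hi hij).imp_right (List.mem_cons_of_mem _)
          · exact Or.inr (by simp)
  obtain ⟨L₁, L₂, h1, h2, h3, h4, h5⟩ := key π.length le_rfl
  refine refutes_of_static h1 h2 h4
    (h3.trans (Nat.mul_le_mul_right _ (IsRefutation.length_le hs))) ?_
  rw [List.getLast?_eq_getElem?] at hlast
  obtain ⟨hi, hlast⟩ := List.getElem?_eq_some_iff.1 hlast
  have := h5 _ hi (by omega)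
  rw [hlast, hΦ] at this
  exact this.resolve_left (by simp)

/-- In a dynamic system a multiplication may use any earlier line, so the lines have no closed form.
The image of a new line is instead derived from the list `L`, which contains the nonzero images of
the earlier lines. -/
theorem dynamic_simulation (hS : ¬ S.IsStatic) (Φ : Poly σ →ₗ[ℝ] Poly τ) (hΦ : Φ (-1) = -1)
    {k s D t N ℓ : ℕ}
    (hT : ∀ (L : List (Poly τ)) (prev : List (Poly σ)) (P : Poly σ),
      (∀ Q ∈ prev, (Q.totalDegree ≤ k ∧ terms Q ≤ s) ∧ (Φ Q = 0 ∨ Φ Q ∈ L)) →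
      P.totalDegree ≤ k → terms P ≤ s → (S.Initial H P ∨ S.Mult H prev P) → Φ P = 0 ∨
      ∃ T : List (Poly τ), Φ P = T.sum ∧ T.length ≤ N ∧
        ∀ q ∈ T, Derivable (fun K => S.Step H' (K ++ L)) (Bounded D t) ℓ q)
    (hb : ∀ P : Poly σ, P.totalDegree ≤ k → terms P ≤ s → Bounded D t (Φ P))
    (h : S.Refutes H k s) : S.Refutes H' D (simSize s N ℓ ((N + 1) * t) D) := by
  obtain ⟨π, ⟨⟨m, hm⟩, hlast⟩, hk, hs⟩ := h
  have hbt : ∀ {P : Poly τ}, Bounded D t P → Bounded D ((N + 1) * t) P := fun hP =>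
    hP.mono le_rfl (Nat.le_mul_of_pos_left _ (by omega))
  have key : ∀ j ≤ π.length, ∃ L : List (Poly τ), Built (S.Step H') L ∧
      L.length ≤ j * (N * ℓ + N + 1) ∧
      (∀ P ∈ L, Bounded D ((N + 1) * t) P) ∧
      ∀ i (hi : i < π.length), i < j → Φ π[i] = 0 ∨ Φ π[i] ∈ L := by
    intro j
    induction j with
    | zero => exact fun _ => ⟨[], trivial, by simp, by simp, by simp⟩
    | succ j ih =>
      intro hj
      obtain ⟨L, h1, h3, h4, h5⟩ := ih (by omega)
      have hkj := hk _ (List.getElem_mem (show j < π.length by omega))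
      have hsj := terms_le_of_mem hs (List.getElem_mem (show j < π.length by omega))
      have hle : j * (N * ℓ + N + 1) ≤ (j + 1) * (N * ℓ + N + 1) :=
        Nat.mul_le_mul_right _ (by omega)
      have hzero : Φ π[j] = 0 ∨ Φ π[j] ∈ L → ∃ L : List (Poly τ),
          Built (S.Step H') L ∧ L.length ≤ (j + 1) * (N * ℓ + N + 1) ∧
          (∀ P ∈ L, Bounded D ((N + 1) * t) P) ∧
          ∀ i (hi : i < π.length), i < j + 1 → Φ π[i] = 0 ∨ Φ π[i] ∈ L := fun h0 => by
        refine ⟨L, h1, h3.trans hle, h4, fun i hi hij => ?_⟩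
        rcases Nat.lt_succ_iff_lt_or_eq.1 hij with hij | rfl
        exacts [h5 i hi hij, h0]
      have hstatic : S.Initial H π[j] ∨ S.Mult H (π.take j) π[j] → ∃ L : List (Poly τ),
          Built (S.Step H') L ∧ L.length ≤ (j + 1) * (N * ℓ + N + 1) ∧
          (∀ P ∈ L, Bounded D ((N + 1) * t) P) ∧
          ∀ i (hi : i < π.length), i < j + 1 → Φ π[i] = 0 ∨ Φ π[i] ∈ L := fun hF => by
        rcases hT L (π.take j) _ (fun Q hQ => by
          obtain ⟨a, ha, rfl⟩ := List.mem_take_iff_getElem.1 hQ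
          exact ⟨⟨hk _ (List.getElem_mem _), terms_le_of_mem hs (List.getElem_mem _)⟩,
            h5 a (by omega) (by omega)⟩) hkj hsj hF with h0 | ⟨T, hTs, hTN, hTd⟩
        · exact hzero (Or.inl h0)
        rcases eq_or_ne T [] with rfl | hTn
        · exact hzero (Or.inl (by simpa using hTs))
        obtain ⟨K, hK1, hK2, hK3, hK4⟩ := Derivable.list (monotonic_step.over L) hTd
        obtain ⟨K', hK1', hK2', hK3', hK4'⟩ := built_sum (B := []) (D := D) (t := t)
          (step := S.Step H')
          (fun L P hP => Or.inr (Or.inr (by simpa using hP))) (h1.over hK1) hTn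
          (fun P hP => hK3 P (hK4 hP))
          (fun P hP => List.mem_append_left _ (List.mem_append_left _ (hK4 hP)))
        refine ⟨K' ++ (K ++ L), hK1', ?_, ?_, ?_⟩
        · have e1 : K.length ≤ N * ℓ := hK2.trans (Nat.mul_le_mul_right _ hTN)
          have e2 := hK2'.trans hTN
          simp only [List.length_append] at h3 ⊢
          linarith
        · intro P hP
          simp only [List.mem_append] at hP
          rcases hP with hP | hP | hP
          · exact (hK3' P hP).mono le_rfl (Nat.mul_le_mul_right _ (by omega))
          · exact hbt (hK3 P hP)
          · exact h4 P hP
        · intro i hi hij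
          rcases Nat.lt_succ_iff_lt_or_eq.1 hij with hij | rfl
          · refine (h5 i hi hij).imp_right fun hmem => ?_
            simp [hmem]
          · rw [hTs]
            exact Or.inr (by simpa using hK4')
      rcases hm j (by omega) with h | ⟨_, h⟩ | ⟨_, Q, hQ, R, hR, hQR⟩
      · exact hstatic (Or.inl h)
      · exact hstatic (Or.inr h)
      · obtain ⟨a, ha, rfl⟩ := List.mem_take_iff_getElem.1 hQ
        obtain ⟨b, hb', rfl⟩ := List.mem_take_iff_getElem.1 hR
        have ha' := h5 a (by omega) (by omega)
        have hb'' := h5 b (by omega) (by omega)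
        rcases ha' with ha' | ha'
        · refine hzero ?_
          rw [hQR, map_add, ha', zero_add]
          exact hb''
        rcases hb'' with hb'' | hb''
        · refine hzero (Or.inr ?_)
          rwa [hQR, map_add, hb'', add_zero]
        refine ⟨Φ π[j] :: L, ⟨Or.inr (Or.inr ⟨_, ha', _, hb'', ?_⟩), h1⟩, ?_, ?_, ?_⟩
        · rw [hQR, map_add]
        · simp only [List.length_cons] at h3 ⊢
          linarith [Nat.zero_le (N * ℓ + N)]
        · intro P hP
          rcases List.mem_cons.1 hP with rfl | hP
          · exact hbt (hb _ hkj hsj)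
          · exact h4 P hP
        · intro i hi hij
          rcases Nat.lt_succ_iff_lt_or_eq.1 hij with hij | rfl
          · exact (h5 i hi hij).imp_right (List.mem_cons_of_mem _)
          · exact Or.inr (by simp)
  obtain ⟨L, h1, h3, h4, h5⟩ := key π.length le_rfl
  refine refutes_of_dynamic hS h1 h4
    (h3.trans (Nat.mul_le_mul_right _ (IsRefutation.length_le hs))) ?_
  rw [List.getLast?_eq_getElem?] at hlast
  obtain ⟨hi, hlast⟩ := List.getElem?_eq_some_iff.1 hlast
  have := h5 _ hi (by omega)
  rw [hlast, hΦ] at this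
  exact this.resolve_left (by simp)

end ProofSystem

/-! ### Substitutions by sums of monomials -/

section SumMonomials

variable {σ τ : Type}

/-- `P` is a sum of at most `m` monomials of degree at most `d` with coefficient `1`. -/
def IsSumMonomials (m d : ℕ) (P : Poly σ) : Prop :=
  ∃ l : List ((σ ⊕ σ) →₀ ℕ), P = (l.map (monomial · 1)).sum ∧ l.length ≤ m ∧ ∀ e ∈ l, e.degree ≤ d

variable {m m' d d' : ℕ} {P Q : Poly σ}

theorem IsSumMonomials.one : IsSumMonomials 1 0 (1 : Poly σ) :=
  ⟨[0], by simp, by simp, by simp⟩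

theorem IsSumMonomials.mono (h : IsSumMonomials m d P) (hm : m ≤ m') (hd : d ≤ d') :
    IsSumMonomials m' d' P := by
  obtain ⟨l, h1, h2, h3⟩ := h
  exact ⟨l, h1, h2.trans hm, fun e he => (h3 e he).trans hd⟩

theorem IsSumMonomials.mul (hP : IsSumMonomials m d P) (hQ : IsSumMonomials m' d' Q) :
    IsSumMonomials (m * m') (d + d') (P * Q) := by
  obtain ⟨l, rfl, h2, h3⟩ := hP
  obtain ⟨l', rfl, h2', h3'⟩ := hQ
  refine ⟨l.flatMap fun e => l'.map (e + ·), ?_, ?_, ?_⟩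
  · clear h2 h3
    induction l with
    | nil => simp
    | cons a l ih =>
      simp only [List.map_cons, List.sum_cons, List.flatMap_cons, List.map_append, List.sum_append,
        add_mul, ih, List.map_map]
      congr 1
      rw [← List.sum_map_mul_left]
      congr 1
      refine List.map_congr_left fun e _ => ?_
      simp [monomial_mul]
  · rw [List.length_flatMap]
    simp only [List.length_map, List.map_const', List.sum_replicate, smul_eq_mul]
    exact Nat.mul_le_mul h2 h2'
  · intro e he
    obtain ⟨a, ha, he⟩ := List.mem_flatMap.1 he
    obtain ⟨b, hb, rfl⟩ := List.mem_map.1 he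
    rw [map_add]
    exact Nat.add_le_add (h3 a ha) (h3' b hb)

theorem IsSumMonomials.bounded (h : IsSumMonomials m d P) : Bounded d m P := by
  obtain ⟨l, rfl, h2, h3⟩ := h
  have : ∀ p ∈ l.map (fun e => (monomial e 1 : Poly σ)), Bounded d 1 p := fun p hp => by
    obtain ⟨e, he, rfl⟩ := List.mem_map.1 hp
    exact ⟨(totalDegree_monomial_le' e 1).trans (h3 e he), terms_monomial_le e 1⟩
  exact (Bounded.list_sum this).mono le_rfl (by simpa using h2)

theorem exponent_induction {ι : Type} {p : (ι →₀ ℕ) → Prop} (h0 : p 0)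
    (h1 : ∀ e u, p e → p (e + Finsupp.single u 1)) (e : ι →₀ ℕ) : p e := by
  classical
  obtain ⟨n, hn⟩ : ∃ n, e.degree = n := ⟨_, rfl⟩
  induction n generalizing e with
  | zero =>
    rw [Finsupp.degree_eq_zero_iff] at hn
    rwa [hn]
  | succ n ih =>
    have hne : e ≠ 0 := by
      rintro rfl
      simp at hn
    obtain ⟨u, hu⟩ := Finsupp.ne_iff.1 hne
    have he : e - Finsupp.single u 1 + Finsupp.single u 1 = e :=
      Finsupp.sub_add_single_one_cancel hu
    rw [← he]
    refine h1 _ _ (ih _ ?_)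
    have := congrArg Finsupp.degree he
    rw [map_add, Finsupp.degree_single, hn] at this
    omega

/-- Every variable is replaced by a sum of at most `M` monomials of degree at most `d`. -/
def IsMonomialSubst (f : σ ⊕ σ → Poly τ) (M d : ℕ) : Prop := ∀ u, IsSumMonomials M d (f u)

theorem IsMonomialSubst.monomial {f : σ ⊕ σ → Poly τ} {M d : ℕ} (hf : IsMonomialSubst f M d)
    (e : (σ ⊕ σ) →₀ ℕ) : IsSumMonomials (M ^ e.degree) (d * e.degree) (bind₁ f (monomial e 1)) := by
  induction e using exponent_induction with
  | h0 => simpa using IsSumMonomials.one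
  | h1 e u ih =>
    have h : (MvPolynomial.monomial (e + Finsupp.single u 1) 1 : Poly σ) =
        MvPolynomial.monomial e 1 * X u := by
      rw [X, monomial_mul, one_mul]
    rw [h, map_mul, bind₁_X_right, map_add, Finsupp.degree_single, pow_succ, mul_add, mul_one]
    exact ih.mul (hf u)

/-- Expanding a monomial of degree at most `k` multiplies at most `k` sums of `M` monomials. This
makes the size bound exponential in the degree. -/
theorem IsMonomialSubst.bounded {f : σ ⊕ σ → Poly τ} {M d : ℕ} (hf : IsMonomialSubst f M d)
    (hM : 0 < M) {P : Poly σ} {k s : ℕ} (hk : P.totalDegree ≤ k) (hs : terms P ≤ s) :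
    Bounded (d * k) (s * M ^ k) (bind₁ f P) := by
  have h1 : ∀ e ∈ P.support, Bounded (d * k) (M ^ k) (bind₁ f (MvPolynomial.monomial e (coeff e P)))
      := fun e he => by
    have he' : e.degree ≤ k := (degree_le_totalDegree' he).trans hk
    rw [← mul_one (coeff e P), ← C_mul_monomial, map_mul, algHom_C, algebraMap_eq]
    have := (hf.monomial e).bounded
    exact ⟨(totalDegree_C_mul_le _ _).trans (this.1.trans (Nat.mul_le_mul_left _ he')),
      (terms_C_mul_le _ _).trans (this.2.trans (Nat.pow_le_pow_right hM he'))⟩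
  rw [P.as_sum, map_sum]
  constructor
  · exact totalDegree_finsetSum_le fun e he => (h1 e he).1
  · refine (terms_finset_sum_le _ _).trans ((Finset.sum_le_card_nsmul _ _ _ fun e he =>
      (h1 e he).2).trans ?_)
    exact Nat.mul_le_mul_right _ hs

/-- All monomials have coefficient `1`, so distributing the product yields positive multiples of
admissible products only. -/
theorem Cone.mul_sumMonomials {H : Set (Poly σ)} {D N : ℕ} (hP : Cone H D N P)
    (hQ : IsSumMonomials m d Q) : Cone H (D + d) (N * m) (P * Q) := by
  obtain ⟨l, rfl, h2, h3⟩ := hQ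
  refine Cone.mono (D := D + d) (N := l.length * N) ?_ le_rfl
    (by rw [Nat.mul_comm N]; exact Nat.mul_le_mul_right _ h2)
  clear h2
  induction l with
  | nil => simpa using Cone.zero
  | cons a l ih =>
    rw [List.map_cons, List.sum_cons, mul_add, List.length_cons, Nat.succ_mul,
      Nat.add_comm (l.length * N)]
    refine Cone.add ?_ (ih fun e he => h3 e (List.mem_cons_of_mem _ he))
    exact (hP.mul_monomial a).mono (Nat.add_le_add_left (h3 a (by simp)) _) le_rfl

end SumMonomials

/-! ### The number of terms of a cofactor -/

section Division

variable {σ : Type}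

/-- Multiplication by `Q` changes only the exponents in `W`. The part `T₁` of `T` that agrees with
`e` outside `W` is nonzero, so `Q * T₁` has a term. This term cannot cancel against `Q * T₂`, whose
terms all differ from `e` outside `W`. -/
theorem exists_mem_support_mul {W : Finset (σ ⊕ σ)} {Q T : Poly σ} (hQ : Q ≠ 0)
    (hW : Q ∈ supported ℝ (W : Set (σ ⊕ σ))) {e : (σ ⊕ σ) →₀ ℕ} (he : e ∈ T.support) :
    ∃ e' ∈ (Q * T).support, ∀ x ∉ W, e' x = e x := by
  classical
  set T₁ : Poly σ := ∑ a ∈ T.support with ∀ x ∉ W, a x = e x, monomial a (coeff a T) with hT₁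
  set T₂ : Poly σ := ∑ a ∈ T.support with ¬ ∀ x ∉ W, a x = e x, monomial a (coeff a T) with hT₂
  have hT : T = T₁ + T₂ := by
    conv_lhs => rw [T.as_sum]
    exact (Finset.sum_filter_add_sum_filter_not _ _ _).symm
  have hmem : ∀ (s : Finset ((σ ⊕ σ) →₀ ℕ)) (b : (σ ⊕ σ) →₀ ℕ),
      b ∈ (∑ a ∈ s, monomial a (coeff a T)).support → b ∈ s := fun s b hb => by
    rw [mem_support_iff, coeff_sum] at hb
    obtain ⟨a, ha, h⟩ := Finset.exists_ne_zero_of_sum_ne_zero hb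
    rw [coeff_monomial] at h
    rw [← (ite_ne_right_iff.1 h).1]
    exact ha
  have hT₁0 : T₁ ≠ 0 := by
    intro h0
    have h1 : coeff e T₁ = coeff e T := by
      rw [hT₁, coeff_sum, Finset.sum_eq_single e]
      · simp
      · intro b _ hb
        rw [coeff_monomial, if_neg hb]
      · intro h
        exact absurd (Finset.mem_filter.2 ⟨he, fun _ _ => rfl⟩) h
    rw [h0, coeff_zero] at h1
    exact mem_support_iff.1 he h1.symm
  have hsupp : ∀ a ∈ Q.support, ∀ x ∉ W, a x = 0 := fun a ha x hx => by
    by_contra h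
    exact hx (mem_supported.1 hW (mem_vars_iff_mem_support x |>.2
      ⟨a, ha, Finsupp.mem_support_iff.2 h⟩))
  obtain ⟨e', he'⟩ := support_nonempty.2 (mul_ne_zero hQ hT₁0)
  obtain ⟨a, ha, b, hb, rfl⟩ := Finset.mem_add.1 (support_mul Q T₁ he')
  have hb' : ∀ x ∉ W, b x = e x := (Finset.mem_filter.1 (hmem _ _ hb)).2
  have hab : ∀ x ∉ W, (a + b) x = e x := fun x hx => by
    rw [Finsupp.add_apply, hsupp a ha x hx, zero_add, hb' x hx]
  refine ⟨a + b, ?_, hab⟩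
  have h2 : coeff (a + b) (Q * T₂) = 0 := by
    by_contra h
    obtain ⟨a', ha', b', hb', hab'⟩ := Finset.mem_add.1 (support_mul Q T₂ (mem_support_iff.2 h))
    refine (Finset.mem_filter.1 (hmem _ _ hb')).2 fun x hx => ?_
    rw [← hab x hx, ← hab', Finsupp.add_apply, hsupp a' ha' x hx, zero_add]
  rw [mem_support_iff, hT, mul_add, coeff_add, h2, add_zero]
  exact mem_support_iff.1 he'

/-- A term of `T` is determined by its exponents in `W`, each at most `k`, together with a term of
the product that agrees with it outside `W`. In SOS this controls a multiplier of which only the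
product with a hypothesis or axiom is written down. -/
theorem terms_cofactor_le {W : Finset (σ ⊕ σ)} {Q T : Poly σ} (hQ : Q ≠ 0)
    (hW : Q ∈ supported ℝ (W : Set (σ ⊕ σ))) {k : ℕ} (hk : T.totalDegree ≤ k) :
    terms T ≤ (k + 1) ^ W.card * terms (Q * T) := by
  classical
  choose! g hg using fun e (he : e ∈ T.support) => exists_mem_support_mul hQ hW he
  have hle : ∀ e ∈ T.support, ∀ x, e x < k + 1 := fun e he x =>
    Nat.lt_succ_of_le ((Finsupp.le_degree x e).trans ((degree_le_totalDegree' he).trans hk))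
  let F : T.support → (W → Fin (k + 1)) × (Q * T).support := fun e =>
    (fun x => ⟨e.1 x, hle e.1 e.2 x⟩, ⟨g e.1, (hg e.1 e.2).1⟩)
  have hF : Function.Injective F := by
    rintro ⟨e, he⟩ ⟨e', he'⟩ h
    simp only [F, Prod.mk.injEq, Subtype.mk.injEq] at h
    refine Subtype.ext (Finsupp.ext fun x => ?_)
    by_cases hx : x ∈ W
    · have := congrFun h.1 ⟨x, hx⟩
      simpa using this
    · rw [← (hg e he).2 x hx, ← (hg e' he').2 x hx, h.2]
  have := Fintype.card_le_of_injective F hF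
  simpa [terms] using this

end Division

/-! ### Transfer of refutations along substitutions -/

section Transfer

variable {σ τ : Type}

/-- A substitution under which the hypotheses and the basic inequalities become derivable. -/
structure Translates (H : Set (Poly σ)) (H' : Set (Poly τ)) (f : σ ⊕ σ → Poly τ)
    (M d D₀ N δ t₀ n₀ : ℕ) : Prop where
  subst : IsMonomialSubst f M d
  cone : ∀ Q, Q ∈ H ∨ Basic Q → Cone H' D₀ N (bind₁ f Q)
  bounded : ∀ Q ∈ H', Bounded δ t₀ Q
  supported : ∀ Q ∈ H, ∃ W : Finset (σ ⊕ σ), W.card ≤ n₀ ∧ Q ∈ supported ℝ (W : Set (σ ⊕ σ))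

theorem basic_bounded {P : Poly σ} (h : Basic P) : Bounded 2 3 P := by
  have hX : ∀ u : σ ⊕ σ, Bounded 2 1 (X u : Poly σ) := fun u =>
    ⟨by simp, terms_X_le u⟩
  have h1 : Bounded 2 1 (1 : Poly σ) := ⟨by simp, terms_one_le⟩
  have hX2 : ∀ u : σ ⊕ σ, Bounded 2 1 (X u ^ 2 : Poly σ) := fun u => by
    refine ⟨(totalDegree_pow _ _).trans (by simp), ?_⟩
    rw [sq]
    exact (terms_mul_X_le _ u).trans (terms_X_le u)
  have hsub : ∀ {P Q : Poly σ} {t t' : ℕ}, Bounded 2 t P → Bounded 2 t' Q →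
      Bounded 2 (t + t') (P - Q) := fun hP hQ =>
    ⟨(totalDegree_sub _ _).trans (max_le hP.1 hQ.1),
      (terms_sub_le _ _).trans (Nat.add_le_add hP.2 hQ.2)⟩
  have hadd : ∀ {P Q : Poly σ} {t t' : ℕ}, Bounded 2 t P → Bounded 2 t' Q →
      Bounded 2 (t + t') (P + Q) := fun hP hQ =>
    ⟨(totalDegree_add _ _).trans (max_le hP.1 hQ.1),
      (terms_add_le _ _).trans (Nat.add_le_add hP.2 hQ.2)⟩
  have hneg : ∀ {P : Poly σ} {t : ℕ}, Bounded 2 t P → Bounded 2 t (-P) := fun hP =>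
    ⟨by rw [totalDegree_neg]; exact hP.1, by rw [terms_neg]; exact hP.2⟩
  cases h with
  | sq v | twin_sq v => exact (hsub (hX2 _) (hX _)).mono le_rfl (by omega)
  | sq_neg v | twin_sq_neg v => exact (hneg (hsub (hX2 _) (hX _))).mono le_rfl (by omega)
  | sum v => exact hsub (hadd (hX _) (hX _)) h1
  | sum_neg v => exact hneg (hsub (hadd (hX _) (hX _)) h1)
  | nonneg v | twin_nonneg v => exact (hX _).mono le_rfl (by omega)
  | le_one v | twin_le_one v => exact (hsub h1 (hX _)).mono le_rfl (by omega)
  | one => exact h1.mono le_rfl (by omega)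

theorem basic_supported {P : Poly σ} (h : Basic P) :
    ∃ W : Finset (σ ⊕ σ), W.card ≤ 2 ∧ P ∈ supported ℝ (W : Set (σ ⊕ σ)) := by
  classical
  have key : ∀ v : σ, ∃ W : Finset (σ ⊕ σ), W.card ≤ 2 ∧
      var v ∈ supported ℝ (W : Set (σ ⊕ σ)) ∧ twin v ∈ supported ℝ (W : Set (σ ⊕ σ)) := fun v =>
    ⟨{Sum.inl v, Sum.inr v}, Finset.card_le_two,
      X_mem_supported.2 (by simp), X_mem_supported.2 (by simp)⟩
  cases h with
  | one => exact ⟨∅, by simp, one_mem _⟩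
  | sq v | sq_neg v | twin_sq v | twin_sq_neg v | sum v | sum_neg v | nonneg v | twin_nonneg v
  | le_one v | twin_le_one v =>
    obtain ⟨W, hW, h1, h2⟩ := key v
    refine ⟨W, hW, ?_⟩
    first
    | exact h1
    | exact h2
    | exact sub_mem (pow_mem h1 2) h1
    | exact neg_mem (sub_mem (pow_mem h1 2) h1)
    | exact sub_mem (pow_mem h2 2) h2
    | exact neg_mem (sub_mem (pow_mem h2 2) h2)
    | exact sub_mem (add_mem h1 h2) (one_mem _)
    | exact neg_mem (sub_mem (add_mem h1 h2) (one_mem _))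
    | exact sub_mem (one_mem _) h1
    | exact sub_mem (one_mem _) h2

namespace ProofSystem

variable {S : ProofSystem} {H : Set (Poly σ)} {H' : Set (Poly τ)}

theorem mult_iff (hS : S ≠ SOS) {L : List (Poly σ)} {P : Poly σ} :
    S.Mult H L P ↔ (∃ Q ∈ L, ∃ c : ℝ, 0 < c ∧ P = C c * Q) ∨ ∃ Q ∈ L, ∃ u, P = Q * X u := by
  have h : S.Mult H L P ↔ (∃ Q ∈ L, ∃ c : ℝ, 0 < c ∧ P = C c * Q) ∨
      ∃ Q ∈ L, ∃ v : σ, P = Q * var v ∨ P = Q * twin v := by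
    cases S <;> first | exact absurd rfl hS | exact Iff.rfl
  rw [h]
  refine or_congr Iff.rfl (exists_congr fun Q => and_congr_right fun _ => ?_)
  rw [Sum.exists, ← exists_or]
  rfl

/-! ### Products with monomials, derived one variable at a time. -/

section Steps

variable {step : List (Poly τ) → Poly τ → Prop}

theorem derivable_mul_monomial (hS : S ≠ SOS) (hM : ∀ L P, S.Mult H' L P → step L P)
    {D t n : ℕ} {Q : Poly τ} (e : (τ ⊕ τ) →₀ ℕ) (hQ : Bounded D t Q) :
    ∀ E, e.degree ≤ E → Derivable step (Bounded (D + E) t) n Q →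
      Derivable step (Bounded (D + E) t) (n + e.degree) (Q * monomial e 1) := by
  induction e using exponent_induction with
  | h0 => exact fun E _ h => by simpa using h
  | h1 e u ih =>
    intro E hE h
    have he : (monomial (e + Finsupp.single u 1) 1 : Poly τ) = monomial e 1 * X u := by
      rw [X, monomial_mul, one_mul]
    have hdeg : (e + Finsupp.single u 1).degree = e.degree + 1 := by
      rw [map_add, Finsupp.degree_single]
    rw [hdeg] at hE ⊢
    refine (ih E (by omega) h).next
      (fun L hL => hM _ _ ((mult_iff hS).2 (Or.inr ⟨_, hL, u, ?_⟩))) ?_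
    · rw [he, mul_assoc]
    · refine ⟨(totalDegree_mul_monomial_le _ _ _).trans ?_,
        (terms_mul_monomial_le _ _ _).trans hQ.2⟩
      rw [hdeg]
      exact Nat.add_le_add hQ.1 hE

theorem derivable_prod (hS : S ≠ SOS) (hI : ∀ L P, S.Initial H' P → step L P)
    (hM : ∀ L P, S.Mult H' L P → step L P) {D t E : ℕ} {Q : Poly τ} (hQ : S.Initial H' Q)
    (hb : Bounded D t Q) {e : (τ ⊕ τ) →₀ ℕ} (he : e.degree ≤ E) {c : ℝ} (hc : 0 < c) :
    Derivable step (Bounded (D + E) t) (E + 2) (C c * (Q * monomial e 1)) := by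
  have h := derivable_mul_monomial hS hM (n := 1) e hb E he
    (Derivable.single (hI _ _ hQ) (hb.mono (by omega) le_rfl))
  refine (h.next (fun L hL => hM _ _ ((mult_iff hS).2 (Or.inl ⟨_, hL, c, hc, rfl⟩))) ?_).mono
    (by omega)
  exact ⟨(totalDegree_C_mul_le _ _).trans ((totalDegree_mul_monomial_le _ _ _).trans
    (Nat.add_le_add hb.1 he)),
    (terms_C_mul_le _ _).trans ((terms_mul_monomial_le _ _ _).trans hb.2)⟩

theorem derivable_isProd (hS : S ≠ SOS) (hI : ∀ L P, S.Initial H' P → step L P)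
    (hM : ∀ L P, S.Mult H' L P → step L P) {δ t₀ E : ℕ} (hδ : 2 ≤ δ) (ht₀ : 3 ≤ t₀)
    (hb : ∀ Q ∈ H', Bounded δ t₀ Q) {p : Poly τ} (hp : IsProd H' E p) :
    Derivable step (Bounded (δ + E) t₀) (E + 2) p := by
  obtain ⟨c, hc, Q, hQ, e, he, rfl⟩ := hp
  refine derivable_prod hS hI hM (hQ.imp_right Or.inl) ?_ he hc
  rcases hQ with hQ | hQ
  exacts [hb Q hQ, (basic_bounded hQ).mono hδ ht₀]

end Steps

variable {f : σ ⊕ σ → Poly τ} {M d D₀ N δ t₀ n₀ : ℕ}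

theorem bind₁_neg_one : (bind₁ f).toLinearMap (-1) = -1 := by simp

/-- Sherali-Adams, with or without squares. -/
theorem transfer_SA (hS : S.IsStatic) (hS' : S ≠ SOS) (hf : Translates H H' f M d D₀ N δ t₀ n₀)
    (hM : 0 < M) (hδ : 2 ≤ δ) (ht₀ : 3 ≤ t₀) {k s : ℕ} (h : S.Refutes H k s) :
    S.Refutes H' (δ + D₀ + 2 * (d * k)) (simSize s ((N + 1) * M ^ k) (D₀ + d * k + 2)
      (((N + 1) * M ^ k + 1) * (t₀ + s * M ^ k)) (δ + D₀ + 2 * (d * k))) := by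
  refine static_simulation hS (bind₁ f).toLinearMap bind₁_neg_one
    -- Without additions, a line is an initial polynomial times a positive scalar and a monomial.
    (F := fun P => ∃ c : ℝ, 0 < c ∧ ∃ Q, S.Initial H Q ∧ ∃ e, P = C c * (Q * monomial e 1))
    (fun P hP => ⟨1, one_pos, P, hP, 0, by simp⟩) ?_ ?_ ?_ h
  · intro prev P hprev hP
    rcases (mult_iff hS').1 hP with ⟨Q, hQ, c, hc, rfl⟩ | ⟨Q, hQ, u, rfl⟩
    · obtain ⟨a, ha, Q, hQI, e, rfl⟩ := hprev Q hQ
      exact ⟨c * a, mul_pos hc ha, Q, hQI, e, by rw [C_mul, mul_assoc]⟩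
    · obtain ⟨a, ha, Q, hQI, e, rfl⟩ := hprev Q hQ
      refine ⟨a, ha, Q, hQI, e + Finsupp.single u 1, ?_⟩
      rw [mul_assoc, mul_assoc, X, monomial_mul, one_mul]
  · rintro P ⟨c, hc, Q, hQ, e, rfl⟩ hk hs
    simp only [AlgHom.toLinearMap_apply]
    rcases eq_or_ne Q 0 with rfl | hQ0
    · exact Or.inl (by simp)
    right
    -- For a nonzero `Q` degrees add up exactly, so the degree of the line bounds both factors.
    have hdeg : Q.totalDegree + e.degree ≤ k := by
      rw [totalDegree_mul_of_isDomain (C_ne_zero.2 hc.ne')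
        (mul_ne_zero hQ0 (by simp)), totalDegree_mul_of_isDomain hQ0 (by simp),
        totalDegree_monomial e one_ne_zero, totalDegree_C, zero_add] at hk
      exact hk
    have hQs : terms Q ≤ s :=
      ((terms_mul_monomial Q e one_ne_zero).trans (terms_C_mul _ hc.ne')).trans hs
    have hmon := (hf.subst.monomial e).mono (Nat.pow_le_pow_right hM (by omega : e.degree ≤ k))
      (Nat.mul_le_mul_left d (by omega : e.degree ≤ k))
    have hfirst : Q ∈ H ∨ Basic Q → ∃ T : List (Poly τ),
        bind₁ f (C c * (Q * monomial e 1)) = T.sum ∧ T.length ≤ (N + 1) * M ^ k ∧ ∀ q ∈ T,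
          Derivable (S.StepM H') (Bounded (δ + D₀ + 2 * (d * k)) (t₀ + s * M ^ k))
            (D₀ + d * k + 2) q := fun hQ' => by
      have hcone := ((hf.cone Q hQ').mul_sumMonomials hmon).smul hc.le
      obtain ⟨T, h1, h2, h3⟩ := hcone
      refine ⟨T, ?_, h2.trans (Nat.mul_le_mul_right _ (by omega)), fun q hq => ?_⟩
      · rw [← h1, map_mul, map_mul, algHom_C, algebraMap_eq]
      · exact (derivable_isProd hS' (fun _ _ => Or.inl) (fun _ _ => Or.inr) hδ ht₀ hf.bounded
          (h3 q hq)).good_mono fun q hq => hq.mono (by omega) (by omega)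
    rcases hQ with hQ | hQ | ⟨hsq, U, rfl⟩
    · exact hfirst (Or.inl hQ)
    · exact hfirst (Or.inr hQ)
    -- The image of a square is again a square. It is written down directly and multiplied by each
    -- monomial in the image of `monomial e 1`.
    · obtain ⟨l, h1, h2, h3⟩ := hmon
      refine ⟨l.map fun e' => C c * (bind₁ f U ^ 2 * monomial e' 1), ?_, ?_, ?_⟩
      · rw [map_mul, map_mul, map_pow, algHom_C, algebraMap_eq, h1,
          ← mul_assoc, ← List.sum_map_mul_left]
        simp only [mul_assoc]
      · rw [List.length_map]
        exact h2.trans (Nat.le_mul_of_pos_left _ (by omega))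
      · intro q hq
        obtain ⟨e', he', rfl⟩ := List.mem_map.1 hq
        have hb := hf.subst.bounded hM (k := k) (by omega : (U ^ 2).totalDegree ≤ k) hQs
        rw [map_pow] at hb
        exact ((derivable_prod hS' (fun _ _ => Or.inl) (fun _ _ => Or.inr)
          (Or.inr (Or.inr ⟨hsq, _, rfl⟩)) hb (h3 e' he') hc).good_mono
            fun q hq => hq.mono (by omega) (by omega)).mono (by omega)
  · intro P hk hs
    exact (hf.subst.bounded hM hk hs).mono (by omega) (by omega)

/-- Lovász-Schrijver, with or without squares. -/
theorem transfer_LS (hS : ¬ S.IsStatic) (hf : Translates H H' f M d D₀ N δ t₀ n₀)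
    (hM : 0 < M) (hδ : 2 ≤ δ) (ht₀ : 3 ≤ t₀) {k s : ℕ} (h : S.Refutes H k s) :
    S.Refutes H' (δ + D₀ + d * k + d) (simSize s (N + M) (D₀ + d + 2)
      ((N + M + 1) * (t₀ + s * M ^ k)) (δ + D₀ + d * k + d)) := by
  have hS' : S ≠ SOS := fun h => by
    rw [h] at hS
    exact hS trivial
  refine dynamic_simulation hS (bind₁ f).toLinearMap bind₁_neg_one ?_ ?_ h
  · rintro L prev P hprev hk hs hP
    simp only [AlgHom.toLinearMap_apply] at hprev ⊢
    have hbP := (hf.subst.bounded hM hk hs).mono (D' := δ + D₀ + d * k + d)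
      (t' := t₀ + s * M ^ k) (by omega) (by omega)
    have hone : S.Step H' L (bind₁ f P) → ∃ T : List (Poly τ), bind₁ f P = T.sum ∧
        T.length ≤ N + M ∧ ∀ q ∈ T, Derivable (fun K => S.Step H' (K ++ L))
          (Bounded (δ + D₀ + d * k + d) (t₀ + s * M ^ k)) (D₀ + d + 2) q := fun hst => by
      refine ⟨[bind₁ f P], by simp, by simp; omega, ?_⟩
      simp only [List.mem_singleton, forall_eq]
      exact (Derivable.single hst hbP).mono (by omega)
    have hfirst : P ∈ H ∨ Basic P → ∃ T : List (Poly τ), bind₁ f P = T.sum ∧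
        T.length ≤ N + M ∧ ∀ q ∈ T, Derivable (fun K => S.Step H' (K ++ L))
          (Bounded (δ + D₀ + d * k + d) (t₀ + s * M ^ k)) (D₀ + d + 2) q := fun hP => by
      obtain ⟨T, h1, h2, h3⟩ := hf.cone P hP
      refine ⟨T, h1, h2.trans (by omega), fun q hq => ?_⟩
      exact ((derivable_isProd hS' (fun _ _ => Or.inl)
        (fun _ _ h => Or.inr (Or.inl (Mult.mono (List.subset_append_left _ _) h))) hδ ht₀
        hf.bounded (h3 q hq)).good_mono fun q hq => hq.mono (by omega) (by omega)).mono (by omega)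
    rcases hP with (hP | hP | ⟨hsq, U, rfl⟩) | hP
    · exact Or.inr (hfirst (Or.inl hP))
    · exact Or.inr (hfirst (Or.inr hP))
    · exact Or.inr (hone (Or.inl (Or.inr (Or.inr ⟨hsq, _, map_pow _ _ _⟩))))
    · rcases (mult_iff hS').1 hP with ⟨Q, hQ, c, hc, rfl⟩ | ⟨Q, hQ, u, rfl⟩
      · rcases (hprev Q hQ).2 with h0 | h0
        · exact Or.inl (by rw [map_mul, h0, mul_zero])
        · refine Or.inr (hone (Or.inr (Or.inl ((mult_iff hS').2 (Or.inl ⟨_, h0, c, hc, ?_⟩)))))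
          rw [map_mul, algHom_C, algebraMap_eq]
      · rcases (hprev Q hQ).2 with h0 | h0
        · exact Or.inl (by rw [map_mul, h0, zero_mul])
        right
        -- One multiplication by a variable becomes at most `M` multiplications by monomials of the
        -- image of the earlier line. No factor `M ^ k` enters the number of lines here.
        obtain ⟨l, h1, h2, h3⟩ := hf.subst u
        have hQb := (hf.subst.bounded hM (hprev Q hQ).1.1 (hprev Q hQ).1.2)
        refine ⟨l.map fun e => bind₁ f Q * monomial e 1, ?_, ?_, ?_⟩
        · rw [map_mul, bind₁_X_right, h1, ← List.sum_map_mul_left]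
        · rw [List.length_map]
          omega
        · intro q hq
          obtain ⟨e, he, rfl⟩ := List.mem_map.1 hq
          -- The polynomial already belongs to `L`, but a derivation must contain its own lines, so
          -- it is repeated as its multiple by `1`.
          have hd : Derivable (fun K => S.Step H' (K ++ L)) (Bounded (d * k + d) (s * M ^ k)) 1
              (bind₁ f Q) := by
            refine Derivable.single (Or.inr (Or.inl ((mult_iff hS').2 (Or.inl
              ⟨_, h0, 1, one_pos, by simp⟩)))) (hQb.mono (by omega) le_rfl)
          exact ((derivable_mul_monomial hS'
            (fun _ _ h => Or.inr (Or.inl (Mult.mono (List.subset_append_left _ _) h)))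
            e hQb d (h3 e he) hd).good_mono fun q hq => hq.mono (by omega) (by omega)).mono
              (by have := h3 e he; omega)
  · intro P hk hs
    exact (hf.subst.bounded hM hk hs).mono (by omega) (by omega)

end ProofSystem

end Transfer

/-! ### Transfer of refutations in Sums-of-Squares. -/

section TransferSOS

variable {σ τ : Type}

theorem basic_sq_sub (u : σ ⊕ σ) :
    Basic (X u ^ 2 - X u : Poly σ) ∧ Basic (-(X u ^ 2 - X u) : Poly σ) := by
  rcases u with v | v
  exacts [⟨Basic.sq v, Basic.sq_neg v⟩, ⟨Basic.twin_sq v, Basic.twin_sq_neg v⟩]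

/-- A monomial differs from its square by a combination of basic equations. -/
theorem exists_monomial_sub_sq (e : (σ ⊕ σ) →₀ ℕ) :
    ∃ l : List ((σ ⊕ σ) × ((σ ⊕ σ) →₀ ℕ)),
      (monomial e 1 - monomial e 1 ^ 2 : Poly σ) =
        (l.map fun q => -(X q.1 ^ 2 - X q.1) * monomial q.2 1).sum ∧
      l.length ≤ e.degree ∧ ∀ q ∈ l, q.2.degree ≤ 2 * e.degree := by
  induction e using exponent_induction with
  | h0 => exact ⟨[], by simp, by simp, by simp⟩
  | h1 e u ih =>
    obtain ⟨l, h1, h2, h3⟩ := ih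
    have he : (monomial (e + Finsupp.single u 1) 1 : Poly σ) = monomial e 1 * X u := by
      rw [X, monomial_mul, one_mul]
    have hdeg : (e + Finsupp.single u 1).degree = e.degree + 1 := by
      rw [map_add, Finsupp.degree_single]
    refine ⟨(u, e + e) :: l.map fun q => (q.1, q.2 + Finsupp.single u 1), ?_, ?_, ?_⟩
    · rw [List.map_cons, List.sum_cons, List.map_map, he]
      have h4 : (List.map ((fun q : (σ ⊕ σ) × ((σ ⊕ σ) →₀ ℕ) =>
          (-(X q.1 ^ 2 - X q.1) * monomial q.2 1 : Poly σ)) ∘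
            fun q => (q.1, q.2 + Finsupp.single u 1)) l).sum =
          (monomial e 1 - monomial e 1 ^ 2) * X u := by
        rw [h1, ← List.sum_map_mul_right]
        congr 1
        refine List.map_congr_left fun q _ => ?_
        simp only [Function.comp, X]
        rw [mul_assoc, monomial_mul, one_mul]
      have h5 : (monomial (e + e) 1 : Poly σ) = monomial e 1 ^ 2 := by
        rw [sq, monomial_mul, one_mul]
      rw [h4, h5]
      ring
    · rw [hdeg]
      simpa using h2
    · rw [hdeg]
      intro q hq
      rcases List.mem_cons.1 hq with rfl | hq
      · simp only [map_add]
        omega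
      · obtain ⟨q, hq', rfl⟩ := List.mem_map.1 hq
        have := h3 q hq'
        simp only [map_add, Finsupp.degree_single]
        omega

namespace ProofSystem

variable {H : Set (Poly σ)} {H' : Set (Poly τ)}

/-- SOS does not multiply inequalities by monomials. The monomial is therefore replaced by its
square: with `m = monomial e 1`, the product `p * W ^ 2` equals `Q * (√c * m * W) ^ 2` plus
multiples of the equations that reduce `m - m ^ 2` to zero. -/
theorem derivable_sos_prod {δ t₀ E D t : ℕ} (hδ : 2 ≤ δ) (ht₀ : 3 ≤ t₀)
    (hb : ∀ Q ∈ H', Bounded δ t₀ Q) {p W : Poly τ} (hp : IsProd H' E p)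
    (hW : W.totalDegree ≤ D) (hWt : terms (W ^ 2) ≤ t) (ht : 0 < t) :
    ∃ T : List (Poly τ), p * W ^ 2 = T.sum ∧ T.length ≤ E + 1 ∧ ∀ q ∈ T,
      Derivable (SOS.StepM H') (Bounded (δ + 2 + 2 * E + 2 * D) (2 * t₀ * t)) 2 q := by
  obtain ⟨c, hc, Q, hQ, e, he, rfl⟩ := hp
  have hQb : Bounded δ t₀ Q := by
    rcases hQ with hQ | hQ
    exacts [hb Q hQ, (basic_bounded hQ).mono hδ ht₀]
  obtain ⟨l, h1, h2, h3⟩ := exists_monomial_sub_sq e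
  have hW2 : (W ^ 2).totalDegree ≤ 2 * D :=
    (totalDegree_pow _ _).trans (Nat.mul_le_mul_left _ hW)
  have hQW : terms (Q * W ^ 2) ≤ t₀ * t :=
    (terms_mul_le _ _).trans (Nat.mul_le_mul hQb.2 hWt)
  have hQWd : (Q * W ^ 2).totalDegree ≤ δ + 2 * D :=
    (totalDegree_mul _ _).trans (Nat.add_le_add hQb.1 hW2)
  have ht2 : t₀ * t ≤ 2 * t₀ * t := by rw [mul_assoc]; omega
  refine ⟨Q * (C (Real.sqrt c) * (monomial e 1 * W)) ^ 2 ::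
    l.map (fun q => -(X q.1 ^ 2 - X q.1) * (monomial q.2 1 * (C c * (Q * W ^ 2)))), ?_, ?_, ?_⟩
  · have h4 : (List.map (fun q : (τ ⊕ τ) × ((τ ⊕ τ) →₀ ℕ) =>
        (-(X q.1 ^ 2 - X q.1) * (monomial q.2 1 * (C c * (Q * W ^ 2))) : Poly τ)) l).sum =
        (monomial e 1 - monomial e 1 ^ 2) * (C c * (Q * W ^ 2)) := by
      rw [h1, ← List.sum_map_mul_right]
      simp only [mul_assoc]
    have h5 : (C (Real.sqrt c) : Poly τ) ^ 2 = C c := by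
      rw [← C_pow, Real.sq_sqrt hc.le]
    rw [List.sum_cons, h4, mul_pow, h5]
    ring
  · rw [List.length_cons, List.length_map]
    omega
  · intro q hq
    rcases List.mem_cons.1 hq with rfl | hq
    · have hstep : Bounded (δ + 2 + 2 * E + 2 * D) (2 * t₀ * t) Q :=
        hQb.mono (by omega) (by nlinarith)
      refine ((Derivable.single (step := SOS.StepM H') (hQ.imp id Or.inl |> Or.inl)
        hstep).next (fun L hL => Or.inr (Or.inl ⟨Q, hL, _, rfl⟩)) ?_).mono (by omega)
      have heq : Q * (C (Real.sqrt c) * (monomial e 1 * W)) ^ 2 =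
          C (Real.sqrt c ^ 2) * (Q * W ^ 2 * monomial (e + e) 1) := by
        have h5 : (monomial (e + e) 1 : Poly τ) = monomial e 1 ^ 2 := by
          rw [sq, monomial_mul, one_mul]
        rw [h5, C_pow]
        ring
      rw [heq]
      refine ⟨(totalDegree_C_mul_le _ _).trans ((totalDegree_mul_monomial_le _ _ _).trans ?_),
        (terms_C_mul_le _ _).trans ((terms_mul_monomial_le _ _ _).trans (hQW.trans ht2))⟩
      rw [map_add]
      omega
    · obtain ⟨q, hql, rfl⟩ := List.mem_map.1 hq
      refine (Derivable.single (Or.inr (Or.inr ⟨_, _, Or.inr (basic_sq_sub q.1).2,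
        Or.inr (by rw [neg_neg]; exact (basic_sq_sub q.1).1), rfl⟩)) ?_).mono (by omega)
      have heq : -(X q.1 ^ 2 - X q.1) * (monomial q.2 1 * (C c * (Q * W ^ 2))) =
          C (-c) * ((Q * W ^ 2 * (X q.1 ^ 2 - X q.1)) * monomial q.2 1) := by
        rw [C_neg]
        ring
      have hX : Bounded 2 2 (X q.1 ^ 2 - X q.1 : Poly τ) := by
        refine ⟨(totalDegree_sub _ _).trans (max_le ((totalDegree_pow _ _).trans (by simp))
          (by simp)), (terms_sub_le _ _).trans ?_⟩
        have := (terms_mul_X_le (X q.1) q.1).trans (terms_X_le q.1)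
        rw [sq]
        have := terms_X_le q.1
        omega
      rw [heq]
      refine ⟨(totalDegree_C_mul_le _ _).trans ((totalDegree_mul_monomial_le _ _ _).trans ?_),
        (terms_C_mul_le _ _).trans ((terms_mul_monomial_le _ _ _).trans
          ((terms_mul_le _ _).trans ?_))⟩
      · have e1 := (totalDegree_mul (Q * W ^ 2) (X q.1 ^ 2 - X q.1)).trans
          (Nat.add_le_add hQWd hX.1)
        have e2 := h3 q hql
        omega
      · have e1 := Nat.mul_le_mul hQW hX.2
        rw [mul_comm 2 t₀, mul_assoc, mul_comm 2 t, ← mul_assoc]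
        exact e1

variable {f : σ ⊕ σ → Poly τ} {M d D₀ N δ t₀ n₀ : ℕ}

theorem derivable_sos_mul_sq (hf : Translates H H' f M d D₀ N δ t₀ n₀) (hδ : 2 ≤ δ) (ht₀ : 3 ≤ t₀)
    {D t : ℕ} {Q : Poly σ} {W : Poly τ} (hQ : Q ∈ H ∨ Basic Q)
    (hW : W.totalDegree ≤ D) (hWt : terms (W ^ 2) ≤ t) (ht : 0 < t) :
    ∃ T : List (Poly τ), bind₁ f Q * W ^ 2 = T.sum ∧ T.length ≤ N * (D₀ + 1) ∧ ∀ q ∈ T,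
      Derivable (SOS.StepM H') (Bounded (δ + 2 + 2 * D₀ + 2 * D) (2 * t₀ * t)) 2 q := by
  obtain ⟨L, h1, h2, h3⟩ := hf.cone Q hQ
  rw [h1]
  clear h1
  have : ∃ T : List (Poly τ), L.sum * W ^ 2 = T.sum ∧ T.length ≤ L.length * (D₀ + 1) ∧ ∀ q ∈ T,
      Derivable (SOS.StepM H') (Bounded (δ + 2 + 2 * D₀ + 2 * D) (2 * t₀ * t)) 2 q := by
    clear h2
    induction L with
    | nil => exact ⟨[], by simp, by simp, by simp⟩
    | cons p L ih =>
      obtain ⟨T, t1, t2, t3⟩ := ih fun q hq => h3 q (List.mem_cons_of_mem _ hq)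
      obtain ⟨T', t1', t2', t3'⟩ :=
        derivable_sos_prod hδ ht₀ hf.bounded (h3 p (by simp)) hW hWt ht
      refine ⟨T' ++ T, ?_, ?_, ?_⟩
      · rw [List.sum_cons, add_mul, t1, t1', List.sum_append]
      · rw [List.length_append, List.length_cons, Nat.succ_mul]
        omega
      · intro q hq
        rcases List.mem_append.1 hq with hq | hq
        exacts [t3' q hq, t3 q hq]
  obtain ⟨T, t1, t2, t3⟩ := this
  exact ⟨T, t1, t2.trans (Nat.mul_le_mul_right _ h2), t3⟩

/-- A bound on the number of terms of squares that occur in the simulation in SOS. -/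
def sosTerms (k s M n₀ : ℕ) : ℕ := ((k + 1) ^ n₀ * s * M ^ k + 1) ^ 2

/-- Sums-of-Squares. -/
theorem transfer_SOS (hf : Translates H H' f M d D₀ N δ t₀ n₀)
    (hM : 0 < M) (hδ : 2 ≤ δ) (ht₀ : 3 ≤ t₀) (hn₀ : 2 ≤ n₀) {k s : ℕ} (h : SOS.Refutes H k s) :
    SOS.Refutes H' (δ + 2 + 2 * D₀ + 2 * (d * k)) (simSize s (2 * (N * (D₀ + 1))) 2
      ((2 * (N * (D₀ + 1)) + 1) * (2 * t₀ * sosTerms k s M n₀))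
      (δ + 2 + 2 * D₀ + 2 * (d * k))) := by
  have hsupp : ∀ Q, Q ∈ H ∨ Basic Q →
      ∃ W : Finset (σ ⊕ σ), W.card ≤ n₀ ∧ Q ∈ supported ℝ (W : Set (σ ⊕ σ)) := by
    rintro Q (hQ | hQ)
    · exact hf.supported Q hQ
    · obtain ⟨W, hW, h⟩ := basic_supported hQ
      exact ⟨W, hW.trans hn₀, h⟩
  -- The size of a line bounds the product but not the multiplier, which is recovered by counting
  -- the terms of a cofactor.
  have hcof : ∀ Q T : Poly σ, (Q ∈ H ∨ Basic Q) → Q ≠ 0 → T.totalDegree ≤ k → terms (Q * T) ≤ s →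
      terms T ≤ (k + 1) ^ n₀ * s := fun Q T hQ hQ0 hT hs => by
    obtain ⟨W, hW, h⟩ := hsupp Q hQ
    exact (terms_cofactor_le hQ0 h hT).trans
      (Nat.mul_le_mul (Nat.pow_le_pow_right (by omega) hW) hs)
  set r := (k + 1) ^ n₀ * s * M ^ k with hr
  have ht : 0 < sosTerms k s M n₀ := by unfold sosTerms; positivity
  refine static_simulation (S := SOS) trivial (bind₁ f).toLinearMap bind₁_neg_one
    -- Successive square multipliers collect into one square, and a written square is a multiple of
    -- the axiom `1`. Multiples of equations form the second class.
    (F := fun P => (∃ Q R, (Q ∈ H ∨ Basic Q) ∧ P = Q * R ^ 2) ∨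
      ∃ Q R, (Q ∈ H ∨ Basic Q) ∧ (-Q ∈ H ∨ Basic (-Q)) ∧ P = Q * R) ?_ ?_ ?_ ?_ h
  · rintro P (hP | hP | ⟨_, Q, rfl⟩)
    · exact Or.inl ⟨P, 1, Or.inl hP, by simp⟩
    · exact Or.inl ⟨P, 1, Or.inr hP, by simp⟩
    · exact Or.inl ⟨1, Q, Or.inr Basic.one, by simp⟩
  · rintro prev P hprev (⟨Q, hQ, R, rfl⟩ | ⟨Q, R, h1, h2, rfl⟩)
    · rcases hprev Q hQ with ⟨Q, R', h1, rfl⟩ | ⟨Q, R', h1, h2, rfl⟩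
      · exact Or.inl ⟨Q, R' * R, h1, by ring⟩
      · exact Or.inr ⟨Q, R' * R ^ 2, h1, h2, by ring⟩
    · exact Or.inr ⟨Q, R, h1, h2, rfl⟩
  · rintro P (⟨Q, R, h1, rfl⟩ | ⟨Q, R, h1, h2, rfl⟩) hk hs
    · simp only [AlgHom.toLinearMap_apply]
      rcases eq_or_ne (Q * R ^ 2) 0 with h0 | h0
      · exact Or.inl (by rw [h0, map_zero])
      right
      have hQ0 : Q ≠ 0 := left_ne_zero_of_mul h0
      have hR0 : R ^ 2 ≠ 0 := right_ne_zero_of_mul h0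
      have hR0' : R ≠ 0 := fun h => hR0 (by simp [h])
      rw [totalDegree_mul_of_isDomain hQ0 hR0] at hk
      have hRd : R.totalDegree ≤ k := by
        have : (R ^ 2).totalDegree = R.totalDegree + R.totalDegree := by
          rw [sq, totalDegree_mul_of_isDomain hR0' hR0']
        omega
      have hR2 := hf.subst.bounded hM (k := k) (by omega : (R ^ 2).totalDegree ≤ k)
        (hcof Q (R ^ 2) h1 hQ0 (by omega) hs)
      rw [map_pow] at hR2
      have hRb := (hf.subst.bounded hM hRd le_rfl).1
      obtain ⟨T, t1, t2, t3⟩ := derivable_sos_mul_sq hf hδ ht₀ (t := sosTerms k s M n₀) h1 hRb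
        (hR2.2.trans (by unfold sosTerms; nlinarith)) ht
      refine ⟨T, ?_, t2.trans (by omega), t3⟩
      rw [map_mul, map_pow, t1]
    · simp only [AlgHom.toLinearMap_apply]
      rcases eq_or_ne (Q * R) 0 with h0 | h0
      · exact Or.inl (by rw [h0, map_zero])
      right
      have hQ0 : Q ≠ 0 := left_ne_zero_of_mul h0
      have hR0 : R ≠ 0 := right_ne_zero_of_mul h0
      rw [totalDegree_mul_of_isDomain hQ0 hR0] at hk
      have hRb := hf.subst.bounded hM (k := k) (by omega : R.totalDegree ≤ k)
        (hcof Q R h1 hQ0 (by omega) hs)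
      -- An arbitrary multiplier is a difference of squares, `R = ((R + 1) / 2) ^ 2 - ((R - 1) / 2)
      -- ^ 2`. The first square multiplies `Q ≥ 0` and the second `-Q ≥ 0`.
      have hW : ∀ a : ℝ, (C (1 / 2) * (bind₁ f R + C a)).totalDegree ≤ d * k ∧
          terms ((C (1 / 2) * (bind₁ f R + C a)) ^ 2) ≤ sosTerms k s M n₀ := fun a => by
        constructor
        · refine (totalDegree_C_mul_le _ _).trans ((totalDegree_add _ _).trans
            (max_le hRb.1 (by simp)))
        · have h3 : terms (C (1 / 2) * (bind₁ f R + C a)) ≤ r + 1 :=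
            (terms_C_mul_le _ _).trans ((terms_add_le _ _).trans
              (Nat.add_le_add hRb.2 (terms_C_le a)))
          rw [sq]
          refine (terms_mul_le _ _).trans ((Nat.mul_le_mul h3 h3).trans ?_)
          unfold sosTerms
          rw [sq]
      obtain ⟨T, t1, t2, t3⟩ := derivable_sos_mul_sq hf hδ ht₀ h1 (hW 1).1 (hW 1).2 ht
      obtain ⟨T', t1', t2', t3'⟩ := derivable_sos_mul_sq hf hδ ht₀ h2 (hW (-1)).1 (hW (-1)).2 ht
      refine ⟨T ++ T', ?_, ?_, ?_⟩
      · rw [List.sum_append, ← t1, ← t1', map_mul, map_neg]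
        have h4 : (C (1 / 2) : Poly τ) * C (1 / 2) * 4 = 1 := by
          rw [show (4 : Poly τ) = C 4 from (map_ofNat C 4).symm, ← C_mul, ← C_mul]
          norm_num
        have h5 : (C (-1) : Poly τ) = -1 := by simp
        rw [h5, C_1]
        linear_combination (-(bind₁ f Q * bind₁ f R)) * h4
      · rw [List.length_append]
        omega
      · intro q hq
        rcases List.mem_append.1 hq with hq | hq
        exacts [t3 q hq, t3' q hq]
  · intro P hk hs
    refine (hf.subst.bounded hM hk hs).mono (by omega) ?_
    have h1 : s * M ^ k ≤ r := by
      rw [hr]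
      refine Nat.mul_le_mul_right _ (Nat.le_mul_of_pos_left _ (by positivity))
    have h2 : r ≤ sosTerms k s M n₀ := by unfold sosTerms; nlinarith
    nlinarith

end ProofSystem

end TransferSOS

/-! ### Polynomial bounds -/

/-- Functions of `k`, `s` and `N` that are bounded by a polynomial in `2 ^ k`, `s` and `N`. -/
def PolyBounded (f : ℕ → ℕ → ℕ → ℕ) : Prop :=
  ∃ e, ∀ k s N, 0 < k → 0 < s → f k s N ≤ (2 ^ k * s * (N + 2)) ^ e

namespace PolyBounded

variable {f g : ℕ → ℕ → ℕ → ℕ}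

theorem two_le_base (k N : ℕ) {s : ℕ} (hs : 0 < s) : 2 ≤ 2 ^ k * s * (N + 2) := by
  have h : 1 ≤ 2 ^ k * s := Nat.mul_pos (by positivity) hs
  nlinarith

theorem le_base_pow (k N : ℕ) {s : ℕ} (hs : 0 < s) (a : ℕ) :
    a ≤ (2 ^ k * s * (N + 2)) ^ a :=
  Nat.lt_two_pow_self.le.trans (Nat.pow_le_pow_left (two_le_base k N hs) a)

theorem const (a : ℕ) : PolyBounded fun _ _ _ => a :=
  ⟨a, fun k _ N _ hs => le_base_pow k N hs a⟩

theorem mul (hf : PolyBounded f) (hg : PolyBounded g) :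
    PolyBounded fun k s N => f k s N * g k s N := by
  obtain ⟨e, he⟩ := hf
  obtain ⟨e', he'⟩ := hg
  refine ⟨e + e', fun k s N hk hs => ?_⟩
  rw [pow_add]
  exact Nat.mul_le_mul (he k s N hk hs) (he' k s N hk hs)

theorem add (hf : PolyBounded f) (hg : PolyBounded g) :
    PolyBounded fun k s N => f k s N + g k s N := by
  obtain ⟨e, he⟩ := hf
  obtain ⟨e', he'⟩ := hg
  refine ⟨e + e' + 1, fun k s N hk hs => ?_⟩
  have h1 := he k s N hk hs
  have h2 := he' k s N hk hs
  have h0 := two_le_base k N hs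
  have h3 : (2 ^ k * s * (N + 2)) ^ e ≤ (2 ^ k * s * (N + 2)) ^ (e + e') :=
    Nat.pow_le_pow_right (by omega) (by omega)
  have h4 : (2 ^ k * s * (N + 2)) ^ e' ≤ (2 ^ k * s * (N + 2)) ^ (e + e') :=
    Nat.pow_le_pow_right (by omega) (by omega)
  rw [pow_succ]
  nlinarith

theorem pow (hf : PolyBounded f) (n : ℕ) : PolyBounded fun k s N => f k s N ^ n := by
  obtain ⟨e, he⟩ := hf
  refine ⟨e * n, fun k s N hk hs => ?_⟩
  rw [pow_mul]
  exact Nat.pow_le_pow_left (he k s N hk hs) n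

/-- The estimate `a ^ k ≤ (2 ^ k) ^ a` makes the factors `M ^ k` polynomial in `2 ^ k`. -/
theorem const_pow (a : ℕ) : PolyBounded fun k _ _ => a ^ k := by
  refine ⟨a, fun k s N _ hs => ?_⟩
  calc a ^ k ≤ (2 ^ a) ^ k := Nat.pow_le_pow_left Nat.lt_two_pow_self.le k
    _ = (2 ^ k) ^ a := by rw [← pow_mul, ← pow_mul, mul_comm]
    _ ≤ _ := Nat.pow_le_pow_left (by
      rw [mul_assoc]
      exact Nat.le_mul_of_pos_right _ (Nat.mul_pos hs (by omega))) a

theorem degree : PolyBounded fun k _ _ => k := by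
  obtain ⟨e, he⟩ := const_pow 2
  exact ⟨e, fun k s N hk hs => Nat.lt_two_pow_self.le.trans (he k s N hk hs)⟩

theorem size : PolyBounded fun _ s _ => s :=
  ⟨1, fun k s N _ _ => by
    rw [pow_one, mul_comm (2 ^ k), mul_assoc]
    exact Nat.le_mul_of_pos_right _ (by positivity)⟩

theorem number : PolyBounded fun _ _ N => N :=
  ⟨1, fun k s N _ hs => by
    rw [pow_one]
    have : 1 ≤ 2 ^ k * s := Nat.mul_pos (by positivity) hs
    nlinarith⟩

theorem simSize {s N ℓ t D : ℕ → ℕ → ℕ → ℕ} (hs : PolyBounded s) (hN : PolyBounded N)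
    (hℓ : PolyBounded ℓ) (ht : PolyBounded t) (hD : PolyBounded D) :
    PolyBounded fun k m n => ProofSystem.simSize (s k m n) (N k m n) (ℓ k m n) (t k m n)
      (D k m n) :=
  (hs.mul (((hN.mul hℓ).add hN).add (const 1))).mul ((const 1).add (ht.mul ((const 1).add hD)))

end PolyBounded

/-! ### Uniform bounds for the five systems. -/

section TransferAll

variable {σ τ : Type}

theorem Translates.mono {H : Set (Poly σ)} {H' : Set (Poly τ)} {f : σ ⊕ σ → Poly τ}
    {M d D₀ N δ t₀ n₀ M' δ' t₀' n₀' : ℕ} (h : Translates H H' f M d D₀ N δ t₀ n₀)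
    (hM : M ≤ M') (hδ : δ ≤ δ') (ht₀ : t₀ ≤ t₀') (hn₀ : n₀ ≤ n₀') :
    Translates H H' f M' d D₀ N δ' t₀' n₀' where
  subst u := (h.subst u).mono hM le_rfl
  cone := h.cone
  bounded Q hQ := (h.bounded Q hQ).mono hδ ht₀
  supported Q hQ := by
    obtain ⟨W, hW, h⟩ := h.supported Q hQ
    exact ⟨W, hW.trans hn₀, h⟩

/-- Refutations can be transferred along translations. -/
theorem exists_transfer_bounds (M d D₀ δ t₀ n₀ : ℕ) :
    ∃ c e : ℕ, ∀ {σ τ : Type} {H : Set (Poly σ)} {H' : Set (Poly τ)} {f : σ ⊕ σ → Poly τ} {N : ℕ},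
      Translates H H' f M d D₀ N δ t₀ n₀ → ∀ (S : ProofSystem) (k s : ℕ), 0 < k → 0 < s →
        S.Refutes H k s → S.Refutes H' (c * k) ((2 ^ k * s * (N + 2)) ^ e) := by
  open PolyBounded in
  have hdk : PolyBounded fun k _ _ => d * k := (const d).mul degree
  have hsM : PolyBounded fun k s _ => s * (M + 1) ^ k := size.mul (const_pow (M + 1))
  have hN : PolyBounded fun k _ N => (N + 1) * (M + 1) ^ k :=
    (number.add (const 1)).mul (const_pow (M + 1))
  have hNM : PolyBounded fun _ _ N => N + (M + 1) := number.add (const (M + 1))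
  have hN2 : PolyBounded fun _ _ N => 2 * (N * (D₀ + 1)) :=
    (const 2).mul (number.mul (const (D₀ + 1)))
  have ht : PolyBounded fun k s _ => t₀ + 3 + s * (M + 1) ^ k := (const (t₀ + 3)).add hsM
  have hsos : PolyBounded fun k s _ => ProofSystem.sosTerms k s (M + 1) (n₀ + 2) :=
    ((((((degree.add (const 1)).pow (n₀ + 2)).mul size).mul (const_pow (M + 1))).add
      (const 1)).pow 2)
  have hSA : PolyBounded fun k s N =>
      ProofSystem.simSize s ((N + 1) * (M + 1) ^ k) (D₀ + d * k + 2)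
        (((N + 1) * (M + 1) ^ k + 1) * (t₀ + 3 + s * (M + 1) ^ k)) (δ + 2 + D₀ + 2 * (d * k)) :=
    PolyBounded.simSize size hN (((const D₀).add hdk).add (const 2))
      ((hN.add (const 1)).mul ht) ((const (δ + 2 + D₀)).add ((const 2).mul hdk))
  have hLS : PolyBounded fun k s N =>
      ProofSystem.simSize s (N + (M + 1)) (D₀ + d + 2)
        ((N + (M + 1) + 1) * (t₀ + 3 + s * (M + 1) ^ k)) (δ + 2 + D₀ + d * k + d) :=
    PolyBounded.simSize size hNM (const (D₀ + d + 2))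
      ((hNM.add (const 1)).mul ht) (((const (δ + 2 + D₀)).add hdk).add (const d))
  have hSOS : PolyBounded fun k s N =>
      ProofSystem.simSize s (2 * (N * (D₀ + 1))) 2
        ((2 * (N * (D₀ + 1)) + 1) * (2 * (t₀ + 3) * ProofSystem.sosTerms k s (M + 1) (n₀ + 2)))
        (δ + 2 + 2 + 2 * D₀ + 2 * (d * k)) :=
    PolyBounded.simSize size hN2 (const 2)
      ((hN2.add (const 1)).mul ((const (2 * (t₀ + 3))).mul hsos))
      ((const (δ + 2 + 2 + 2 * D₀)).add ((const 2).mul hdk))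
  obtain ⟨e, he⟩ := (hSA.add hLS).add hSOS
  refine ⟨δ + 4 + 2 * D₀ + 2 * d + d, e, ?_⟩
  intro σ τ H H' f N hf S k s hk hs h
  -- The parameters are enlarged so that the lower bounds required by the three transfer theorems
  -- hold.
  have hf' := hf.mono (Nat.le_add_right M 1) (Nat.le_add_right δ 2) (Nat.le_add_right t₀ 3)
    (Nat.le_add_right n₀ 2)
  have hb := he k s N hk hs
  beta_reduce at hb
  -- The left side bounds the degrees of all three simulations. Since `k ≥ 1`, the constants are
  -- absorbed by the factor.
  have hmono : δ + 4 + 2 * D₀ + 2 * (d * k) + d ≤ (δ + 4 + 2 * D₀ + 2 * d + d) * k := by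
    nlinarith [Nat.zero_le (δ * (k - 1)), Nat.le_mul_of_pos_right δ hk,
      Nat.le_mul_of_pos_right D₀ hk, Nat.le_mul_of_pos_right d hk]
  by_cases hS : S.IsStatic
  · by_cases hS' : S = ProofSystem.SOS
    · subst hS'
      exact (ProofSystem.transfer_SOS hf' (by omega) (by omega) (by omega) (by omega) h).mono
        (by omega) (by omega)
    · exact (ProofSystem.transfer_SA hS hS' hf' (by omega) (by omega) (by omega) h).mono
        (by omega) (by omega)
  · exact (ProofSystem.transfer_LS hS hf' (by omega) (by omega) (by omega) h).mono
      (by omega) (by omega)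

end TransferAll

open FirstOrder.Language.Structure (RelMap)

/-! ### Local encoding schemes -/

section Rename

variable {σ τ : Type}

theorem Bounded.renameVars {δ t : ℕ} {P : Poly σ} (h : Bounded δ t P) (w : σ → τ) :
    Bounded δ t (renameVars w P) := by
  refine ⟨(totalDegree_rename_le _ P).trans h.1, le_trans ?_ h.2⟩
  conv_lhs => rw [P.as_sum]
  unfold CSPClosure.renameVars
  rw [map_sum]
  refine (terms_finset_sum_le _ _).trans ((Finset.sum_le_card_nsmul _ _ 1 fun e _ => ?_).trans ?_)
  · rw [rename_monomial]
    exact terms_monomial_le _ _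
  · simp [terms]

theorem eval_renameVars (w : σ → τ) (P : Poly σ) (v : τ ⊕ τ → ℝ) :
    eval v (renameVars w P) = eval (v ∘ Sum.map w w) P := eval_rename _ _ _

theorem renameVars_leftInverse {w : σ → τ} {w' : τ → σ} (h : Function.LeftInverse w' w)
    (P : Poly σ) : renameVars w' (renameVars w P) = P := by
  unfold renameVars
  rw [rename_rename, Sum.map_comp_map, h.comp_eq_id, Sum.map_id_id, rename_id, AlgHom.id_apply]

theorem renameVars_mem_supported {w : σ → τ} {P : Poly σ} {W : Set τ} (hw : ∀ x, w x ∈ W) :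
    renameVars w P ∈ supported ℝ (literals W) := by
  classical
  rw [mem_supported]
  intro x hx
  obtain ⟨y, _, rfl⟩ := Finset.mem_image.1 (vars_rename (Sum.map w w) P hx)
  rcases y with y | y
  exacts [hw y, hw y]

theorem exists_bounded_of_finite {F : Set (Poly σ)} (hF : F.Finite) :
    ∃ δ, ∀ P ∈ F, Bounded δ δ P := by
  have := hF.to_subtype
  obtain ⟨δ, h⟩ := Finite.exists_le fun P : F => max P.1.totalDegree (terms P.1)
  exact ⟨δ, fun P hP => ⟨(le_max_left _ _).trans (h ⟨P, hP⟩), (le_max_right _ _).trans (h ⟨P, hP⟩)⟩⟩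

end Rename

section Local

variable {T : Template} (E : EncodingScheme T) (A : FinStr T.L)

/-- The encoding of an element of an instance. -/
def elemPolys (a : A.dom) : Set (Poly (A.dom × T.B.dom)) :=
  renameVars (fun x : ({a} : Set A.dom) × T.B.dom => ((x.1 : A.dom), x.2)) ''
    E.sys (pointStr A a)

/-- The encoding of a tuple in a relation of an instance. -/
def tuplePolys {r : ℕ} (R : T.L.Relations r) (t : Fin r → A.dom) :
    Set (Poly (A.dom × T.B.dom)) :=
  renameVars (fun x : Set.range t × T.B.dom => ((x.1 : A.dom), x.2)) ''
    E.sys (tupleStr A R t)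

variable {E A}

theorem EncodingScheme.IsLocal.mem_sys_iff (hE : E.IsLocal) {Q : Poly (A.dom × T.B.dom)} :
    Q ∈ E.sys A ↔ (∃ a, Q ∈ elemPolys E A a) ∨
      ∃ (r : ℕ) (R : T.L.Relations r) (t : Fin r → A.dom), RelMap R t ∧ Q ∈ tuplePolys E A R t := by
  rw [hE.union A]
  simp only [Set.mem_union, Set.mem_iUnion, elemPolys, tuplePolys, exists_prop]

theorem exists_pointStr_equiv {L : FirstOrder.Language.{0, 0}} [L.IsRelational] (A : FinStr L)
    (a : A.dom) :
    Nonempty ((pointStr (FinStr.ofRel L Unit fun _ _ _ => False) ()).dom ≃[L] (pointStr A a).dom) :=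
  ⟨{ toFun := fun _ => ⟨a, rfl⟩
     invFun := fun _ => ⟨(), rfl⟩
     left_inv := fun _ => Subtype.ext rfl
     right_inv := fun x => Subtype.ext x.2.symm
     map_fun' := fun f => isEmptyElim f
     map_rel' := fun _ _ => Iff.rfl }⟩

/-- Up to isomorphism, the structure of a tuple depends only on the symbol and on which entries
coincide. The map `u` sends each index to a chosen index with the same entry, so `u` and `t`
identify the same positions. -/
theorem exists_tupleStr_equiv {L : FirstOrder.Language.{0, 0}} [L.IsRelational] (A : FinStr L)
    {r : ℕ} (R : L.Relations r) (t : Fin r → A.dom) :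
    ∃ u : Fin r → Fin r,
      Nonempty ((tupleStr (FinStr.ofRel L (Fin r) fun _ _ _ => False) R u).dom ≃[L]
        (tupleStr A R t).dom) := by
  let u : Fin r → Fin r := fun i => Set.rangeSplitting t ⟨t i, i, rfl⟩
  have hu : ∀ i, t (u i) = t i := fun i => Set.apply_rangeSplitting t _
  have hu' : ∀ i j, t i = t j → u i = u j := fun i j h => by
    simp only [u, h]
  let g : Set.range u → Set.range t := fun x => ⟨t x.1, x.1, rfl⟩
  have hg : Function.Bijective g := by
    constructor
    · rintro ⟨_, i, rfl⟩ ⟨_, j, rfl⟩ h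
      refine Subtype.ext (hu' i j ?_)
      have := congrArg Subtype.val h
      simpa only [g, hu] using this
    · rintro ⟨_, i, rfl⟩
      exact ⟨⟨u i, i, rfl⟩, Subtype.ext (hu i)⟩
  refine ⟨u, ⟨{ toEquiv := Equiv.ofBijective g hg
                map_fun' := fun f => isEmptyElim f
                map_rel' := ?_ }⟩⟩
  intro m S x
  change (⟨m, S, fun i => t (x i).1⟩ : Σ m, L.Relations m × (Fin m → A.dom)) = ⟨r, R, t⟩ ↔
    (⟨m, S, fun i => (x i).1⟩ : Σ m, L.Relations m × (Fin m → Fin r)) = ⟨r, R, u⟩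
  constructor
  · intro h
    obtain ⟨rfl, h⟩ := Sigma.mk.inj_iff.1 h
    obtain ⟨rfl, h⟩ := Prod.mk.inj (eq_of_heq h)
    congr 2
    funext i
    obtain ⟨j, hj⟩ := (x i).2
    have h1 := congrFun h i
    simp only [← hj, hu] at h1
    rw [← hj]
    exact hu' _ _ h1
  · intro h
    obtain ⟨rfl, h⟩ := Sigma.mk.inj_iff.1 h
    obtain ⟨rfl, h⟩ := Prod.mk.inj (eq_of_heq h)
    congr 2
    funext i
    rw [congrFun h i, hu]

/-- By locality every encoding is assembled from renamed encodings of finitely many isomorphism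
types of points and tuples. -/
theorem EncodingScheme.IsLocal.exists_bounded (hE : E.IsLocal) :
    ∃ δ, ∀ (A : FinStr T.L), ∀ Q ∈ E.sys A, Bounded δ δ Q := by
  obtain ⟨δ₁, h1⟩ := exists_bounded_of_finite
    (E.finite_sys (pointStr (FinStr.ofRel T.L Unit fun _ _ _ => False) ()))
  choose δ₂ h2 using fun q : (Σ q : (Σ n, T.L.Relations n), (Fin q.1 → Fin q.1)) =>
    exists_bounded_of_finite
      (E.finite_sys (tupleStr (FinStr.ofRel T.L (Fin q.1.1) fun _ _ _ => False) q.1.2 q.2))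
  obtain ⟨δ₃, h3⟩ := Finite.exists_le δ₂
  refine ⟨δ₁ + δ₃, fun A Q hQ => ?_⟩
  rcases hE.mem_sys_iff.1 hQ with ⟨a, Q, hQ', rfl⟩ | ⟨r, R, t, _, Q, hQ', rfl⟩
  · obtain ⟨g⟩ := exists_pointStr_equiv A a
    rw [hE.invariant _ _ g] at hQ'
    obtain ⟨Q, hQ₀, rfl⟩ := hQ'
    exact (((h1 Q hQ₀).mono (by omega) (by omega)).renameVars _).renameVars _
  · obtain ⟨u, ⟨g⟩⟩ := exists_tupleStr_equiv A R t
    rw [hE.invariant _ _ g] at hQ'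
    obtain ⟨Q, hQ₀, rfl⟩ := hQ'
    have := h3 ⟨⟨r, R⟩, u⟩
    exact (((h2 ⟨⟨r, R⟩, u⟩ Q hQ₀).mono (by omega) (by omega)).renameVars _).renameVars _

/-- `v` takes values in `{0, 1}` at the variables of `a` and respects their twins. -/
def BoolAt {α β : Type} (v : (α × β) ⊕ (α × β) → ℝ) (a : α) : Prop :=
  ∀ b, (v (Sum.inl (a, b)) = 0 ∨ v (Sum.inl (a, b)) = 1) ∧
    v (Sum.inr (a, b)) = 1 - v (Sum.inl (a, b))

theorem IsBool.boolAt {α β : Type} {v : (α × β) ⊕ (α × β) → ℝ} (h : IsBool v) (a : α) :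
    BoolAt v a := fun _ => ⟨h.1 _, h.2 _⟩

/-- This is correctness on the one-element instance. The evaluation need only be Boolean at `a`,
because `v` will come from a substitution that may fail to be Boolean elsewhere. -/
theorem elemPolys_nonneg_iff {v : (A.dom × T.B.dom) ⊕ (A.dom × T.B.dom) → ℝ} {a : A.dom}
    (hv : BoolAt v a) : (∀ Q ∈ elemPolys E A a, 0 ≤ eval v Q) ↔
      ∃ y, ∀ b, v (Sum.inl (a, b)) = 1 ↔ y = b := by
  let w : (pointStr A a).dom × T.B.dom → A.dom × T.B.dom := fun x => (x.1.1, x.2)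
  have hb : IsBool (v ∘ Sum.map w w) := by
    constructor
    · rintro ⟨⟨_, rfl⟩, b⟩
      exact (hv b).1
    · rintro ⟨⟨_, rfl⟩, b⟩
      exact (hv b).2
  have := E.correct (pointStr A a) (v ∘ Sum.map w w) hb.zero_or_one fun P hP => hb.basic hP
  refine Iff.trans ⟨fun h Q hQ => ?_, ?_⟩ (this.trans ?_)
  · exact (h _ ⟨Q, hQ, rfl⟩).trans_eq (eval_renameVars w Q v)
  · rintro h _ ⟨Q, hQ, rfl⟩
    exact (h Q hQ).trans_eq (eval_renameVars w Q v).symm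
  · constructor
    · rintro ⟨h, hh⟩
      exact ⟨h ⟨a, rfl⟩, hh ⟨a, rfl⟩⟩
    · rintro ⟨y, hy⟩
      refine ⟨⟨fun _ => y, fun f => isEmptyElim f, fun _ _ h => h.elim⟩, ?_⟩
      rintro ⟨_, rfl⟩ b
      exact hy b

theorem tuplePolys_nonneg_iff {v : (A.dom × T.B.dom) ⊕ (A.dom × T.B.dom) → ℝ} {r : ℕ}
    {R : T.L.Relations r} {t : Fin r → A.dom} (hv : ∀ i, BoolAt v (t i)) :
    (∀ Q ∈ tuplePolys E A R t, 0 ≤ eval v Q) ↔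
      ∃ y : Fin r → T.B.dom, RelMap R y ∧ ∀ i b, v (Sum.inl (t i, b)) = 1 ↔ y i = b := by
  let w : (tupleStr A R t).dom × T.B.dom → A.dom × T.B.dom := fun x => (x.1.1, x.2)
  have hb : IsBool (v ∘ Sum.map w w) := by
    constructor
    · rintro ⟨⟨_, i, rfl⟩, b⟩
      exact (hv i b).1
    · rintro ⟨⟨_, i, rfl⟩, b⟩
      exact (hv i b).2
  have := E.correct (tupleStr A R t) (v ∘ Sum.map w w) hb.zero_or_one fun P hP => hb.basic hP
  refine Iff.trans ⟨fun h Q hQ => ?_, ?_⟩ (this.trans ?_)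
  · exact (h _ ⟨Q, hQ, rfl⟩).trans_eq (eval_renameVars w Q v)
  · rintro h _ ⟨Q, hQ, rfl⟩
    exact (h Q hQ).trans_eq (eval_renameVars w Q v).symm
  · constructor
    · rintro ⟨h, hh⟩
      refine ⟨fun i => h ⟨t i, i, rfl⟩, ?_, fun i b => hh ⟨t i, i, rfl⟩ b⟩
      exact h.map_rel R (fun i => ⟨t i, i, rfl⟩) rfl
    · rintro ⟨y, hy, hvy⟩
      -- Repeated entries of the tuple share their variables, so `y` induces a map on the range of
      -- `t`.
      have hind : ∀ i j, t i = t j → y i = y j := fun i j hij =>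
        (hvy i (y j)).1 (by rw [hij]; exact (hvy j (y j)).2 rfl)
      let h : Set.range t → T.B.dom := fun x => y (Set.rangeSplitting t x)
      have hh : ∀ i (x : Set.range t), x.1 = t i → h x = y i := fun i x hx =>
        hind _ _ ((Set.apply_rangeSplitting t x).trans hx)
      refine ⟨⟨h, fun f => isEmptyElim f, ?_⟩, ?_⟩
      · intro m S x hx
        change (⟨m, S, fun i => (x i).1⟩ : Σ m, T.L.Relations m × (Fin m → A.dom)) =
          ⟨r, R, t⟩ at hx
        obtain ⟨rfl, hx⟩ := Sigma.mk.inj_iff.1 hx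
        obtain ⟨rfl, hx⟩ := Prod.mk.inj (eq_of_heq hx)
        have : h ∘ x = y := funext fun i => hh i (x i) (congrFun hx i)
        change RelMap S (h ∘ x)
        rwa [this]
      · rintro ⟨_, i, rfl⟩ b
        change v (Sum.inl (t i, b)) = 1 ↔ h ⟨t i, i, rfl⟩ = b
        rw [hh i _ rfl]
        exact hvy i b

end Local

/-! ### The direct encoding -/

section Direct

variable (T : Template)

/-- The sum of the variables of an element minus one. -/
noncomputable def totalPoly {α : Type} (a : α) : Poly (α × T.B.dom) :=
  letI := Fintype.ofFinite T.B.dom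
  ∑ b, var (a, b) - 1

/-- The inequality that excludes the assignment `y` of the tuple `t`. -/
noncomputable def excludePoly {α : Type} {r : ℕ} (t : Fin r → α) (y : Fin r → T.B.dom) :
    Poly (α × T.B.dom) := -∏ i, var (t i, y i)

/-- The system of inequalities of the direct encoding. -/
inductive DirectSys (A : FinStr T.L) : Poly (A.dom × T.B.dom) → Prop
  | total (a : A.dom) : DirectSys A (totalPoly T a)
  | total_neg (a : A.dom) : DirectSys A (-totalPoly T a)
  | exclude {r : ℕ} (R : T.L.Relations r) (t : Fin r → A.dom) (ht : RelMap R t)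
      (y : Fin r → T.B.dom) (hy : ¬ RelMap R y) : DirectSys A (excludePoly T t y)

variable {T}

theorem renameVars_totalPoly {α β : Type} (g : α → β) (a : α) :
    renameVars (fun x : α × T.B.dom => (g x.1, x.2)) (totalPoly T a) = totalPoly T (g a) := by
  simp [renameVars, totalPoly, var]

theorem renameVars_neg {σ τ : Type} (w : σ → τ) (P : Poly σ) :
    renameVars w (-P) = -renameVars w P := map_neg (rename _) P

theorem renameVars_excludePoly {α β : Type} (g : α → β) {r : ℕ} (t : Fin r → α)
    (y : Fin r → T.B.dom) :
    renameVars (fun x : α × T.B.dom => (g x.1, x.2)) (excludePoly T t y) =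
      excludePoly T (g ∘ t) y := by
  simp [renameVars, excludePoly, var]

theorem DirectSys.rename {A A' : FinStr T.L} (g : A.dom → A'.dom)
    (hg : ∀ {r : ℕ} (R : T.L.Relations r) (t : Fin r → A.dom), RelMap R t → RelMap R (g ∘ t))
    {P : Poly (A.dom × T.B.dom)} (hP : DirectSys T A P) :
    DirectSys T A' (renameVars (fun x => (g x.1, x.2)) P) := by
  cases hP with
  | total a =>
    rw [renameVars_totalPoly]
    exact .total _
  | total_neg a =>
    rw [renameVars_neg, renameVars_totalPoly]
    exact .total_neg _
  | exclude R t ht y hy =>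
    rw [renameVars_excludePoly]
    exact .exclude R _ (hg R t ht) y hy

theorem finite_directSys (A : FinStr T.L) : {P | DirectSys T A P}.Finite := by
  have h1 : (Set.range fun a : A.dom => totalPoly T a).Finite := Set.finite_range _
  have h2 : (Set.range fun a : A.dom => -totalPoly T a).Finite := Set.finite_range _
  have h3 : (Set.range fun q : (Σ q : A.Tuple, (Fin q.1.1 → T.B.dom)) =>
      excludePoly T q.1.1.2.2 q.2).Finite := Set.finite_range _
  refine ((h1.union h2).union h3).subset ?_
  rintro P (a | a | ⟨R, t, ht, y, hy⟩)
  · exact Or.inl (Or.inl ⟨a, rfl⟩)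
  · exact Or.inl (Or.inr ⟨a, rfl⟩)
  · exact Or.inr ⟨⟨⟨⟨_, R, t⟩, ht⟩, y⟩, rfl⟩

theorem directSys_correct (A : FinStr T.L) {v : (A.dom × T.B.dom) ⊕ (A.dom × T.B.dom) → ℝ}
    (hv : IsBool v) : (∀ P, DirectSys T A P → 0 ≤ eval v P) ↔
      ∃ h : A.dom →[T.L] T.B.dom, ∀ a b, v (Sum.inl (a, b)) = 1 ↔ h a = b := by
  classical
  let _ := Fintype.ofFinite T.B.dom
  have htot : ∀ a, eval v (totalPoly T a) = ∑ b, v (Sum.inl (a, b)) - 1 := fun a => by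
    simp [totalPoly, var]
  have hexc : ∀ {r : ℕ} (t : Fin r → A.dom) (y : Fin r → T.B.dom),
      eval v (excludePoly T t y) = -∏ i, v (Sum.inl (t i, y i)) := fun t y => by
    simp [excludePoly, var]
  constructor
  · intro H
    have hex : ∀ a, ∃ y, ∀ b, v (Sum.inl (a, b)) = 1 ↔ y = b := fun a => by
      have h1 := H _ (.total a)
      have h2 := H _ (.total_neg a)
      rw [map_neg] at h2
      rw [htot] at h1 h2
      have h3 : ∑ b, v (Sum.inl (a, b)) = 1 := by linarith
      obtain ⟨y, _, hy⟩ := Finset.exists_ne_zero_of_sum_ne_zero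
        (show ∑ b, v (Sum.inl (a, b)) ≠ 0 by rw [h3]; exact one_ne_zero)
      have hy1 := (hv.1 (a, y)).resolve_left hy
      refine ⟨y, fun b => ⟨fun hb => ?_, fun hb => hb ▸ hy1⟩⟩
      by_contra hne
      have h4 := Finset.add_le_sum (f := fun b => v (Sum.inl (a, b))) (s := Finset.univ)
        (fun b _ => by rcases hv.1 (a, b) with h | h <;> simp [h])
        (Finset.mem_univ y) (Finset.mem_univ b) hne
      simp only [hy1, hb, h3] at h4
      norm_num at h4
    choose h hh using hex
    refine ⟨⟨h, fun f => isEmptyElim f, fun R t ht => ?_⟩, hh⟩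
    by_contra hcon
    have h1 := H _ (.exclude R t ht (h ∘ t) hcon)
    have h2 : ∏ i, v (Sum.inl (t i, (h ∘ t) i)) = 1 :=
      Finset.prod_eq_one fun i _ => (hh _ _).2 rfl
    rw [hexc, h2] at h1
    norm_num at h1
  · rintro ⟨h, hh⟩ P hP
    have hsum : ∀ a, ∑ b, v (Sum.inl (a, b)) = 1 := fun a => by
      rw [Finset.sum_eq_single (h a), (hh a _).2 rfl]
      · intro b _ hb
        exact (hv.1 (a, b)).resolve_right fun h1 => hb ((hh a b).1 h1).symm
      · simp
    cases hP with
    | total a => rw [htot, hsum, sub_self]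
    | total_neg a => rw [map_neg, htot, hsum, sub_self, neg_zero]
    | exclude R t ht y hy =>
      rw [hexc]
      have : ∃ i, v (Sum.inl (t i, y i)) = 0 := by
        by_contra hcon
        push Not at hcon
        have : h ∘ t = y := funext fun i =>
          (hh _ _).1 ((hv.1 (t i, y i)).resolve_left (hcon i))
        exact hy (this ▸ h.map_rel R t ht)
      obtain ⟨i, hi⟩ := this
      rw [Finset.prod_eq_zero (Finset.mem_univ i) hi, neg_zero]

variable (T)

/-- The direct encoding scheme. -/
def directScheme : EncodingScheme T where
  sys A := {P | DirectSys T A P}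
  finite_sys := finite_directSys
  correct A _ h01 hbasic := directSys_correct A (isBool_of_basic h01 hbasic)

/-- Composing two transfers requires some local encoding for the intermediate template, and the
direct encoding provides one. -/
theorem directScheme_isLocal : (directScheme T).IsLocal where
  invariant A A' g := by
    have h1 : ∀ P, DirectSys T A P → DirectSys T A' (renameVars (fun x => (g x.1, x.2)) P) :=
      fun P hP => DirectSys.rename (fun x => g x) (fun R t h => (g.map_rel R t).2 h) hP
    have h2 : ∀ P, DirectSys T A' P →
        DirectSys T A (renameVars (fun x => (g.symm x.1, x.2)) P) :=
      fun P hP => DirectSys.rename (fun x => g.symm x) (fun R t h => (g.symm.map_rel R t).2 h) hP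
    have h3 : Function.LeftInverse (fun x : A.dom × T.B.dom => (g x.1, x.2))
        fun x : A'.dom × T.B.dom => (g.symm x.1, x.2) :=
      fun x => Prod.ext (g.apply_symm_apply x.1) rfl
    ext P
    constructor
    · exact fun hP => ⟨_, h2 P hP, renameVars_leftInverse h3 P⟩
    · rintro ⟨Q, hQ, rfl⟩
      exact h1 Q hQ
  union A := by
    refine Set.Subset.antisymm (fun P hP => ?_) ?_
    · rcases hP with a | a | ⟨R, t, ht, y, hy⟩
      · refine Or.inl (Set.mem_iUnion.2 ⟨a, _, DirectSys.total (A := pointStr A a) ⟨a, rfl⟩, ?_⟩)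
        exact renameVars_totalPoly (Subtype.val : ({a} : Set A.dom) → A.dom) _
      · refine Or.inl (Set.mem_iUnion.2 ⟨a, _,
          DirectSys.total_neg (A := pointStr A a) ⟨a, rfl⟩, ?_⟩)
        exact (renameVars_neg _ _).trans
          (congrArg _ (renameVars_totalPoly (Subtype.val : ({a} : Set A.dom) → A.dom) _))
      · refine Or.inr ?_
        simp only [Set.mem_iUnion]
        refine ⟨_, R, t, ht, _,
          DirectSys.exclude (A := tupleStr A R t) R (fun i => ⟨t i, i, rfl⟩) rfl y hy, ?_⟩
        exact renameVars_excludePoly (Subtype.val : Set.range t → A.dom) _ y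
    · rintro P (hP | hP)
      · obtain ⟨a, P, hP', rfl⟩ := Set.mem_iUnion.1 hP
        exact DirectSys.rename (A := pointStr A a) (Subtype.val : ({a} : Set A.dom) → A.dom)
          (fun R t h => h.elim) hP'
      · simp only [Set.mem_iUnion] at hP
        obtain ⟨r, R, t, ht, P, hP', rfl⟩ := hP
        refine DirectSys.rename (A := tupleStr A R t) (Subtype.val : Set.range t → A.dom)
          (fun {m} S x h => ?_) hP'
        change (⟨m, S, fun i => (x i).1⟩ : Σ m, T.L.Relations m × (Fin m → A.dom)) =
          ⟨r, R, t⟩ at h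
        obtain ⟨rfl, h⟩ := Sigma.mk.inj_iff.1 h
        obtain ⟨rfl, h⟩ := Prod.mk.inj (eq_of_heq h)
        change RelMap S (fun i => (x i).1)
        rwa [h]

end Direct

/-! ### Local consequences of a system of inequalities -/

section Forces

variable {α β : Type}

/-- `Φ` follows from bounded derivable inequalities on a bounded set of elements. -/
def Forces (H : Set (Poly (α × β))) (ρ δ D N : ℕ) (Φ : ((α × β) ⊕ (α × β) → ℝ) → Prop) : Prop :=
  ∃ (W : Finset α) (G : Set (Poly (α × β))), W.card ≤ ρ ∧
    (∀ g ∈ G, g.totalDegree ≤ δ ∧ g ∈ supported ℝ (literals {x : α × β | x.1 ∈ W}) ∧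
      Cone H D N g) ∧
    ∀ v, IsBool v → (∀ g ∈ G, 0 ≤ eval v g) → Φ v

variable {H : Set (Poly (α × β))} {ρ δ D N ρ' δ' D' N' : ℕ}
  {Φ Ψ : ((α × β) ⊕ (α × β) → ℝ) → Prop}

theorem supported_literals_mono {W W' : Finset α} (h : W ⊆ W') :
    supported ℝ (literals {x : α × β | x.1 ∈ W}) ≤
      supported ℝ (literals {x : α × β | x.1 ∈ W'}) :=
  supported_mono fun x (hx : (Sum.elim id id x).1 ∈ W) => h hx

theorem Forces.mono (h : Forces H ρ δ D N Φ) (hρ : ρ ≤ ρ') (hδ : δ ≤ δ') (hD : D ≤ D')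
    (hN : N ≤ N') : Forces H ρ' δ' D' N' Φ := by
  obtain ⟨W, G, h1, h2, h3⟩ := h
  exact ⟨W, G, h1.trans hρ, fun g hg => ⟨(h2 g hg).1.trans hδ, (h2 g hg).2.1,
    (h2 g hg).2.2.mono hD hN⟩, h3⟩

theorem Forces.imp (h : Forces H ρ δ D N Φ) (hΦ : ∀ v, IsBool v → Φ v → Ψ v) :
    Forces H ρ δ D N Ψ := by
  obtain ⟨W, G, h1, h2, h3⟩ := h
  exact ⟨W, G, h1, h2, fun v hv hg => hΦ v hv (h3 v hv hg)⟩

theorem Forces.trivial (h : ∀ v, IsBool v → Φ v) : Forces H ρ δ D N Φ :=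
  ⟨∅, ∅, by simp, by simp, fun v hv _ => h v hv⟩

theorem Forces.and (h : Forces H ρ δ D N Φ) (h' : Forces H ρ' δ D N Ψ) :
    Forces H (ρ + ρ') δ D N fun v => Φ v ∧ Ψ v := by
  classical
  obtain ⟨W, G, h1, h2, h3⟩ := h
  obtain ⟨W', G', h1', h2', h3'⟩ := h'
  refine ⟨W ∪ W', G ∪ G', (Finset.card_union_le _ _).trans (Nat.add_le_add h1 h1'), ?_, ?_⟩
  · intro g hg
    rcases (Set.mem_union g G G').1 hg with hg | hg
    · exact ⟨(h2 g hg).1, supported_literals_mono Finset.subset_union_left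
        (h2 g hg).2.1, (h2 g hg).2.2⟩
    · exact ⟨(h2' g hg).1, supported_literals_mono Finset.subset_union_right
        (h2' g hg).2.1, (h2' g hg).2.2⟩
  · intro v hv hg
    exact ⟨h3 v hv fun g hg' => hg g (Or.inl hg'), h3' v hv fun g hg' => hg g (Or.inr hg')⟩

theorem Forces.forall {n : ℕ} {Φ : Fin n → ((α × β) ⊕ (α × β) → ℝ) → Prop}
    (h : ∀ i, Forces H ρ δ D N (Φ i)) : Forces H (n * ρ) δ D N fun v => ∀ i, Φ i v := by
  induction n with
  | zero => exact Forces.trivial fun _ _ i => i.elim0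
  | succ n ih =>
    have h1 := (ih fun i => h i.succ).and (h 0)
    rw [← Nat.succ_mul] at h1
    exact h1.imp fun v _ hv => Fin.cases hv.2 hv.1

/-- Local consequences are derivable. -/
theorem exists_forces_bounds (ρ δ q : ℕ) :
    ∃ D₁ N₁ : ℕ, ∀ {α β : Type} [Finite β] (H : Set (Poly (α × β))) (D N : ℕ) (P : Poly (α × β))
      (W : Finset α) (Φ : ((α × β) ⊕ (α × β) → ℝ) → Prop), Nat.card β ≤ q → W.card ≤ ρ →
      P.totalDegree ≤ δ → P ∈ supported ℝ (literals {x : α × β | x.1 ∈ W}) →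
      Forces H ρ δ D N Φ → (∀ v, IsBool v → Φ v → 0 ≤ eval v P) →
      Cone H (D + D₁) (N₁ * (N + 1)) P := by
  classical
  -- At most `ρ` elements occur in `P` and at most `ρ` in the forcing inequalities, each with at
  -- most `q` values.
  obtain ⟨D₁, N₁, h⟩ := exists_cone_bounds ((ρ + ρ) * q) δ
  refine ⟨D₁, N₁, ?_⟩
  intro α β _ H D N P W Φ hβ hW hδ hP hΦ hsem
  let _ := Fintype.ofFinite β
  obtain ⟨W', G, h1, h2, h3⟩ := hΦ
  have hmono : ∀ W₁ ⊆ W ∪ W', supported ℝ (literals {x : α × β | x.1 ∈ W₁}) ≤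
      supported ℝ (literals (((W ∪ W') ×ˢ Finset.univ : Finset (α × β)) : Set (α × β))) :=
    fun W₁ h => supported_mono fun x (hx : (Sum.elim id id x).1 ∈ W₁) =>
      Finset.mem_coe.2 (Finset.mem_product.2 ⟨h hx, Finset.mem_univ _⟩)
  refine h H ((W ∪ W') ×ˢ Finset.univ) P G D N ?_ hδ (hmono W Finset.subset_union_left hP)
    (fun g hg => ⟨(h2 g hg).1, hmono W' Finset.subset_union_right (h2 g hg).2.1, (h2 g hg).2.2⟩)
    fun v hv hg => hsem v hv (h3 v hv hg)
  rw [Finset.card_product, Finset.card_univ, ← Nat.card_eq_fintype_card]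
  exact Nat.mul_le_mul ((Finset.card_union_le _ _).trans (Nat.add_le_add hW h1)) hβ

end Forces

/-! ### Substitutions defined by partial assignments -/

section AssignSum

variable {α β : Type}

/-- The exponent of the product of the variables that hold under an assignment. -/
noncomputable def assignExp {D : Finset α} (g : D → β) : ((α × β) ⊕ (α × β)) →₀ ℕ :=
  ∑ a, Finsupp.single (Sum.inl (a.1, g a)) 1

theorem monomial_assignExp {D : Finset α} (g : D → β) :
    (monomial (assignExp g) 1 : Poly (α × β)) = ∏ a, var (a.1, g a) := by
  unfold assignExp
  rw [monomial_sum_one]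
  rfl

variable [Finite β]

open Classical in
/-- The sum of the products of variables that correspond to the assignments with property `p`. -/
noncomputable def assignSum (D : Finset α) (p : (D → β) → Prop) : Poly (α × β) :=
  letI := Fintype.ofFinite β
  ∑ g : D → β with p g, monomial (assignExp g) 1

theorem assignSum_isSumMonomials {D : Finset α} {r : ℕ} (hD : D.card ≤ r) (p : (D → β) → Prop) :
    IsSumMonomials ((Nat.card β + 1) ^ r) r (assignSum D p) := by
  classical
  let _ := Fintype.ofFinite β
  refine ⟨(Finset.univ.filter p).toList.map assignExp, ?_, ?_, ?_⟩
  · rw [List.map_map]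
    exact (Finset.sum_map_toList _ _).symm
  · rw [List.length_map, Finset.length_toList]
    refine (Finset.card_filter_le _ _).trans ?_
    rw [Finset.card_univ, Fintype.card_fun, Fintype.card_coe, ← Nat.card_eq_fintype_card]
    exact (Nat.pow_le_pow_left (Nat.le_succ _) _).trans (Nat.pow_le_pow_right (by omega) hD)
  · intro e he
    obtain ⟨g, _, rfl⟩ := List.mem_map.1 he
    simpa [assignExp, map_sum] using hD

theorem assignSum_mem_supported {D W : Finset α} (h : D ⊆ W) (p : (D → β) → Prop) :
    assignSum D p ∈ supported ℝ (literals {x : α × β | x.1 ∈ W}) := by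
  unfold assignSum
  refine sum_mem fun g _ => ?_
  rw [monomial_assignExp]
  exact prod_mem fun a _ => X_mem_supported.2 (h a.2)

-- At a Boolean point with values `h`, exactly one of the products is nonzero, namely the one that
-- belongs to `h`.
open Classical in
theorem eval_assignSum {D : Finset α} (p : (D → β) → Prop) {v : (α × β) ⊕ (α × β) → ℝ}
    (hv : IsBool v) {h : D → β} (hh : ∀ a b, v (Sum.inl (a.1, b)) = 1 ↔ h a = b) :
    eval v (assignSum D p) = if p h then 1 else 0 := by
  let _ := Fintype.ofFinite β
  have key : ∀ g : D → β, eval v (monomial (assignExp g) 1) = if g = h then 1 else 0 := fun g => by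
    rw [monomial_assignExp, map_prod]
    simp only [var, eval_X]
    split_ifs with hg
    · exact Finset.prod_eq_one fun a _ => (hh a _).2 (by rw [hg])
    · obtain ⟨a, ha⟩ := Function.ne_iff.1 hg
      exact Finset.prod_eq_zero (Finset.mem_univ a)
        ((hv.1 _).resolve_right fun h1 => ha ((hh a _).1 h1).symm)
  unfold assignSum
  rw [map_sum, Finset.sum_congr rfl fun g _ => key g]
  simp [Finset.sum_ite_eq']

end AssignSum

/-! ### Gadgets: substitutions that compute the values of new elements. -/

section Gadget

/-- Every element of an instance over `β'` is given a value that depends on the values of some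
elements of an instance over `β`. -/
structure Gadget (α β α' β' : Type) where
  dep : α' → Finset α
  val : ∀ x, (dep x → β) → Option β'

variable {α β α' β' : Type}

namespace Gadget

/-- `x` has the value `b` under the evaluation `v`. -/
def Holds (G : Gadget α β α' β') (v : (α × β) ⊕ (α × β) → ℝ) (x : α') (b : β') : Prop :=
  ∃ h : G.dep x → β, (∀ a b, v (Sum.inl (a.1, b)) = 1 ↔ h a = b) ∧ G.val x h = some b

variable [Finite β]

/-- The substitution of a gadget. -/
noncomputable def subst (G : Gadget α β α' β') : (α' × β') ⊕ (α' × β') → Poly (α × β) :=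
  Sum.elim (fun x => assignSum (G.dep x.1) fun g => G.val x.1 g = some x.2)
    -- The twin is the complementary sum rather than one minus the first sum, so its monomials also
    -- have coefficient `1`.
    (fun x => assignSum (G.dep x.1) fun g => G.val x.1 g ≠ some x.2)

variable {G : Gadget α β α' β'}

theorem isMonomialSubst {r : ℕ} (hr : ∀ x, (G.dep x).card ≤ r) :
    IsMonomialSubst G.subst ((Nat.card β + 1) ^ r) r := by
  rintro (x | x) <;> exact assignSum_isSumMonomials (hr _) _

theorem subst_mem_supported {W : Finset α} {x : (α' × β') ⊕ (α' × β')}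
    (h : G.dep (Sum.elim id id x).1 ⊆ W) :
    G.subst x ∈ supported ℝ (literals {x : α × β | x.1 ∈ W}) := by
  rcases x with x | x <;> exact assignSum_mem_supported h _

theorem Holds.eval_subst {v : (α × β) ⊕ (α × β) → ℝ} (hv : IsBool v) {x : α'} {b : β'}
    (h : G.Holds v x b) : BoolAt (fun u => eval v (G.subst u)) x ∧
      ∀ b', eval v (G.subst (Sum.inl (x, b'))) = 1 ↔ b = b' := by
  classical
  obtain ⟨g, hg, hb⟩ := h
  have h1 : ∀ b', eval v (G.subst (Sum.inl (x, b'))) = if b = b' then 1 else 0 := fun b' => by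
    refine (eval_assignSum _ hv hg).trans ?_
    rw [hb]
    by_cases h : b = b' <;> simp [h]
  have h2 : ∀ b', eval v (G.subst (Sum.inr (x, b'))) = if b = b' then 0 else 1 := fun b' => by
    refine (eval_assignSum _ hv hg).trans ?_
    rw [hb]
    by_cases h : b = b' <;> simp [h]
  refine ⟨fun b' => ?_, fun b' => ?_⟩
  · dsimp only
    rw [h1, h2]
    by_cases h : b = b' <;> simp [h]
  · rw [h1]
    by_cases h : b = b' <;> simp [h]

end Gadget

theorem eval_bind₁ {σ τ : Type} (f : σ ⊕ σ → Poly τ) (P : Poly σ) (v : τ ⊕ τ → ℝ) :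
    eval v (bind₁ f P) = eval (fun u => eval v (f u)) P := by
  induction P using MvPolynomial.induction_on with
  | C a => simp
  | add p q hp hq => simp [hp, hq]
  | mul_X p u hp => simp [hp]

theorem bind₁_renameVars_mem {ω σ τ : Type} {f : σ ⊕ σ → Poly τ} {w : ω → σ}
    {A : Subalgebra ℝ (Poly τ)} (h : ∀ u, f (Sum.map w w u) ∈ A) (P : Poly ω) :
    bind₁ f (renameVars w P) ∈ A := by
  unfold renameVars
  rw [bind₁_rename]
  induction P using MvPolynomial.induction_on with
  | C a =>
    rw [algHom_C]
    exact A.algebraMap_mem a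
  | add p q hp hq =>
    rw [map_add]
    exact add_mem hp hq
  | mul_X p u hp =>
    rw [map_mul, bind₁_X_right]
    exact mul_mem hp (h u)

/-- A basic inequality other than `1 ≥ 0` concerns a single variable and its twin. -/
theorem Basic.eq_one_or {σ : Type} {P : Poly σ} (h : Basic P) :
    P = 1 ∨ ∃ (u : σ) (P₀ : Poly Unit), Basic P₀ ∧ P = renameVars (fun _ => u) P₀ := by
  have hv : ∀ u : σ, renameVars (fun _ : Unit => u) (var ()) = var u := fun u => by
    simp [renameVars, var]
  have ht : ∀ u : σ, renameVars (fun _ : Unit => u) (twin ()) = twin u := fun u => by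
    simp [renameVars, twin]
  have h1 : ∀ u : σ, renameVars (fun _ : Unit => u) 1 = 1 := fun u => map_one (rename _)
  have hs : ∀ (u : σ) (P Q), renameVars (fun _ : Unit => u) (P - Q) =
      renameVars (fun _ => u) P - renameVars (fun _ => u) Q := fun u P Q => map_sub (rename _) P Q
  have ha : ∀ (u : σ) (P Q), renameVars (fun _ : Unit => u) (P + Q) =
      renameVars (fun _ => u) P + renameVars (fun _ => u) Q := fun u P Q => map_add (rename _) P Q
  have hp : ∀ (u : σ) (P), renameVars (fun _ : Unit => u) (P ^ 2) =
      renameVars (fun _ => u) P ^ 2 := fun u P => map_pow (rename _) P 2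
  cases h with
  | one => exact Or.inl rfl
  | sq u => exact Or.inr ⟨u, _, .sq (), by rw [hs, hp, hv]⟩
  | sq_neg u => exact Or.inr ⟨u, _, .sq_neg (), by rw [renameVars_neg, hs, hp, hv]⟩
  | twin_sq u => exact Or.inr ⟨u, _, .twin_sq (), by rw [hs, hp, ht]⟩
  | twin_sq_neg u => exact Or.inr ⟨u, _, .twin_sq_neg (), by rw [renameVars_neg, hs, hp, ht]⟩
  | sum u => exact Or.inr ⟨u, _, .sum (), by rw [hs, ha, hv, ht, h1]⟩
  | sum_neg u => exact Or.inr ⟨u, _, .sum_neg (), by rw [renameVars_neg, hs, ha, hv, ht, h1]⟩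
  | nonneg u => exact Or.inr ⟨u, _, .nonneg (), by rw [hv]⟩
  | twin_nonneg u => exact Or.inr ⟨u, _, .twin_nonneg (), by rw [ht]⟩
  | le_one u => exact Or.inr ⟨u, _, .le_one (), by rw [hs, hv, h1]⟩
  | twin_le_one u => exact Or.inr ⟨u, _, .twin_le_one (), by rw [hs, ht, h1]⟩

theorem exists_arity_bound (L : FirstOrder.Language.{0, 0}) [Finite (Σ n, L.Relations n)] :
    ∃ m, ∀ {r : ℕ} (_ : L.Relations r), r ≤ m := by
  obtain ⟨m, h⟩ := Finite.exists_le fun q : (Σ n, L.Relations n) => q.1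
  exact ⟨m, fun {r} R => h ⟨r, R⟩⟩

theorem exists_supported_finset {σ : Type} {W : Finset σ} {P : Poly σ}
    (h : P ∈ supported ℝ (literals (W : Set σ))) :
    ∃ W' : Finset (σ ⊕ σ), W'.card ≤ 2 * W.card ∧ P ∈ supported ℝ (W' : Set (σ ⊕ σ)) := by
  refine ⟨W.disjSum W, by rw [Finset.card_disjSum]; omega, supported_mono ?_ h⟩
  rintro (x | x) hx
  · exact Finset.mem_coe.2 (Finset.inl_mem_disjSum.2 hx)
  · exact Finset.mem_coe.2 (Finset.inr_mem_disjSum.2 hx)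

variable {U V : Template}

/-- Each inequality belongs to one element or one tuple, hence to at most `m + 1` elements. The
factor `2` counts the twins. -/
theorem EncodingScheme.IsLocal.exists_supported {E : EncodingScheme U} (hE : E.IsLocal) :
    ∃ n₀, ∀ (A : FinStr U.L), ∀ Q ∈ E.sys A, ∃ W : Finset ((A.dom × U.B.dom) ⊕ (A.dom × U.B.dom)),
      W.card ≤ n₀ ∧ Q ∈ supported ℝ (W : Set ((A.dom × U.B.dom) ⊕ (A.dom × U.B.dom))) := by
  classical
  obtain ⟨m, hm⟩ := exists_arity_bound U.L
  let _ := Fintype.ofFinite U.B.dom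
  refine ⟨2 * ((m + 1) * Fintype.card U.B.dom), fun A Q hQ => ?_⟩
  have key : ∀ (W : Finset A.dom), W.card ≤ m + 1 →
      Q ∈ supported ℝ (literals {x : A.dom × U.B.dom | x.1 ∈ W}) →
      ∃ W : Finset ((A.dom × U.B.dom) ⊕ (A.dom × U.B.dom)),
        W.card ≤ 2 * ((m + 1) * Fintype.card U.B.dom) ∧
          Q ∈ supported ℝ (W : Set ((A.dom × U.B.dom) ⊕ (A.dom × U.B.dom))) := fun W hW h => by
    have hset : {x : A.dom × U.B.dom | x.1 ∈ W} =
        ((W ×ˢ Finset.univ : Finset (A.dom × U.B.dom)) : Set (A.dom × U.B.dom)) := by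
      ext x
      simp
    rw [hset] at h
    obtain ⟨W', h1, h2⟩ := exists_supported_finset h
    refine ⟨W', h1.trans (Nat.mul_le_mul_left 2 ?_), h2⟩
    rw [Finset.card_product, Finset.card_univ]
    exact Nat.mul_le_mul_right _ hW
  rcases hE.mem_sys_iff.1 hQ with ⟨a, Q, _, rfl⟩ | ⟨r, R, t, _, Q, _, rfl⟩
  · refine key {a} (by simp) (renameVars_mem_supported fun x => ?_)
    exact Finset.mem_singleton.2 x.1.2
  · refine key (Finset.univ.image t) (Finset.card_image_le.trans ?_)
      (renameVars_mem_supported fun x => ?_)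
    · rw [Finset.card_univ, Fintype.card_fin]
      exact (hm R).trans (Nat.le_succ m)
    · obtain ⟨i, hi⟩ := x.1.2
      exact Finset.mem_image.2 ⟨i, Finset.mem_univ i, hi⟩

/-- A gadget whose values are forced to be homomorphisms gives a translation. -/
theorem exists_translates_bounds {E : EncodingScheme U} {E' : EncodingScheme V} (hE : E.IsLocal)
    (hE' : E'.IsLocal) (r ρ δ : ℕ) :
    ∃ M D₁ N₁ δ' n₀ : ℕ, ∀ (A : FinStr V.L) (A' : FinStr U.L)
      (G : Gadget A.dom V.B.dom A'.dom U.B.dom) (D N : ℕ), (∀ x, (G.dep x).card ≤ r) →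
      (∀ x, Forces (E'.sys A) ρ δ D N fun v => ∃ b, G.Holds v x b) →
      (∀ (n : ℕ) (R : U.L.Relations n) (t : Fin n → A'.dom), RelMap R t →
        Forces (E'.sys A) ρ δ D N fun v => ∃ y, RelMap R y ∧ ∀ i, G.Holds v (t i) (y i)) →
      Translates (E.sys A') (E'.sys A) G.subst M r (D + D₁) (N₁ * (N + 1)) δ' δ' n₀ := by
  classical
  obtain ⟨δE, hδE⟩ := hE.exists_bounded
  obtain ⟨δ', hδ'⟩ := hE'.exists_bounded
  obtain ⟨n₀, hn₀⟩ := hE.exists_supported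
  obtain ⟨m, hm⟩ := exists_arity_bound U.L
  -- The elements counted are `ρ` for the forcing inequalities, `r` for the dependencies of one
  -- element and `m * r` for those of a tuple. Hypotheses and axioms have degree at most `δE + 2`,
  -- and the substitution multiplies degrees by `r`.
  obtain ⟨D₁, N₁, hcone⟩ := exists_forces_bounds (ρ + r + m * r) (δ + r * (δE + 2))
    (Nat.card V.B.dom)
  -- The summand `1` in `N₁ + 1` leaves room for the axiom `1 ≥ 0`, which is its own image.
  refine ⟨(Nat.card V.B.dom + 1) ^ r, D₁, N₁ + 1, δ', n₀, ?_⟩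
  intro A A' G D N hr helem htuple
  have hsub := Gadget.isMonomialSubst (G := G) hr
  have hpos : 0 < (Nat.card V.B.dom + 1) ^ r := by positivity
  have main : ∀ {ω : Type} (w : ω → A'.dom × U.B.dom) (Q : Poly ω) (W : Finset A.dom)
      (Φ : ((A.dom × V.B.dom) ⊕ (A.dom × V.B.dom) → ℝ) → Prop), Q.totalDegree ≤ δE + 2 →
      W.card ≤ r + m * r → (∀ o, G.dep (w o).1 ⊆ W) → Forces (E'.sys A) ρ δ D N Φ →
      (∀ v, IsBool v → Φ v → 0 ≤ eval (fun u => eval v (G.subst u)) (renameVars w Q)) →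
      Cone (E'.sys A) (D + D₁) ((N₁ + 1) * (N + 1)) (bind₁ G.subst (renameVars w Q)) := by
    intro ω w Q W Φ hQ hW hdep hΦ hsem
    refine (hcone (E'.sys A) D N _ W Φ le_rfl (by omega) ?_ ?_
      (hΦ.mono (by omega) (by omega) le_rfl le_rfl)
      fun v hv h => by rw [eval_bind₁]; exact hsem v hv h).mono le_rfl
        (Nat.mul_le_mul_right _ (Nat.le_succ _))
    · have h1 := (hsub.bounded hpos (P := renameVars w Q)
        ((totalDegree_rename_le _ Q).trans hQ) le_rfl).1
      omega
    · refine bind₁_renameVars_mem (fun u => Gadget.subst_mem_supported ?_) Q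
      rcases u with u | u <;> exact hdep u
  refine ⟨hsub, ?_, hδ' A, hn₀ A'⟩
  rintro Q (hQ | hQ)
  · have hQ' := hQ
    rcases hE.mem_sys_iff.1 hQ with ⟨a, Q, hQ₀, rfl⟩ | ⟨n, R, t, ht, Q, hQ₀, rfl⟩
    · refine main _ Q (G.dep a) _ ((hδE (pointStr A' a) Q hQ₀).1.trans (Nat.le_add_right _ 2))
        ((hr a).trans (by omega)) (fun o => ?_) (helem a) ?_
      · rw [show o.1.1 = a from o.1.2]
      · rintro v hv ⟨b, hb⟩
        obtain ⟨h1, h2⟩ := hb.eval_subst hv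
        exact (elemPolys_nonneg_iff (E := E) h1).2 ⟨b, h2⟩ _ ⟨Q, hQ₀, rfl⟩
    · refine main _ Q (Finset.univ.biUnion fun i => G.dep (t i)) _
        ((hδE (tupleStr A' R t) Q hQ₀).1.trans (Nat.le_add_right _ 2)) ?_
        (fun o => ?_) (htuple n R t ht) ?_
      · refine (Finset.card_biUnion_le_card_mul _ _ r fun i _ => hr (t i)).trans ?_
        rw [Finset.card_univ, Fintype.card_fin]
        have := Nat.mul_le_mul_right r (hm R)
        omega
      · obtain ⟨i, hi⟩ := o.1.2
        rw [show o.1.1 = t i from hi.symm]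
        exact Finset.subset_biUnion_of_mem (fun i => G.dep (t i)) (Finset.mem_univ i)
      · rintro v hv ⟨y, hy, h⟩
        exact (tuplePolys_nonneg_iff (E := E) fun i => ((h i).eval_subst hv).1).2
          ⟨y, hy, fun i => ((h i).eval_subst hv).2⟩ _ ⟨Q, hQ₀, rfl⟩
  · rcases hQ.eq_one_or with rfl | ⟨⟨x, b⟩, Q, hQ₀, rfl⟩
    · rw [map_one]
      exact (Cone.of_mem (D := 0) (Or.inr Basic.one)).mono (Nat.zero_le _)
        (Nat.mul_pos (by omega) (by omega))
    · refine main _ Q (G.dep x) _ ((basic_bounded hQ₀).1.trans (Nat.le_add_left 2 _))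
        ((hr x).trans (by omega)) (fun _ => subset_rfl) (helem x) ?_
      rintro v hv ⟨b', hb⟩
      rw [eval_renameVars]
      refine IsBool.basic ⟨fun _ => ?_, fun _ => ?_⟩ hQ₀
      · exact ((hb.eval_subst hv).1 b).1
      · exact ((hb.eval_subst hv).1 b).2

end Gadget

/-! ### Single constructions -/

/-! ### Polynomial bounds in the size of the instance. -/

section PowerBounded

/-- Functions that are bounded by a power of `a + 2`. -/
def PowerBounded (f : ℕ → ℕ) : Prop := ∃ e, ∀ a, f a ≤ (a + 2) ^ e

namespace PowerBounded

variable {f g : ℕ → ℕ}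

theorem const (c : ℕ) : PowerBounded fun _ => c :=
  ⟨c, fun a => Nat.lt_two_pow_self.le.trans (Nat.pow_le_pow_left (by omega) c)⟩

theorem id : PowerBounded fun a => a := ⟨1, fun a => by simp⟩

theorem mul (hf : PowerBounded f) (hg : PowerBounded g) : PowerBounded fun a => f a * g a := by
  obtain ⟨e, he⟩ := hf
  obtain ⟨e', he'⟩ := hg
  exact ⟨e + e', fun a => by rw [pow_add]; exact Nat.mul_le_mul (he a) (he' a)⟩

theorem add (hf : PowerBounded f) (hg : PowerBounded g) : PowerBounded fun a => f a + g a := by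
  obtain ⟨e, he⟩ := hf
  obtain ⟨e', he'⟩ := hg
  refine ⟨e + e' + 1, fun a => ?_⟩
  have h3 : (a + 2) ^ e ≤ (a + 2) ^ (e + e') := Nat.pow_le_pow_right (by omega) (by omega)
  have h4 : (a + 2) ^ e' ≤ (a + 2) ^ (e + e') := Nat.pow_le_pow_right (by omega) (by omega)
  have := he a
  have := he' a
  rw [pow_succ]
  nlinarith

theorem pow (hf : PowerBounded f) (n : ℕ) : PowerBounded fun a => f a ^ n := by
  obtain ⟨e, he⟩ := hf
  exact ⟨e * n, fun a => by rw [pow_mul]; exact Nat.pow_le_pow_left (he a) n⟩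

end PowerBounded

end PowerBounded

/-- A transformation of instances along which refutations can be transferred. -/
def IsTranslation (U V : Template) (red : FinStr V.L → FinStr U.L) : Prop :=
  (∃ f, PowerBounded f ∧ ∀ A, Nat.card (red A).dom ≤ f (Nat.card A.dom)) ∧
  ∀ (E : EncodingScheme U) (E' : EncodingScheme V), E.IsLocal → E'.IsLocal →
    ∃ (M d D₀ δ t₀ n₀ : ℕ) (N : ℕ → ℕ), PowerBounded N ∧ ∀ A,
      ∃ f, Translates (E.sys (red A)) (E'.sys A) f M d D₀ (N (Nat.card A.dom)) δ t₀ n₀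

/-! ### Homomorphic equivalence and constants. -/

section Constructions

variable {V : Template}

theorem EncodingScheme.IsLocal.forces_elem {E : EncodingScheme V} (hE : E.IsLocal) {δ : ℕ}
    (hδ : ∀ A, ∀ Q ∈ E.sys A, Bounded δ δ Q) (A : FinStr V.L) (a : A.dom) :
    Forces (E.sys A) 1 δ 0 1 fun v => ∃ y, ∀ b, v (Sum.inl (a, b)) = 1 ↔ y = b := by
  have hsub : ∀ g ∈ elemPolys E A a, g ∈ E.sys A := fun g hg => hE.mem_sys_iff.2 (Or.inl ⟨a, hg⟩)
  refine ⟨{a}, elemPolys E A a, by simp, fun g hg => ⟨(hδ A g (hsub g hg)).1, ?_,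
    Cone.of_mem (Or.inl (hsub g hg))⟩, fun v hv h => (elemPolys_nonneg_iff (hv.boolAt a)).1 h⟩
  obtain ⟨Q, _, rfl⟩ := hg
  exact renameVars_mem_supported fun x => Finset.mem_singleton.2 x.1.2

theorem EncodingScheme.IsLocal.forces_tuple {E : EncodingScheme V} (hE : E.IsLocal) {δ : ℕ}
    (hδ : ∀ A, ∀ Q ∈ E.sys A, Bounded δ δ Q) (A : FinStr V.L) {r : ℕ} {R : V.L.Relations r}
    {t : Fin r → A.dom} (ht : RelMap R t) :
    Forces (E.sys A) r δ 0 1 fun v =>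
      ∃ y : Fin r → V.B.dom, RelMap R y ∧ ∀ i b, v (Sum.inl (t i, b)) = 1 ↔ y i = b := by
  classical
  have hsub : ∀ g ∈ tuplePolys E A R t, g ∈ E.sys A := fun g hg =>
    hE.mem_sys_iff.2 (Or.inr ⟨r, R, t, ht, hg⟩)
  refine ⟨Finset.univ.image t, tuplePolys E A R t, Finset.card_image_le.trans (by simp),
    fun g hg => ⟨(hδ A g (hsub g hg)).1, ?_, Cone.of_mem (Or.inl (hsub g hg))⟩,
    fun v hv h => (tuplePolys_nonneg_iff fun i => hv.boolAt (t i)).1 h⟩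
  obtain ⟨Q, _, rfl⟩ := hg
  refine renameVars_mem_supported fun x => ?_
  obtain ⟨i, hi⟩ := x.1.2
  exact Finset.mem_image.2 ⟨i, Finset.mem_univ i, hi⟩

/-- The value of an element in `C` is sent to `U.B` by `h`, which preserves the constraint of every
tuple. -/
theorem isTranslation_homEquiv (U : Template) (C : FinStr U.L) (h : C.dom →[U.L] U.B.dom) :
    IsTranslation U { L := U.L, B := C } fun A => A := by
  refine ⟨⟨_, PowerBounded.id, fun A => le_rfl⟩, fun E E' hE hE' => ?_⟩
  obtain ⟨δ, hδ⟩ := hE'.exists_bounded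
  obtain ⟨m, hm⟩ := exists_arity_bound U.L
  obtain ⟨M, D₁, N₁, δ', n₀, H⟩ := exists_translates_bounds hE hE' 1 (m + 1) δ
  refine ⟨M, 1, 0 + D₁, δ', δ', n₀, fun _ => N₁ * (1 + 1), PowerBounded.const _, fun A => ?_⟩
  let G : Gadget A.dom C.dom A.dom U.B.dom :=
    ⟨fun x => {x}, fun x g => some (h (g ⟨x, Finset.mem_singleton_self x⟩))⟩
  have hG : ∀ (v : (A.dom × C.dom) ⊕ (A.dom × C.dom) → ℝ) (a : A.dom) (y : C.dom),
      (∀ b, v (Sum.inl (a, b)) = 1 ↔ y = b) → G.Holds v a (h y) := fun v a y hy => by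
    refine ⟨fun _ => y, ?_, rfl⟩
    intro a' b
    have h1 : a'.1 = a := Finset.mem_singleton.1 a'.2
    rw [h1]
    exact hy b
  refine ⟨G.subst, H A A G 0 1 (fun x => by simp [G]) (fun x => ?_) fun n R t ht => ?_⟩
  · refine ((hE'.forces_elem hδ A x).mono (by omega) le_rfl le_rfl le_rfl).imp ?_
    rintro v _ ⟨y, hy⟩
    exact ⟨_, hG v x y hy⟩
  · refine ((hE'.forces_tuple hδ A (R := R) ht).mono ((hm R).trans (by omega)) le_rfl le_rfl
      le_rfl).imp ?_
    rintro v _ ⟨y, hy, hv⟩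
    exact ⟨h ∘ y, h.map_rel R y hy, fun i => hG v (t i) (y i) (hv i)⟩

/-- Elements of `A` keep their values, and every `b` of the template is given the value `b`. Since
`a ∈ R_b(A)` forces the value `b` on `a`, replacing `b` by `a` in a tuple of the template does not
change the tuple of values. -/
theorem isTranslation_constants (U : Template) :
    IsTranslation U U.withConstants (constInst U) := by
  classical
  refine ⟨⟨_, PowerBounded.id.add (PowerBounded.const (Nat.card U.B.dom)), fun A => ?_⟩,
    fun E E' hE hE' => ?_⟩
  · exact (Nat.card_sum (α := A.dom) (β := U.B.dom)).le
  obtain ⟨δ, hδ⟩ := hE'.exists_bounded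
  obtain ⟨m, hm⟩ := exists_arity_bound U.L
  obtain ⟨M, D₁, N₁, δ', n₀, H⟩ := exists_translates_bounds hE hE' 1 (m + 1) δ
  refine ⟨M, 1, 0 + D₁, δ', δ', n₀, fun _ => N₁ * (1 + 1), PowerBounded.const _, fun A => ?_⟩
  let G : Gadget A.dom U.B.dom (A.dom ⊕ U.B.dom) U.B.dom :=
    ⟨Sum.elim (fun a => {a}) fun _ => ∅, fun x => match x with
      | Sum.inl a => fun g => some (g ⟨a, Finset.mem_singleton_self a⟩)
      | Sum.inr b => fun _ => some b⟩
  have hG : ∀ (v : (A.dom × U.B.dom) ⊕ (A.dom × U.B.dom) → ℝ) (a : A.dom) (y : U.B.dom),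
      (∀ b, v (Sum.inl (a, b)) = 1 ↔ y = b) → G.Holds v (Sum.inl a) y := fun v a y hy => by
    refine ⟨fun _ => y, ?_, rfl⟩
    intro a' b
    have h1 : a'.1 = a := Finset.mem_singleton.1 a'.2
    rw [h1]
    exact hy b
  have hG' : ∀ (v : (A.dom × U.B.dom) ⊕ (A.dom × U.B.dom) → ℝ) (b : U.B.dom),
      G.Holds v (Sum.inr b) b := fun v b =>
    ⟨fun a => absurd a.2 (Finset.notMem_empty _), fun a => absurd a.2 (Finset.notMem_empty _), rfl⟩
  refine ⟨G.subst, H A (constInst U A) G 0 1 ?_ ?_ ?_⟩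
  · rintro (a | b) <;> simp [G]
  · rintro (a | b)
    · refine ((hE'.forces_elem hδ A a).mono (by omega) le_rfl le_rfl le_rfl).imp ?_
      rintro v _ ⟨y, hy⟩
      exact ⟨_, hG v a y hy⟩
    · exact Forces.trivial fun v _ => ⟨b, hG' v b⟩
  · rintro n R t (⟨x, hx, rfl⟩ | ⟨y, hy, rfl⟩ | ⟨b, a, y, ha, hy, rfl⟩)
    · refine ((hE'.forces_tuple hδ A hx).mono ((hm R).trans (by omega)) le_rfl le_rfl
        le_rfl).imp ?_
      rintro v _ ⟨y, hy, hv⟩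
      exact ⟨y, hy, fun i => hG v (x i) (y i) (hv i)⟩
    · exact Forces.trivial fun v _ => ⟨y, hy, fun i => hG' v (y i)⟩
    · refine ((hE'.forces_tuple hδ A ha).mono (by omega) le_rfl le_rfl le_rfl).imp ?_
      rintro v _ ⟨y', hy', hv⟩
      have hb : y' 0 = b := hy'
      refine ⟨y, hy, fun i => ?_⟩
      by_cases hi : y i = b
      · simp only [hi, if_true]
        refine hG v a b fun b' => ?_
        rw [← hb]
        exact hv 0 b'
      · simp only [hi, if_false]
        exact hG' v (y i)

end Constructions

/-! ### Pp-interpretations -/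

namespace PPFormula

variable {L : FirstOrder.Language.{0, 0}}

theorem elim_comp {α D D' : Type} (F : D → D') (d : D) (e : α → D) :
    (fun o : Option α => o.elim (F d) (F ∘ e)) = F ∘ fun o => o.elim d e := by
  funext o
  cases o <;> rfl

/-- A satisfied formula has witnesses that satisfy all its atoms. -/
theorem exists_witnesses {D : Type} [L.Structure D] : ∀ {α : Type} (φ : PPFormula L α) {e : α → D},
    φ.Realize e → ∃ w : φ.Wit → D, (∀ n S x, φ.RelAtom e w n S x → RelMap S x) ∧
      ∀ x y, φ.EqAtom e w x y → x = y
  | _, eq i j, e, h => by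
    refine ⟨fun z => Empty.elim z, fun _ _ _ h => False.elim h, ?_⟩
    rintro _ _ ⟨rfl, rfl⟩
    exact h
  | _, rel R t, e, h => by
    refine ⟨fun z => Empty.elim z, fun n S x hx => ?_, fun _ _ h => False.elim h⟩
    simp only [RelAtom, Sigma.mk.injEq] at hx
    obtain ⟨rfl, hx⟩ := hx
    obtain ⟨rfl, rfl⟩ := Prod.mk.inj (eq_of_heq hx)
    exact h
  | _, and φ ψ, e, h => by
    obtain ⟨w, h1, h2⟩ := exists_witnesses φ h.1
    obtain ⟨w', h1', h2'⟩ := exists_witnesses ψ h.2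
    exact ⟨Sum.elim w w', fun n S x hx => hx.elim (h1 n S x) (h1' n S x),
      fun x y hx => hx.elim (h2 x y) (h2' x y)⟩
  | _, ex φ, e, h => by
    obtain ⟨d, h⟩ := h
    obtain ⟨w, h1, h2⟩ := exists_witnesses φ h
    exact ⟨fun o => o.elim d w, h1, h2⟩

/-- Atoms are syntactic and commute with any map of the replaced values. Every atom in an instance
is thus the image of an atom in the variables of the formula, to which `value` can be applied. -/
theorem relAtom_comp {D D' : Type} (F : D → D') {n : ℕ} {S : L.Relations n} {x' : Fin n → D'} :
    ∀ {α : Type} (φ : PPFormula L α) (e : α → D) (w : φ.Wit → D),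
      φ.RelAtom (F ∘ e) (F ∘ w) n S x' ↔ ∃ x, x' = F ∘ x ∧ φ.RelAtom e w n S x
  | _, eq _ _, _, _ => ⟨fun h => False.elim h, fun ⟨_, _, h⟩ => False.elim h⟩
  | _, rel R t, e, w => by
    constructor
    · intro h
      simp only [RelAtom, Sigma.mk.injEq] at h
      obtain ⟨rfl, h⟩ := h
      obtain ⟨rfl, rfl⟩ := Prod.mk.inj (eq_of_heq h)
      exact ⟨fun k => e (t k), rfl, rfl⟩
    · rintro ⟨x, rfl, h⟩
      simp only [RelAtom, Sigma.mk.injEq] at h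
      obtain ⟨rfl, h⟩ := h
      obtain ⟨rfl, rfl⟩ := Prod.mk.inj (eq_of_heq h)
      rfl
  | _, and φ ψ, e, w => by
    have h1 := relAtom_comp F (S := S) (x' := x') φ e (fun v => w (Sum.inl v))
    have h2 := relAtom_comp F (S := S) (x' := x') ψ e (fun v => w (Sum.inr v))
    refine (or_congr h1 h2).trans ?_
    simp only [RelAtom, and_or_left, exists_or]
  | _, ex φ, e, w => by
    have h := relAtom_comp F (S := S) (x' := x') φ (fun o => o.elim (w none) e)
      (fun v => w (some v))
    rw [← elim_comp] at h
    exact h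

theorem eqAtom_comp {D D' : Type} (F : D → D') {x' y' : D'} :
    ∀ {α : Type} (φ : PPFormula L α) (e : α → D) (w : φ.Wit → D),
      φ.EqAtom (F ∘ e) (F ∘ w) x' y' ↔ ∃ x y, x' = F x ∧ y' = F y ∧ φ.EqAtom e w x y
  | _, eq i j, e, _ => by
    constructor
    · rintro ⟨rfl, rfl⟩
      exact ⟨_, _, rfl, rfl, rfl, rfl⟩
    · rintro ⟨_, _, rfl, rfl, rfl, rfl⟩
      exact ⟨rfl, rfl⟩
  | _, rel _ _, _, _ => ⟨fun h => False.elim h, fun ⟨_, _, _, _, h⟩ => False.elim h⟩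
  | _, and φ ψ, e, w => by
    have h1 := eqAtom_comp F (x' := x') (y' := y') φ e (fun v => w (Sum.inl v))
    have h2 := eqAtom_comp F (x' := x') (y' := y') ψ e (fun v => w (Sum.inr v))
    refine (or_congr h1 h2).trans ?_
    simp only [EqAtom, and_or_left, exists_or]
  | _, ex φ, e, w => by
    have h := eqAtom_comp F (x' := x') (y' := y') φ (fun o => o.elim (w none) e)
      (fun v => w (some v))
    rw [← elim_comp] at h
    exact h

end PPFormula

theorem Gadget.Holds.eval_subst_eq {α β α' β' : Type} [Finite β] {G : Gadget α β α' β'}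
    {v : (α × β) ⊕ (α × β) → ℝ} (hv : IsBool v) {x y : α'} {b : β'} (hx : G.Holds v x b)
    (hy : G.Holds v y b) (b' : β') :
    eval v (G.subst (Sum.inl (x, b'))) = eval v (G.subst (Sum.inl (y, b'))) := by
  obtain ⟨h1, h2⟩ := hx.eval_subst hv
  obtain ⟨h3, h4⟩ := hy.eval_subst hv
  rcases (h1 b').1 with h | h <;> rcases (h3 b').1 with h' | h'
  · exact h.trans h'.symm
  · exact absurd (((h2 b').2 ((h4 b').1 h')).symm.trans h) one_ne_zero
  · exact absurd (((h4 b').2 ((h2 b').1 h)).symm.trans h') one_ne_zero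
  · exact h.trans h'.symm

/-- Inequalities along a path add up. -/
theorem Cone.of_eqvGen {α σ : Type} [Finite α] {H : Set (Poly σ)} {D N : ℕ} {P : α → Poly σ}
    {r : α → α → Prop}
    (h : ∀ x y, r x y → Cone H D N (P x - P y) ∧ Cone H D N (P y - P x)) {x y : α}
    (hxy : Relation.EqvGen r x y) : Cone H D (Nat.card α * N) (P x - P y) := by
  let _ := Fintype.ofFinite α
  have hreach : (SimpleGraph.fromRel r).Reachable x y := by
    induction hxy with
    | rel x y hr =>
      by_cases he : x = y
      · rw [he]
      · exact SimpleGraph.Adj.reachable ((SimpleGraph.fromRel_adj r x y).2 ⟨he, Or.inl hr⟩)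
    | refl x => exact SimpleGraph.Reachable.refl x
    | symm x y _ ih => exact ih.symm
    | trans x y z _ _ ih ih' => exact ih.trans ih'
  -- A derivation of equivalence has no a priori length bound, but a path without repetitions has
  -- fewer edges than there are vertices.
  obtain ⟨p, hp⟩ := hreach.exists_isPath
  have hlen := hp.length_lt
  rw [← Nat.card_eq_fintype_card] at hlen
  refine Cone.mono (N := p.length * N) ?_ le_rfl (Nat.mul_le_mul_right _ hlen.le)
  clear hp hlen hxy
  induction p with
  | nil => simpa using Cone.zero
  | @cons x y z hadj p ih =>
    have h1 : Cone H D N (P x - P y) := by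
      rcases ((SimpleGraph.fromRel_adj r x y).1 hadj).2 with h' | h'
      exacts [(h _ _ h').1, (h _ _ h').2]
    rw [SimpleGraph.Walk.length_cons, Nat.succ_mul, ← sub_add_sub_cancel (P x) (P y) (P z),
      Nat.add_comm]
    exact h1.add (ih (hreach := p.reachable))

namespace PPInterpretation

variable {U V : Template} (I : PPInterpretation U V)

/-- A preimage of `c`. -/
noncomputable def tup (c : V.B.dom) : Fin I.n → U.B.dom := (I.surj c).choose

theorem mem_tup (c : V.B.dom) : c ∈ I.f (I.tup c) := (I.surj c).choose_spec

theorem exists_wit {r : ℕ} {R : V.L.Relations r} {y : Fin r → V.B.dom} (h : RelMap R y) :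
    ∃ w : (I.relF R).Wit → U.B.dom,
      (∀ n S x, (I.relF R).RelAtom (fun p => I.tup (y p.1) p.2) w n S x → RelMap S x) ∧
      ∀ x x', (I.relF R).EqAtom (fun p => I.tup (y p.1) p.2) w x x' → x = x' :=
  PPFormula.exists_witnesses _ ((I.relF_iff R _).2 ⟨y, fun i => I.mem_tup (y i), h⟩)

/-- Values of the quantified variables of the formula that defines `R`. -/
noncomputable def wit {r : ℕ} {R : V.L.Relations r} {y : Fin r → V.B.dom} (h : RelMap R y) :
    (I.relF R).Wit → U.B.dom := (I.exists_wit h).choose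

/-- Values of all variables of the formula that defines `R`. -/
noncomputable def value {r : ℕ} {R : V.L.Relations r} {y : Fin r → V.B.dom} (h : RelMap R y) :
    (Fin r × Fin I.n) ⊕ (I.relF R).Wit → U.B.dom :=
  Sum.elim (fun p => I.tup (y p.1) p.2) (I.wit h)

theorem relMap_value {r : ℕ} {R : V.L.Relations r} {y : Fin r → V.B.dom} (h : RelMap R y) {n : ℕ}
    {S : U.L.Relations n} {s : Fin n → (Fin r × Fin I.n) ⊕ (I.relF R).Wit}
    (hs : (I.relF R).RelAtom Sum.inl Sum.inr n S s) : RelMap S (I.value h ∘ s) :=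
  (I.exists_wit h).choose_spec.1 n S _
    ((PPFormula.relAtom_comp (I.value h) (I.relF R) Sum.inl Sum.inr).2 ⟨s, rfl, hs⟩)

theorem value_eq {r : ℕ} {R : V.L.Relations r} {y : Fin r → V.B.dom} (h : RelMap R y)
    {s s' : (Fin r × Fin I.n) ⊕ (I.relF R).Wit} (hs : (I.relF R).EqAtom Sum.inl Sum.inr s s') :
    I.value h s = I.value h s' :=
  (I.exists_wit h).choose_spec.2 _ _
    ((PPFormula.eqAtom_comp (I.value h) (I.relF R) Sum.inl Sum.inr).2 ⟨s, s', rfl, rfl, hs⟩)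

open Classical in
/-- The copies of an element are assigned a preimage of its value, the fresh elements of a tuple
are assigned witnesses. -/
noncomputable def gadget (A : FinStr V.L) : Gadget A.dom V.B.dom (I.PreDom A) U.B.dom where
  dep := Sum.elim (fun p => {p.1}) fun p => Finset.univ.image p.1.1.2.2
  val x := match x with
    | Sum.inl p => fun g => some (I.tup (g ⟨p.1, Finset.mem_singleton_self p.1⟩) p.2)
    | Sum.inr ⟨q, w⟩ => fun g =>
      if h : RelMap q.1.2.1 fun i =>
          g ⟨q.1.2.2 i, Finset.mem_image_of_mem q.1.2.2 (Finset.mem_univ i)⟩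
        then some (I.wit h w) else none

theorem card_gadget_dep_le {m : ℕ} (hm : ∀ {r : ℕ} (_ : V.L.Relations r), r ≤ m) (A : FinStr V.L)
    (x : I.PreDom A) : ((I.gadget A).dep x).card ≤ m + 1 := by
  rcases x with p | ⟨q, w⟩
  · exact (Finset.card_singleton p.1).le.trans (Nat.le_add_left 1 m)
  · classical
    refine Finset.card_image_le.trans ?_
    rw [Finset.card_univ, Fintype.card_fin]
    exact (hm q.1.2.1).trans (Nat.le_succ m)

/-- The gadget of a fresh element sees only the values of the entries of `q`. These determine `y`,
hence also the chosen witnesses, even if entries repeat. -/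
theorem gadget_holds {A : FinStr V.L} {q : A.Tuple} {y : Fin q.1.1 → V.B.dom}
    (hy : RelMap q.1.2.1 y) {v : (A.dom × V.B.dom) ⊕ (A.dom × V.B.dom) → ℝ}
    (hv : ∀ i b, v (Sum.inl (q.1.2.2 i, b)) = 1 ↔ y i = b)
    (s : (Fin q.1.1 × Fin I.n) ⊕ (I.relF q.1.2.1).Wit) :
    (I.gadget A).Holds v (Sum.elim (I.freeVal A q) (I.witVal A q) s) (I.value hy s) := by
  classical
  rcases s with p | w
  · refine ⟨fun _ => y p.1, ?_, rfl⟩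
    intro a b
    have h1 : a.1 = q.1.2.2 p.1 := Finset.mem_singleton.1 a.2
    rw [h1]
    exact hv p.1 b
  · have hex : ∀ a : (I.gadget A).dep (Sum.inr ⟨q, w⟩), ∃ i, q.1.2.2 i = a.1 := fun a => by
      obtain ⟨i, _, hi⟩ := Finset.mem_image.1 a.2
      exact ⟨i, hi⟩
    choose ι hι using hex
    have hg : ∀ a b, v (Sum.inl (a.1, b)) = 1 ↔ y (ι a) = b := fun a b => by
      rw [← hι a]
      exact hv (ι a) b
    refine ⟨fun a => y (ι a), hg, ?_⟩
    have key : ∀ y', y' = y →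
        (if h : RelMap q.1.2.1 y' then some (I.wit h w) else none) = some (I.wit hy w) := by
      rintro _ rfl
      rw [dif_pos hy]
    refine key _ (funext fun i => ?_)
    exact ((hg ⟨q.1.2.2 i, _⟩ _).1 ((hv i (y i)).2 rfl))

end PPInterpretation

namespace PowerBounded

theorem finset_sum {ι : Type*} (s : Finset ι) {f : ι → ℕ → ℕ} (h : ∀ i ∈ s, PowerBounded (f i)) :
    PowerBounded fun a => ∑ i ∈ s, f i a := by
  classical
  induction s using Finset.induction_on with
  | empty => simpa using PowerBounded.const 0
  | insert i s hi ih =>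
    simp only [Finset.sum_insert hi]
    exact (h i (Finset.mem_insert_self i s)).add
      (ih fun j hj => h j (Finset.mem_insert_of_mem hj))

end PowerBounded

/-! ### Size of the transformed instance and its quotient by the equality atoms. -/

namespace PPInterpretation

variable {U V : Template} (I : PPInterpretation U V)

/-- For each of the finitely many symbols, of arity `r` say, there are at most `a ^ r` tuples, each
with a fixed number of fresh elements. -/
theorem exists_card_preDom_le :
    ∃ f, PowerBounded f ∧ ∀ A : FinStr V.L, Nat.card (I.PreDom A) ≤ f (Nat.card A.dom) := by
  let _ := Fintype.ofFinite (Σ n, V.L.Relations n)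
  refine ⟨fun a => a * I.n + ∑ R : (Σ n, V.L.Relations n), a ^ R.1 * Nat.card (I.relF R.2).Wit,
    (PowerBounded.id.mul (PowerBounded.const _)).add (PowerBounded.finset_sum _ fun R _ =>
      (PowerBounded.id.pow _).mul (PowerBounded.const _)), fun A => ?_⟩
  rw [Nat.card_sum, Nat.card_prod, Nat.card_fin]
  refine Nat.add_le_add_left ?_ _
  have h : Function.Injective (fun p : (Σ q : A.Tuple, (I.relF q.1.2.1).Wit) =>
      (⟨⟨p.1.1.1, p.1.1.2.1⟩, p.1.1.2.2, p.2⟩ :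
        Σ R : (Σ n, V.L.Relations n), (Fin R.1 → A.dom) × (I.relF R.2).Wit)) := by
    rintro ⟨⟨⟨r, R, t⟩, h⟩, w⟩ ⟨⟨⟨r', R', t'⟩, h'⟩, w'⟩ he
    simp only [Sigma.mk.injEq] at he
    obtain ⟨⟨rfl, h1⟩, h2⟩ := he
    obtain rfl := eq_of_heq h1
    obtain ⟨rfl, rfl⟩ := Prod.mk.inj (eq_of_heq h2)
    rfl
  refine (Nat.card_le_card_of_injective _ h).trans ?_
  rw [Nat.card_sigma]
  refine (Finset.sum_congr rfl fun R _ => ?_).le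
  rw [Nat.card_prod, Nat.card_fun, Nat.card_fin]

/-- The relation that generates the identifications. -/
def EqRel (A : FinStr V.L) (x y : I.PreDom A) : Prop :=
  ∃ q : A.Tuple, (I.relF q.1.2.1).EqAtom (I.freeVal A q) (I.witVal A q) x y

/-- A representative of an element. -/
noncomputable def rep (A : FinStr V.L) (z : (I.inst A).dom) : I.PreDom A :=
  Quot.out (r := I.EqRel A) z

theorem eqvGen_rep (A : FinStr V.L) (x : I.PreDom A) :
    Relation.EqvGen (I.EqRel A) (I.rep A (Quot.mk (I.EqRel A) x)) x :=
  Quot.eqvGen_exact (Quot.out_eq _)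

theorem totalDegree_gadget_sub_le {m : ℕ} (hm : ∀ {r : ℕ} (_ : V.L.Relations r), r ≤ m)
    (A : FinStr V.L) (x y : I.PreDom A) (b : U.B.dom) :
    ((I.gadget A).subst (Sum.inl (x, b)) - (I.gadget A).subst (Sum.inl (y, b))).totalDegree ≤
      m + 1 :=
  (totalDegree_sub _ _).trans (max_le
    (Gadget.isMonomialSubst (I.card_gadget_dep_le hm A) _).bounded.1
    (Gadget.isMonomialSubst (I.card_gadget_dep_le hm A) _).bounded.1)

open Classical in
theorem gadget_sub_mem_supported (A : FinStr V.L) (x y : I.PreDom A) (b : U.B.dom) :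
    (I.gadget A).subst (Sum.inl (x, b)) - (I.gadget A).subst (Sum.inl (y, b)) ∈
      supported ℝ (literals {p : A.dom × V.B.dom |
        p.1 ∈ (I.gadget A).dep x ∪ (I.gadget A).dep y}) :=
  sub_mem (Gadget.subst_mem_supported Finset.subset_union_left)
    (Gadget.subst_mem_supported Finset.subset_union_right)

/-- The values of identified elements are provably equal. -/
theorem exists_cone_sub {E' : EncodingScheme V} (hE' : E'.IsLocal) :
    ∃ D N : ℕ, ∀ (A : FinStr V.L) (x y : I.PreDom A), I.EqRel A x y → ∀ b,
      Cone (E'.sys A) D N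
        ((I.gadget A).subst (Sum.inl (x, b)) - (I.gadget A).subst (Sum.inl (y, b))) ∧
      Cone (E'.sys A) D N
        ((I.gadget A).subst (Sum.inl (y, b)) - (I.gadget A).subst (Sum.inl (x, b))) := by
  classical
  obtain ⟨δ, hδ⟩ := hE'.exists_bounded
  obtain ⟨m, hm⟩ := exists_arity_bound V.L
  obtain ⟨D₁, N₁, H⟩ := exists_forces_bounds (2 * (m + 1)) (δ + (m + 1)) (Nat.card V.B.dom)
  refine ⟨0 + D₁, N₁ * (1 + 1), fun A x y ⟨q, hq⟩ b => ?_⟩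
  have hcard : ∀ x y, ((I.gadget A).dep x ∪ (I.gadget A).dep y).card ≤ 2 * (m + 1) := fun x y => by
    have h1 := I.card_gadget_dep_le hm A x
    have h2 := I.card_gadget_dep_le hm A y
    exact (Finset.card_union_le _ _).trans (by omega)
  have hforces := (hE'.forces_tuple hδ A q.2).mono (δ' := δ + (m + 1)) (ρ' := 2 * (m + 1))
    ((hm q.1.2.1).trans (by omega)) (Nat.le_add_right _ _) le_rfl le_rfl
  -- The constraint of the tuple `q` that generates the identification determines both values, and
  -- the chosen witnesses satisfy its equality atoms.
  have heq : ∀ v, IsBool v → (∃ z : Fin q.1.1 → V.B.dom, RelMap q.1.2.1 z ∧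
      ∀ i b, v (Sum.inl (q.1.2.2 i, b)) = 1 ↔ z i = b) →
      eval v ((I.gadget A).subst (Sum.inl (x, b))) =
        eval v ((I.gadget A).subst (Sum.inl (y, b))) := by
    rintro v hv ⟨z, hz, hvz⟩
    obtain ⟨s, s', rfl, rfl, hs⟩ := (PPFormula.eqAtom_comp
      (Sum.elim (I.freeVal A q) (I.witVal A q)) (I.relF q.1.2.1) Sum.inl Sum.inr).1 hq
    have h1 := I.value_eq hz hs
    have h2 := I.gadget_holds hz hvz s'
    rw [← h1] at h2
    exact (I.gadget_holds hz hvz s).eval_subst_eq hv h2 b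
  constructor
  · refine H _ _ _ _ _ _ le_rfl (hcard x y)
      ((I.totalDegree_gadget_sub_le hm A x y b).trans (Nat.le_add_left _ _))
      (I.gadget_sub_mem_supported A x y b) hforces fun v hv h => ?_
    rw [map_sub, heq v hv h, sub_self]
  · refine H _ _ _ _ _ _ le_rfl (hcard y x)
      ((I.totalDegree_gadget_sub_le hm A y x b).trans (Nat.le_add_left _ _))
      (I.gadget_sub_mem_supported A y x b) hforces fun v hv h => ?_
    rw [map_sub, heq v hv h, sub_self]

/-- Every element is given the value of its representative. -/
noncomputable def quotGadget (A : FinStr V.L) :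
    Gadget A.dom V.B.dom (I.inst A).dom U.B.dom where
  dep z := (I.gadget A).dep (I.rep A z)
  val z := (I.gadget A).val (I.rep A z)

theorem forces_gadget {E' : EncodingScheme V} (hE' : E'.IsLocal) {δ m : ℕ}
    (hδ : ∀ A, ∀ Q ∈ E'.sys A, Bounded δ δ Q) (hm : ∀ {r : ℕ} (_ : V.L.Relations r), r ≤ m)
    (A : FinStr V.L) (x : I.PreDom A) :
    Forces (E'.sys A) (m + 1) δ 0 1 fun v => ∃ b, (I.gadget A).Holds v x b := by
  rcases x with ⟨a, i⟩ | ⟨q, w⟩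
  · refine ((hE'.forces_elem hδ A a).mono (Nat.le_add_left _ _) le_rfl le_rfl le_rfl).imp ?_
    rintro v _ ⟨y, hy⟩
    refine ⟨_, fun _ => y, ?_, rfl⟩
    intro a' b
    have h1 : a'.1 = a := Finset.mem_singleton.1 a'.2
    rw [h1]
    exact hy b
  · refine ((hE'.forces_tuple hδ A q.2).mono ((hm q.1.2.1).trans (Nat.le_succ m)) le_rfl le_rfl
      le_rfl).imp ?_
    rintro v _ ⟨y, hy, hv⟩
    exact ⟨_, I.gadget_holds hy hv (Sum.inr w)⟩

/-- The constraint of `q` determines the values of the elements `x i` in its atoms, but their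
representatives `z i` may stem from distant tuples. The inequalities that compare the variables of
`z i` with those of `x i` are derived along paths and used as auxiliary hypotheses. The relation on
the representatives then follows locally. -/
theorem isTranslation : IsTranslation U V I.inst := by
  classical
  obtain ⟨f, hf, hcard⟩ := I.exists_card_preDom_le
  refine ⟨⟨f, hf, fun A => ?_⟩, fun E E' hE hE' => ?_⟩
  · exact (Nat.card_le_card_of_surjective (Quot.mk (I.EqRel A)) Quot.mk_surjective).trans (hcard A)
  obtain ⟨δ, hδ⟩ := hE'.exists_bounded
  obtain ⟨m, hm⟩ := exists_arity_bound V.L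
  obtain ⟨m', hm'⟩ := exists_arity_bound U.L
  obtain ⟨D₀, N₀, hsub⟩ := I.exists_cone_sub hE'
  obtain ⟨M, D₁, N₁, δ', n₀, H⟩ := exists_translates_bounds hE hE' (m + 1)
    -- The elements needed are those of `q` and, for each of the at most `m'` entries of the atom,
    -- those that give `z i` a value and those in the comparison of `z i` with `x i`.
    (m + 1 + m' * (m + 1 + 2 * (m + 1))) (δ + (m + 1))
  refine ⟨M, m + 1, D₀ + D₁, δ', δ', n₀, fun a => N₁ * (f a * N₀ + 1 + 1),
    (PowerBounded.const _).mul (((hf.mul (PowerBounded.const _)).add (PowerBounded.const 1)).add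
      (PowerBounded.const 1)), fun A => ⟨(I.quotGadget A).subst, ?_⟩⟩
  set N := f (Nat.card A.dom) * N₀ + 1
  have helem : ∀ x, Forces (E'.sys A) (m + 1) (δ + (m + 1)) D₀ N
      fun v => ∃ b, (I.gadget A).Holds v x b := fun x =>
    (I.forces_gadget hE' hδ hm A x).mono le_rfl (Nat.le_add_right _ _) (Nat.zero_le _)
      (Nat.le_add_left _ _)
  refine H A (I.inst A) (I.quotGadget A) D₀ N (fun z => I.card_gadget_dep_le hm A _)
    (fun z => (helem (I.rep A z)).mono (Nat.le_add_right _ _) le_rfl le_rfl le_rfl) ?_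
  rintro n S _ ⟨q, x, hx, rfl⟩
  let z : Fin n → I.PreDom A := fun i => I.rep A (Quot.mk (I.EqRel A) (x i))
  have hdiff : ∀ i, Forces (E'.sys A) (2 * (m + 1)) (δ + (m + 1)) D₀ N fun v => ∀ b,
      0 ≤ eval v ((I.gadget A).subst (Sum.inl (z i, b)) -
        (I.gadget A).subst (Sum.inl (x i, b))) := fun i => by
    refine ⟨(I.gadget A).dep (z i) ∪ (I.gadget A).dep (x i),
      Set.range fun b => (I.gadget A).subst (Sum.inl (z i, b)) -
        (I.gadget A).subst (Sum.inl (x i, b)), ?_, ?_, fun v _ h b => h _ ⟨b, rfl⟩⟩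
    · have h1 := I.card_gadget_dep_le hm A (z i)
      have h2 := I.card_gadget_dep_le hm A (x i)
      exact (Finset.card_union_le _ _).trans (by omega)
    · rintro _ ⟨b, rfl⟩
      refine ⟨(I.totalDegree_gadget_sub_le hm A _ _ b).trans (Nat.le_add_left _ _),
        I.gadget_sub_mem_supported A _ _ b, ?_⟩
      exact (Cone.of_eqvGen (P := fun x => (I.gadget A).subst (Sum.inl (x, b)))
        (fun x y h => hsub A x y h b) (I.eqvGen_rep A (x i))).mono le_rfl
          ((Nat.mul_le_mul_right _ (hcard A)).trans (Nat.le_succ _))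
  have htuple : Forces (E'.sys A) (m + 1) (δ + (m + 1)) D₀ N _ :=
    (hE'.forces_tuple hδ A q.2).mono ((hm q.1.2.1).trans (Nat.le_succ m))
      (Nat.le_add_right _ _) (Nat.zero_le _) (Nat.le_add_left _ _)
  refine ((htuple.and (Forces.forall fun i => (helem (z i)).and (hdiff i))).mono
    (Nat.add_le_add_left (Nat.mul_le_mul_right _ (hm' S)) _) le_rfl le_rfl le_rfl).imp ?_
  rintro v hv ⟨⟨y, hy, hvy⟩, hz⟩
  obtain ⟨s, hxs, hs⟩ := (PPFormula.relAtom_comp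
    (Sum.elim (I.freeVal A q) (I.witVal A q)) (I.relF q.1.2.1) Sum.inl Sum.inr).1 hx
  refine ⟨_, I.relMap_value hy hs, fun i => ?_⟩
  obtain ⟨⟨b, hb⟩, hpos⟩ := hz i
  have h1 : (I.gadget A).Holds v (x i) (I.value hy (s i)) := by
    rw [hxs]
    exact I.gadget_holds hy hvy (s i)
  obtain ⟨-, h2⟩ := h1.eval_subst hv
  obtain ⟨h3, h4⟩ := hb.eval_subst hv
  have h5 := hpos (I.value hy (s i))
  -- One direction of the comparison suffices: the variable of `x i` at its value is `1`, so that of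
  -- `z i` is not `0`.
  have h7 : b = I.value hy (s i) := by
    refine (h4 _).1 ((h3 _).1.resolve_left fun h0 => ?_)
    have h8 : eval v ((I.gadget A).subst (Sum.inl (x i, I.value hy (s i)))) = 1 := (h2 _).2 rfl
    have h9 := (map_sub (eval v) _ _ ▸ h5).trans_eq (congr_arg₂ (· - ·) h0 h8)
    norm_num at h9
  rw [h7] at hb
  exact hb

end PPInterpretation

/-! ### Sequences of constructions -/

/-- Refutations can be transferred along `red` with a linear increase of the degree and a polynomial
increase of the size. -/
def IsTransfer (T V : Template) (red : FinStr V.L → FinStr T.L) : Prop :=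
  ∀ (E : EncodingScheme T) (E' : EncodingScheme V), E.IsLocal → E'.IsLocal → ∃ c e : ℕ,
    ∀ (S : ProofSystem) (k s : ℕ), 0 < k → 0 < s → ∀ A : FinStr V.L,
      S.Refutes (E.sys (red A)) k s →
      S.Refutes (E'.sys A) (c * k) ((2 ^ k * s * (Nat.card A.dom + 2)) ^ e)

theorem IsTranslation.isTransfer {U V : Template} {red : FinStr V.L → FinStr U.L}
    (h : IsTranslation U V red) : IsTransfer U V red := fun E E' hE hE' => by
  obtain ⟨M, d, D₀, δ, t₀, n₀, N, ⟨e', hN⟩, H⟩ := h.2 E E' hE hE'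
  obtain ⟨c, e, hce⟩ := exists_transfer_bounds M d D₀ δ t₀ n₀
  refine ⟨c, (e' + 2) * e, fun S k s hk hs A hA => ?_⟩
  obtain ⟨f, hf⟩ := H A
  refine (hce hf S k s hk hs hA).mono le_rfl ?_
  rw [pow_mul]
  refine Nat.pow_le_pow_left ?_ e
  have h1 : 1 ≤ 2 ^ k * s := Nat.mul_pos (by positivity) hs
  have h2 : N (Nat.card A.dom) + 2 ≤ (Nat.card A.dom + 2) ^ (e' + 2) := by
    have h3 := hN (Nat.card A.dom)
    have h4 : 1 ≤ (Nat.card A.dom + 2) ^ e' := Nat.one_le_pow _ _ (by omega)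
    calc _ ≤ (Nat.card A.dom + 2) ^ e' * 2 ^ 2 := by omega
      _ ≤ _ := Nat.mul_le_mul_left _ (Nat.pow_le_pow_left (Nat.le_add_left 2 _) 2)
      _ = _ := (pow_add _ _ _).symm
  rw [mul_pow]
  exact Nat.mul_le_mul (Nat.le_self_pow (by omega) _) h2

/-- A transfer may be followed by a translation. -/
theorem IsTransfer.comp {T U V : Template} {red : FinStr U.L → FinStr T.L}
    {red' : FinStr V.L → FinStr U.L} (h : IsTransfer T U red) (h' : IsTranslation U V red') :
    IsTransfer T V fun A => red (red' A) := fun E E' hE hE' => by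
  obtain ⟨f, ⟨e₀, hf⟩, hcard⟩ := h'.1
  -- The refutation passes through the direct encoding of the intermediate template.
  obtain ⟨c₁, e₁, h₁⟩ := h E (directScheme U) hE (directScheme_isLocal U)
  obtain ⟨c₂, e₂, h₂⟩ := h'.isTransfer (directScheme U) E' (directScheme_isLocal U) hE'
  -- Using `c₁ + 1` keeps the intermediate degree positive. With `B = 2 ^ k * s * (a + 2)`, the
  -- three factors of the second bound are at most `B ^ (c₁ + 1)`, `B ^ ((e₀ + 2) * e₁)` and `B`.
  refine ⟨c₂ * (c₁ + 1), (c₁ + 1 + (e₀ + 2) * e₁ + 1) * e₂, fun S k s hk hs A hA => ?_⟩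
  have h3 := h₁ S k s hk hs (red' A) hA
  set a := Nat.card A.dom
  set B := 2 ^ k * s * (a + 2)
  have hB1 : 1 ≤ 2 ^ k * s := Nat.mul_pos (by positivity) hs
  have ha : a + 2 ≤ B := Nat.le_mul_of_pos_left _ hB1
  have hB : 0 < B := (Nat.succ_pos _).trans_le ha
  have hred : Nat.card (red' A).dom + 2 ≤ (a + 2) ^ (e₀ + 2) := by
    have h4 := (hcard A).trans (hf a)
    have h5 : 1 ≤ (a + 2) ^ e₀ := Nat.one_le_pow _ _ (by omega)
    calc _ ≤ (a + 2) ^ e₀ * 2 ^ 2 := by omega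
      _ ≤ _ := Nat.mul_le_mul_left _ (Nat.pow_le_pow_left (Nat.le_add_left 2 _) 2)
      _ = _ := (pow_add _ _ _).symm
  have hsize : (2 ^ k * s * (Nat.card (red' A).dom + 2)) ^ e₁ ≤ B ^ ((e₀ + 2) * e₁) := by
    rw [pow_mul]
    refine Nat.pow_le_pow_left ?_ e₁
    rw [mul_pow]
    exact Nat.mul_le_mul (Nat.le_self_pow (by omega) _) hred
  have h4 := h₂ S ((c₁ + 1) * k) (B ^ ((e₀ + 2) * e₁)) (by positivity) (by positivity) A
    (h3.mono (Nat.mul_le_mul_right _ (Nat.le_succ _)) hsize)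
  refine h4.mono (by rw [mul_assoc]) ?_
  rw [pow_mul B (c₁ + 1 + (e₀ + 2) * e₁ + 1) e₂]
  refine Nat.pow_le_pow_left ?_ e₂
  rw [pow_add, pow_add, pow_one]
  refine Nat.mul_le_mul (Nat.mul_le_mul_right _ ?_) ha
  rw [mul_comm, pow_mul]
  refine Nat.pow_le_pow_left ?_ _
  calc 2 ^ k ≤ 2 ^ k * (s * (a + 2)) := Nat.le_mul_of_pos_right _ (by positivity)
    _ = B := (mul_assoc _ _ _).symm

/-- The empty sequence still has to change the encoding from `E` to `E'`. It is treated as a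
homomorphic equivalence by the identity. -/
theorem Reduction.isTransfer {T : Template} : ∀ {T' : Template} (ρ : Reduction T T'),
    IsTransfer T T' ρ.inst
  | _, refl => (isTranslation_homEquiv T T.B (FirstOrder.Language.Hom.id T.L T.B.dom)).isTransfer
  | _, interp ρ I => ρ.isTransfer.comp I.isTranslation
  | _, homEquiv (U := U) ρ C _ h' => ρ.isTransfer.comp (isTranslation_homEquiv U C h'.some)
  | _, constants (U := U) ρ _ => ρ.isTransfer.comp (isTranslation_constants U)

end CSPClosure

open CSPClosure in
theorem mainTheorem5 (T T' : Template) (ρ : Reduction T T')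
    (E : EncodingScheme T) (E' : EncodingScheme T') (hE : E.IsLocal) (hE' : E'.IsLocal) :
    ∃ (c : ℕ) (p : MvPolynomial (Fin 3) ℕ),
      ∀ (S : ProofSystem) (k s : ℕ), 0 < k → 0 < s → ∀ A : FinStr T'.L,
        S.Refutes (E.sys (ρ.inst A)) k s →
        S.Refutes (E'.sys A) (c * k) (MvPolynomial.eval ![2 ^ k, s, Nat.card A.dom] p) := by
  obtain ⟨c, e, h⟩ := ρ.isTransfer E E' hE hE'
  refine ⟨c, (MvPolynomial.X 0 * MvPolynomial.X 1 *
    (MvPolynomial.X 2 + MvPolynomial.C 2)) ^ e, fun S k s hk hs A hA => ?_⟩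
  have h1 := h S k s hk hs A hA
  simpa using h1
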